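/- **Setting.** Let $d\ge 2$, let $\Omega\subset\mathbb R^d$ be a bounded Lipschitz domain (nonempty, open, connected) such that $\Omega\cap\{x_d=t\}$ is connected for every $t\in\mathbb R$ for which it is nonempty. Let $\kappa>0$, $A=\mathrm{Id}$, $B=\mathrm{diag}(1,\dots,1,1+\kappa)$, and let $W:\mathbb R^{d\times d}\to[0,\infty)$ be continuous with $W(RF)=W(F)$ for $R\in SO(d)$, $W(A)=W(B)=0$ and $W(F)\ge c_1\,\mathrm{dist}^2(F,SO(d)\{A,B\})$ for some $c_1>0$ (Frobenius norm). For $\varepsilon>0$ and $y\in H^2(\Omega;\mathbb R^d)$ set, with $\eta_\varepsilon=\varepsilon^{-1+1/(2d)}$, $$\mathcal E_\varepsilon(y)=\frac1{\varepsilon^2}\int_\Omega W(\nabla y)\,dx+\varepsilon^2\int_\Omega|\nabla^2y|^2dx+\eta_\varepsilon^2\int_\Omega\big(|\nabla^2y|^2-|\partial^2_{dd}y|^2\big)dx .$$ Let $\varepsilon=\varepsilon_n>0$, $\varepsilon_n\to0$, and let $y^\varepsilon\in H^2(\Omega;\mathbb R^d)$ satisfy $\sup_\varepsilon\mathcal E_\varepsilon(y^\varepsilon)<\infty$.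 Fix an exponent $p\in(1,2)$. **Function classes.** A Caccioppoli partition of $\Omega$ is a finite or countable family $\mathcal P=\{P_j\}_j$ of measurable subsets of $\Omega$ that are disjoint and cover $\Omega$ up to null sets, ordered by decreasing measure, with $\sum_j\mathcal H^{d-1}(\partial^*P_j)<\infty$, where $\partial^*$ is the essential boundary; a finite partition is continued by empty sets. $\mathscr P(\Omega)$ is the class of those with $\bigcup_j\partial P_j\cap\Omega\subset\bigcup_{i\in\mathbb N}(\mathbb R^{d-1}\times\{s_i\})$ for some $s_i\in\mathbb R$. $\mathscr U(\Omega)$ is the class of $u\in SBV^2_{\rm loc}(\Omega;\mathbb R^d)$ with jump set $J_u\subset\bigcup_{i\in\mathbb N}(\mathbb R^{d-1}\times\{s_i\})$ for some $s_i\in\mathbb R$. For $R\in SO(d)$, $\mathcal Y_R(\Omega)$ is the class of $y\in H^1(\Omega;\mathbb R^d)$ with mean value $0$ and $\nabla y\in BV(\Omega;R\{A,B\})$. For $\Omega'\subset\Omega$ put $L_{\Omega'}(S)=\{x\in\Omega':x_d=z_d\text{ for some }z\in S\}$. **Admissible triples.** A triple $(y,u,\mathcal P)$ with $y\in\bigcup_{R\in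 SO(d)}\mathcal Y_R(\Omega)$, $u\in\mathscr U(\Omega)$, $\mathcal P=\{P_j\}_j\in\mathscr P(\Omega)$ is *admissible* for $\{y^\varepsilon\}$ if there are rotations $R^\varepsilon\in SO(d)$, Caccioppoli partitions $\{P^\varepsilon_j\}_j$ of $\Omega$, phases $M^\varepsilon_j\in\{A,B\}$ and translations $t^\varepsilon_j\in\mathbb R^d$ such that 1. $\sup_\varepsilon\mathcal H^{d-1}(\bigcup_j\partial^*P^\varepsilon_j)<\infty$, and for every open $\Omega'\subset\subset\Omega$ there is $C_{\Omega'}$ with, for all $\varepsilon$, $\sum_j\min\{\mathcal L^d(\Omega'\cap P^\varepsilon_j),\mathcal L^d(L_{\Omega'}(P^\varepsilon_j)\setminus P^\varepsilon_j)\}\le C_{\Omega'}\varepsilon^p$ and $\|\nabla y^\varepsilon-\sum_jR^\varepsilon M^\varepsilon_j\chi_{P^\varepsilon_j}\|_{L^2(\Omega')}\le C_{\Omega'}\varepsilon$; 2. $R^\varepsilon\to R$ for some $R\in SO(d)$ with $y\in\mathcal Y_R(\Omega)$; $\mathcal L^d(P^\varepsilon_j\triangle P_j)\to0$ for all $j$;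 $y^\varepsilon-\frac{1}{\mathcal L^d(\Omega)}\int_\Omega y^\varepsilon\,dx\to y$ strongly in $H^1(\Omega;\mathbb R^d)$; $\sum_jR^\varepsilon M^\varepsilon_j\chi_{P^\varepsilon_j}\rightharpoonup^*\nabla y$ weakly* in $BV(\Omega;\mathbb R^{d\times d})$; 3. $|t^\varepsilon_i-t^\varepsilon_j|/\varepsilon\to\infty$ whenever $i\ne j$, $\mathcal L^d(P_i),\mathcal L^d(P_j)>0$ and $\lim_{\varepsilon\to0}M^\varepsilon_i=\lim_{\varepsilon\to0}M^\varepsilon_j$; 4. the maps $u^\varepsilon=\varepsilon^{-1}\big(y^\varepsilon-\sum_j(R^\varepsilon M^\varepsilon_jx+t^\varepsilon_j)\chi_{P^\varepsilon_j}\big)$ converge to $u$ in measure in $\Omega$, and their approximate gradients satisfy $\nabla u^\varepsilon\rightharpoonup\nabla u$ weakly in $L^2_{\rm loc}(\Omega;\mathbb R^{d\times d})$. Let $\mathscr T(y,\mathcal P)$ be the set of all maps $T:\Omega\to\mathbb R^d$ of the form $T(x)=\sum_jt_j\chi_{P_j}(x)+S\,\nabla y(x)\,x$ (almost everywhere) with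 $t_j\in\mathbb R^d$ and $S\in\mathbb R^{d\times d}$ skew-symmetric. **Proposition.** Let $(y^1,u^1,\mathcal P^1)$ and $(y^2,u^2,\mathcal P^2)$ be admissible for $\{y^\varepsilon\}$. Then (with equality of maps and of sets up to null sets): (i) $y^1=y^2$, and $\mathcal P^1=\mathcal P^2$ up to reordering of the sets; (ii) $\mathscr T(y^1,\mathcal P^1)=\mathscr T(y^2,\mathcal P^2)$, and there is $T\in\mathscr T(y^1,\mathcal P^1)$ with $u^1-u^2=T$; (iii) for each $\tilde T\in\mathscr T(y^1,\mathcal P^1)$, the triple $(y^1,u^1+\tilde T,\mathcal P^1)$ is admissible for $\{y^\varepsilon\}$. -/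

import Mathlib

open MeasureTheory Filter Topology Set
open scoped ENNReal NNReal ContDiff symmDiff RealInnerProductSpace

noncomputable section

namespace TwoWell

/-- The Euclidean space `ℝ^d`. -/
abbrev Vec (d : ℕ) := EuclideanSpace ℝ (Fin d)

/-- Real `d × d` matrices. -/
abbrev Mat (d : ℕ) := Matrix (Fin d) (Fin d) ℝ

variable {d : ℕ}

/-- Matrix-vector product `F x` on `ℝ^d`. -/
def act (F : Mat d) (x : Vec d) : Vec d := Matrix.toEuclideanLin F x

/-- The square `|F|²` of the Frobenius norm. -/
def frobSq (F : Mat d) : ℝ := ∑ i, ∑ j, F i j ^ 2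

/-- The squared Frobenius distance `dist²(F, K)`. -/
def frobDistSq (F : Mat d) (K : Set (Mat d)) : ℝ := sInf ((fun G => frobSq (F - G)) '' K)

/-- `SO(d)`, as a set of matrices. -/
def rotations (d : ℕ) : Set (Mat d) := {R | R ∈ Matrix.specialOrthogonalGroup (Fin d) ℝ}

/-! ### Domains -/

/-- Open connected nonempty set whose boundary is locally, after a rotation, the graph of a
Lipschitz function, the set lying locally on one side of the graph. The graph function is
evaluated only on the hyperplane orthogonal to `ν`. -/
structure IsLipschitzDomain (Ω : Set (Vec d)) : Prop where
  isOpen : IsOpen Ω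
  isConnected : IsConnected Ω
  graph : ∀ x ∈ frontier Ω, ∃ r > 0, ∃ ν : Vec d, ‖ν‖ = 1 ∧ ∃ (K : ℝ≥0) (γ : Vec d → ℝ),
    LipschitzWith K γ ∧ ∀ z ∈ Metric.ball x r, z ∈ Ω ↔ γ (z - ⟪ν, z⟫ • ν) < ⟪ν, z⟫

/-- `O ⊂⊂ Ω`, for open `O`. -/
def CompactlyIn (O Ω : Set (Vec d)) : Prop :=
  IsOpen O ∧ IsCompact (closure O) ∧ closure O ⊆ Ω

/-! ### Weak derivatives and Sobolev spaces -/

/-- Test functions: `C_c^∞(Ω)`. -/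
def IsTest (Ω : Set (Vec d)) (φ : Vec d → ℝ) : Prop :=
  ContDiff ℝ ∞ φ ∧ HasCompactSupport φ ∧ tsupport φ ⊆ Ω

/-- The classical partial derivative `∂_i φ`. -/
def pderiv (i : Fin d) (φ : Vec d → ℝ) (x : Vec d) : ℝ :=
  fderiv ℝ φ x (EuclideanSpace.single i 1)

/-- `g` is the weak partial derivative `∂_i f` in `Ω`. -/
def HasWeakPartial (Ω : Set (Vec d)) (i : Fin d) (f g : Vec d → ℝ) : Prop :=
  LocallyIntegrableOn f Ω ∧ LocallyIntegrableOn g Ω ∧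
    ∀ φ, IsTest Ω φ → (∫ x in Ω, f x * pderiv i φ x) = - (∫ x in Ω, g x * φ x)

open Classical in
/-- A representative of the weak partial derivative `∂_i f` in `Ω` (zero if there is none);
it is determined up to null sets. -/
def weakPartial (Ω : Set (Vec d)) (i : Fin d) (f : Vec d → ℝ) : Vec d → ℝ :=
  if h : ∃ g, HasWeakPartial Ω i f g then h.choose else 0

/-- Scalar functions in `H¹(Ω)`. -/
def MemH1Scalar (Ω : Set (Vec d)) (f : Vec d → ℝ) : Prop :=
  MemLp f 2 (volume.restrict Ω) ∧
    ∀ i, ∃ g, HasWeakPartial Ω i f g ∧ MemLp g 2 (volume.restrict Ω)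

/-- `H¹(Ω; ℝ^d)`. -/
def MemH1 (Ω : Set (Vec d)) (y : Vec d → Vec d) : Prop :=
  ∀ k, MemH1Scalar Ω (fun x => y x k)

/-- `H²(Ω; ℝ^d)`: the map and all its first weak derivatives are in `H¹`. -/
def MemH2 (Ω : Set (Vec d)) (y : Vec d → Vec d) : Prop :=
  MemH1 Ω y ∧ ∀ k i, MemH1Scalar Ω (weakPartial Ω i (fun x => y x k))

/-- The weak gradient `∇y`, with entry `∂_i y_k` in row `k` and column `i`. -/
def grad (Ω : Set (Vec d)) (y : Vec d → Vec d) (x : Vec d) : Mat d :=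
  Matrix.of fun k i => weakPartial Ω i (fun z => y z k) x

/-- The second weak derivative `∂_j ∂_i y_k`. -/
def hess (Ω : Set (Vec d)) (y : Vec d → Vec d) (x : Vec d) (k i j : Fin d) : ℝ :=
  weakPartial Ω j (weakPartial Ω i (fun z => y z k)) x

/-! ### Functions of bounded variation -/

/-- The finite signed measure `μ`, carried by `Ω`, is the distributional derivative `D_i f` of `f`
in `Ω`. -/
def HasDistribDeriv (Ω : Set (Vec d)) (i : Fin d) (f : Vec d → ℝ)
    (μ : SignedMeasure (Vec d)) : Prop :=
  μ.totalVariation Ωᶜ = 0 ∧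
    ∀ φ, IsTest Ω φ → (∫ x in Ω, f x * pderiv i φ x) = - (∫ᵛ x, φ x ∂•μ)

/-- `BV(Ω)`, for scalar functions. -/
def MemBV (Ω : Set (Vec d)) (f : Vec d → ℝ) : Prop :=
  IntegrableOn f Ω ∧ ∀ i, ∃ μ, HasDistribDeriv Ω i f μ

/-- Weak* convergence `F n ⇀* F₀` in `BV(Ω)`: the functions are in `BV(Ω)`, they converge in
`L¹(Ω)`, and their derivatives converge weakly* as measures, tested with the continuous functions
that vanish outside the bounded set `Ω`. -/
def TendstoWeakStarBV (Ω : Set (Vec d)) (F : ℕ → Vec d → ℝ) (F₀ : Vec d → ℝ) : Prop :=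
  (∀ n, MemBV Ω (F n)) ∧ MemBV Ω F₀ ∧
  Tendsto (fun n => ∫⁻ x in Ω, ‖F n x - F₀ x‖ₑ) atTop (𝓝 0) ∧
  ∀ (i : Fin d) (D : ℕ → SignedMeasure (Vec d)) (D₀ : SignedMeasure (Vec d)),
    (∀ n, HasDistribDeriv Ω i (F n) (D n)) → HasDistribDeriv Ω i F₀ D₀ →
    ∀ φ : Vec d → ℝ, Continuous φ → (∀ x ∉ Ω, φ x = 0) →
      Tendsto (fun n => ∫ᵛ x, φ x ∂•(D n)) atTop (𝓝 (∫ᵛ x, φ x ∂•D₀))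

/-- The jump set `J_u` of `u` in `Ω`: the points at which `u` has two different one-sided
approximate limits, with respect to some direction `ν`. -/
def jumpSet (Ω : Set (Vec d)) (u : Vec d → Vec d) : Set (Vec d) :=
  {x ∈ Ω | ∃ a b ν : Vec d, a ≠ b ∧ ‖ν‖ = 1 ∧
    Tendsto (fun r => ⨍⁻ z in Metric.ball x r ∩ {z | 0 < ⟪z - x, ν⟫}, ‖u z - a‖ₑ ∂volume)
      (𝓝[>] (0 : ℝ)) (𝓝 0) ∧
    Tendsto (fun r => ⨍⁻ z in Metric.ball x r ∩ {z | ⟪z - x, ν⟫ < 0}, ‖u z - b‖ₑ ∂volume)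
      (𝓝[>] (0 : ℝ)) (𝓝 0)}

/-- `u ∈ SBV²(O; ℝ^d)` with (approximate) gradient `∇u = g`: `Du = g ℒ^d + σ`, where the singular
part `σ` has no Cantor part, i.e. is carried by the jump set; `g ∈ L²` and `ℋ^{d-1}(J_u) < ⊤`.
(The normalization of the Hausdorff measure plays no role for finiteness.) -/
def MemSBV2 (O : Set (Vec d)) (u : Vec d → Vec d) (g : Vec d → Mat d) : Prop :=
  IntegrableOn u O ∧
  (∀ k i, IntegrableOn (fun x => g x k i) O) ∧
  (∀ k i, MemLp (fun x => g x k i) 2 (volume.restrict O)) ∧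
  μH[(d : ℝ) - 1] (jumpSet O u) < ⊤ ∧
  ∃ σ : Fin d → Fin d → SignedMeasure (Vec d), ∀ k i,
    (σ k i).totalVariation ⟂ₘ volume ∧
    (σ k i).totalVariation (jumpSet O u)ᶜ = 0 ∧
    HasDistribDeriv O i (fun x => u x k)
      ((volume.restrict O).withDensityᵥ (fun x => g x k i) + σ k i)

/-- `u ∈ SBV²_loc(Ω; ℝ^d)` with gradient `∇u = g`. -/
def MemSBV2Loc (Ω : Set (Vec d)) (u : Vec d → Vec d) (g : Vec d → Mat d) : Prop :=
  ∀ O, CompactlyIn O Ω → MemSBV2 O u g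

/-- The linear map `L` is the approximate differential of `u` at `x`. -/
def HasApproxGradAt (u : Vec d → Vec d) (L : Mat d) (x : Vec d) : Prop :=
  ∀ δ : ℝ, 0 < δ → Tendsto
    (fun r => volume ({z | δ * ‖z - x‖ < ‖u z - u x - act L (z - x)‖} ∩ Metric.ball x r) /
      volume (Metric.ball x r)) (𝓝[>] (0 : ℝ)) (𝓝 0)

/-- `g n ⇀ g₀` weakly in `L²_loc(Ω)`. -/
def TendstoWeakL2Loc (Ω : Set (Vec d)) (g : ℕ → Vec d → Mat d) (g₀ : Vec d → Mat d) : Prop :=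
  ∀ O, CompactlyIn O Ω → ∀ k i,
    (∀ n, MemLp (fun x => g n x k i) 2 (volume.restrict O)) ∧
    MemLp (fun x => g₀ x k i) 2 (volume.restrict O) ∧
    ∀ ψ : Vec d → ℝ, MemLp ψ 2 (volume.restrict O) →
      Tendsto (fun n => ∫ x in O, g n x k i * ψ x) atTop (𝓝 (∫ x in O, g₀ x k i * ψ x))

/-! ### Caccioppoli partitions -/

/-- The essential boundary `∂*E`: the points where `E` has neither density `0` nor density `1`. -/
def essBoundary (E : Set (Vec d)) : Set (Vec d) :=
  {x | ¬ Tendsto (fun r => volume (E ∩ Metric.ball x r) / volume (Metric.ball x r))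
          (𝓝[>] (0 : ℝ)) (𝓝 0) ∧
       ¬ Tendsto (fun r => volume (E ∩ Metric.ball x r) / volume (Metric.ball x r))
          (𝓝[>] (0 : ℝ)) (𝓝 1)}

/-- Ordered Caccioppoli partitions of `Ω` (up to null sets). They are indexed by `ℕ`; a finite
partition is continued by empty sets. -/
structure IsCaccioppoliPartition (Ω : Set (Vec d)) (P : ℕ → Set (Vec d)) : Prop where
  measurableSet : ∀ j, MeasurableSet (P j)
  subset : ∀ j, P j ⊆ Ω
  disjoint : ∀ i j, i ≠ j → volume (P i ∩ P j) = 0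
  cover : volume (Ω \ ⋃ j, P j) = 0
  ordered : Antitone fun j => volume (P j)
  perimeter : ∑' j, μH[(d : ℝ) - 1] (essBoundary (P j)) < ⊤

/-- The piecewise constant matrix field `∑_j R M_j χ_{P_j}`. -/
def phaseField (R : Mat d) (P : ℕ → Set (Vec d)) (M : ℕ → Mat d) (x : Vec d) : Mat d :=
  ∑' j, (P j).indicator (fun _ => R * M j) x

/-- The rescaled displacement `ε⁻¹ (y - ∑_j (R M_j x + t_j) χ_{P_j})`. -/
def rescaledDisp (ε : ℝ) (y : Vec d → Vec d) (R : Mat d) (P : ℕ → Set (Vec d))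
    (M : ℕ → Mat d) (t : ℕ → Vec d) (x : Vec d) : Vec d :=
  ε⁻¹ • (y x - ∑' j, (P j).indicator (fun z => act (R * M j) z + t j) x)

/-- The set `𝒯(y, 𝒫)` of the maps `∑_j t_j χ_{P_j} + S ∇y(x) x` with `t_j ∈ ℝ^d` and one
skew-symmetric matrix `S` (maps on `Ω` are identified when they agree almost everywhere). -/
def piecewiseTranslations (Ω : Set (Vec d)) (y : Vec d → Vec d) (P : ℕ → Set (Vec d)) :
    Set (Vec d → Vec d) :=
  {T | ∃ (t : ℕ → Vec d) (S : Mat d), S.transpose = -S ∧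
    T =ᵐ[volume.restrict Ω] fun x =>
      (∑' j, (P j).indicator (fun _ => t j) x) + act (S * grad Ω y x) x}

variable [NeZero d]

/-- `S` is contained in the union of countably many hyperplanes `ℝ^{d-1} × {s_i}`. The index `⊤`
is the last one, so that `x ⊤` is `x_d`. -/
def InLayers (S : Set (Vec d)) : Prop :=
  ∃ s : ℕ → ℝ, S ⊆ ⋃ i, {x : Vec d | x ⊤ = s i}

/-- The class `𝒫(Ω)` of Caccioppoli partitions whose boundaries inside `Ω` lie in countably many
hyperplanes orthogonal to `e_d`. -/
def LayerPartition (Ω : Set (Vec d)) (P : ℕ → Set (Vec d)) : Prop :=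
  IsCaccioppoliPartition Ω P ∧ InLayers ((⋃ j, frontier (P j)) ∩ Ω)

/-- The layer set `L_{Ω'}(S) = Ω' ∩ (ℝ^{d-1} × π_d(S))`. -/
def layerSet (Ω' S : Set (Vec d)) : Set (Vec d) := {x ∈ Ω' | ∃ z ∈ S, z ⊤ = x ⊤}

/-! ### The two-well energy -/

/-- The well `B = diag(1, …, 1, 1 + κ)`; the other well `A` is the identity matrix. -/
def wellB (d : ℕ) [NeZero d] (κ : ℝ) : Mat d :=
  Matrix.diagonal fun i => if i = ⊤ then 1 + κ else 1

/-- The two phases `{A, B}`. -/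
def wells (d : ℕ) [NeZero d] (κ : ℝ) : Set (Mat d) := {1, wellB d κ}

/-- Stored energy densities: nonnegative, continuous, frame indifferent, zero on the two wells,
and coercive. -/
structure IsTwoWellDensity (κ : ℝ) (W : Mat d → ℝ) : Prop where
  nonneg : ∀ F, 0 ≤ W F
  continuous : Continuous W
  frame : ∀ R ∈ rotations d, ∀ F, W (R * F) = W F
  wells_zero : W 1 = 0 ∧ W (wellB d κ) = 0
  coercive : ∃ c₁ > 0, ∀ F,
    c₁ * frobDistSq F {G | ∃ R ∈ rotations d, ∃ M ∈ wells d κ, G = R * M} ≤ W F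

/-- The exponent-scaled coefficient `η = ε^{-1 + 1/(2d)}` of the anisotropic penalization. -/
def etaBar (d : ℕ) (ε : ℝ) : ℝ := ε ^ (-1 + 1 / (2 * (d : ℝ)))

/-- The energy `ε⁻² ∫ W(∇y) + ε² ∫ |∇²y|² + η² ∫ (|∇²y|² - |∂²_dd y|²)`. -/
def energy (Ω : Set (Vec d)) (W : Mat d → ℝ) (ε : ℝ) (y : Vec d → Vec d) : ℝ≥0∞ :=
  ENNReal.ofReal (1 / ε ^ 2) * (∫⁻ x in Ω, ENNReal.ofReal (W (grad Ω y x))) +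
  ENNReal.ofReal (ε ^ 2) * (∫⁻ x in Ω, ENNReal.ofReal (∑ k, ∑ i, ∑ j, hess Ω y x k i j ^ 2)) +
  ENNReal.ofReal (etaBar d ε ^ 2) * (∫⁻ x in Ω, ENNReal.ofReal
    ((∑ k, ∑ i, ∑ j, hess Ω y x k i j ^ 2) - ∑ k, hess Ω y x k ⊤ ⊤ ^ 2))

/-! ### Limiting triples -/

/-- `𝒴_R(Ω)`: maps in `H¹` with mean zero and `∇y ∈ BV(Ω; R{A,B})`. -/
def LimitDeformation (Ω : Set (Vec d)) (κ : ℝ) (R : Mat d) (y : Vec d → Vec d) : Prop :=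
  MemH1 Ω y ∧ (⨍ x in Ω, y x) = 0 ∧
  (∀ k i, MemBV Ω (fun x => grad Ω y x k i)) ∧
  ∀ᵐ x ∂(volume.restrict Ω), ∃ M ∈ wells d κ, grad Ω y x = R * M

/-- `𝒰(Ω)`, together with the gradient `∇u = g`. -/
def LimitDisplacement (Ω : Set (Vec d)) (u : Vec d → Vec d) (g : Vec d → Mat d) : Prop :=
  MemSBV2Loc Ω u g ∧ InLayers (jumpSet Ω u)

/-- The quadruples `(R^ε, 𝒫^ε, ℳ^ε, 𝒯^ε)` along `ε = ε_n → 0` represent the sequence `y^ε`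
asymptotically, with the limiting triple `(y, u, 𝒫)`; the exponent of the layer estimate is `p`. -/
structure Represents (Ω : Set (Vec d)) (κ p : ℝ) (ε : ℕ → ℝ) (yε : ℕ → Vec d → Vec d)
    (Rε : ℕ → Mat d) (Pε : ℕ → ℕ → Set (Vec d)) (Mε : ℕ → ℕ → Mat d) (tε : ℕ → ℕ → Vec d)
    (y u : Vec d → Vec d) (P : ℕ → Set (Vec d)) : Prop where
  rot : ∀ n, Rε n ∈ rotations d
  part : ∀ n, IsCaccioppoliPartition Ω (Pε n)
  phase : ∀ n j, Mε n j ∈ wells d κ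
  /-- uniform bound on the surface of the partitions -/
  surface : ∃ C : ℝ≥0, ∀ n, μH[(d : ℝ) - 1] (⋃ j, essBoundary (Pε n j)) ≤ C
  /-- each component is small or almost fills a layer -/
  layer : ∀ Ω', CompactlyIn Ω' Ω → ∃ C : ℝ≥0, ∀ n,
    ∑' j, min (volume (Ω' ∩ Pε n j)) (volume (layerSet Ω' (Pε n j) \ Pε n j)) ≤
      C * ENNReal.ofReal (ε n ^ p)
  /-- `‖∇y^ε - ∑_j R^ε M_j^ε χ_{P_j^ε}‖_{L²(Ω')} ≤ C ε` -/
  rigidity : ∀ Ω', CompactlyIn Ω' Ω → ∃ C : ℝ≥0, ∀ n,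
    (∫⁻ x in Ω', ENNReal.ofReal
      (frobSq (grad Ω (yε n) x - phaseField (Rε n) (Pε n) (Mε n) x))) ^ (1 / 2 : ℝ) ≤
      C * ENNReal.ofReal (ε n)
  /-- convergence of the rotations, with `y ∈ 𝒴_R(Ω)` for the limiting rotation -/
  rot_tendsto : ∃ R ∈ rotations d, LimitDeformation Ω κ R y ∧ Tendsto Rε atTop (𝓝 R)
  limit_part : LayerPartition Ω P
  part_tendsto : ∀ j, Tendsto (fun n => volume (Pε n j ∆ P j)) atTop (𝓝 0)
  /-- `y^ε - ⨍ y^ε → y` strongly in `H¹` -/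
  def_tendsto : Tendsto (fun n =>
      (∫⁻ x in Ω, ‖(yε n x - (⨍ z in Ω, yε n z)) - y x‖ₑ ^ 2) +
      (∫⁻ x in Ω, ENNReal.ofReal (frobSq (grad Ω (yε n) x - grad Ω y x)))) atTop (𝓝 0)
  phase_tendsto : ∀ k i, TendstoWeakStarBV Ω
    (fun n x => phaseField (Rε n) (Pε n) (Mε n) x k i) (fun x => grad Ω y x k i)
  /-- the selection principle -/
  selection : ∀ i j, i ≠ j → 0 < volume (P i) → 0 < volume (P j) →
    (∃ L, Tendsto (fun n => Mε n i) atTop (𝓝 L) ∧ Tendsto (fun n => Mε n j) atTop (𝓝 L)) →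
    Tendsto (fun n => ‖tε n i - tε n j‖ / ε n) atTop atTop
  disp_tendsto : TendstoInMeasure (volume.restrict Ω)
    (fun n => rescaledDisp (ε n) (yε n) (Rε n) (Pε n) (Mε n) (tε n)) atTop u
  /-- `u ∈ 𝒰(Ω)`, and the approximate gradients of the displacements converge weakly to `∇u` -/
  grad_tendsto : ∃ (gε : ℕ → Vec d → Mat d) (g : Vec d → Mat d),
    LimitDisplacement Ω u g ∧
    (∀ n, ∀ᵐ x ∂(volume.restrict Ω), HasApproxGradAt
      (rescaledDisp (ε n) (yε n) (Rε n) (Pε n) (Mε n) (tε n)) (gε n x) x) ∧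
    TendstoWeakL2Loc Ω gε g

/-- The triple `(y, u, 𝒫)` is admissible for the sequence `y^ε`. -/
def AdmissibleTriple (Ω : Set (Vec d)) (κ p : ℝ) (ε : ℕ → ℝ) (yε : ℕ → Vec d → Vec d)
    (y u : Vec d → Vec d) (P : ℕ → Set (Vec d)) : Prop :=
  ∃ Rε Pε Mε tε, Represents Ω κ p ε yε Rε Pε Mε tε y u P

end TwoWell

end

open TwoWell

/-!
# Uniqueness of the limits of two-well sequences, up to piecewise translations

**Uniqueness.** Two representations of the same sequence `y^ε` give rescaled displacements whose
difference, on the overlap of a component of one representation with a component of the other, is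
the affine map with linear part `ε⁻¹ (R₂ M₂ - R₁ M₁)` and constant part `ε⁻¹ (t₂ - t₁)`. Along a
subsequence these affine maps converge almost everywhere on the overlap of the limiting components.
Convergence at the points of a set of positive measure forces convergence of the coefficients
(`exists_tendsto_affine`, `exists_affine_limits`). Therefore `R₂ M₂ - R₁ M₁ → 0`; determinants
distinguish the wells, so both phases have the same limit, hence they agree eventually, and
`ε⁻¹ (R₂ - R₁)` converges. Differentiating `R Rᵀ = 1`, its limit is `S R` with a skew-symmetric `S`,
the same for all overlaps (`exists_common_limits`). The translations differ by `O(ε)` on overlaps,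
so by the selection principle `|t_i - t_j| / ε → ∞` a component overlaps only one component of the
other partition (`overlap_unique`). As the partitions are ordered by measure, this gives the
permutation (`exists_perm_of_overlap_unique`), and the limits of the affine maps give the map `T`
with `u₁ - u₂ = T` (`AdmissibleTriple.unique`).

**Stability.** To add `T = ∑ τ_j χ_{P_j} + S ∇y x` to `u`, one replaces `R^ε` by `(1 - ε N^ε) R^ε`
and `t^ε_j` by `t^ε_j - ε τ_j`, where `1 - ε N^ε` is the Cayley transform of a multiple of `S`, a
rotation with `N^ε → S` (`exists_rotation_expansion`). All conditions on the sequence survive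
(`Represents.perturb`). What remains is that `u + T` belongs to the limiting class: it has to be
locally in `SBV²`, with jumps in countably many hyperplanes `{x_d = s}`.

For this, the heights at which a component of a layer partition begins or ends are locally finite
(`LayerPartition.exists_ball_finite`). As the slices of `Ω` are connected, at an isolated such height
the whole slice lies in the essential boundary, whose area is bounded below and of finite total; a
closed countable set of reals with finitely many isolated points is finite, by Baire's theorem. Thus
`T` is, locally, a finite sum of affine maps cut off to half spaces, and its singular derivative lives
on finitely many hyperplanes (`hasLayeredDeriv_of_layers`). The jumps of `u` and `T` on a common
hyperplane may cancel, though, so the derivative of the sum must be shown to leave no mass outside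
the jump set of `u + T`. That is the trace theorem `totalVariation_strip_diff_jumpSet`: on a
hyperplane, the derivative `∂_d` of an integrable function has the density `w⁺ - w⁻`, the difference
of the one-sided traces, and these are the one-sided approximate limits almost everywhere
(`HasFstDeriv.exists_limits`), while the derivatives along the hyperplane do not charge it. Hence
`MemSBV2.add_layered` and `LimitDisplacement.add_layerwise`.
-/

noncomputable section

namespace TwoWell

/-! ### Signed measures and test functions -/

section

section SignedMeasures

variable {X : Type*} [MeasurableSpace X]

lemma signedIntegral_sub_toSignedMeasure (p q : Measure X)
    [IsFiniteMeasure p] [IsFiniteMeasure q] {φ : X → ℝ} (hp : Integrable φ p)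
    (hq : Integrable φ q) :
    (∫ᵛ x, φ x ∂•(p.toSignedMeasure - q.toSignedMeasure)) = (∫ x, φ x ∂p) - ∫ x, φ x ∂q := by
  rw [VectorMeasure.integral_sub_vectorMeasure]
  · have hflip : (ContinuousLinearMap.lsmul ℝ ℝ : ℝ →L[ℝ] ℝ →L[ℝ] ℝ) =
        (ContinuousLinearMap.lsmul ℝ ℝ).flip := by
      ext
      simp
    rw [hflip, VectorMeasure.integral_toSignedMeasure, VectorMeasure.integral_toSignedMeasure]
  · simpa [VectorMeasure.Integrable] using hp
  · simpa [VectorMeasure.Integrable] using hq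

lemma signedIntegral_eq_sub (μ : SignedMeasure X) {φ : X → ℝ}
    (hφ : Integrable φ μ.totalVariation) :
    (∫ᵛ x, φ x ∂•μ) = (∫ x, φ x ∂μ.toJordanDecomposition.posPart)
      - ∫ x, φ x ∂μ.toJordanDecomposition.negPart := by
  conv_lhs => rw [← SignedMeasure.toSignedMeasure_toJordanDecomposition μ]
  exact signedIntegral_sub_toSignedMeasure _ _ (hφ.mono_measure (Measure.le_add_right le_rfl))
    (hφ.mono_measure (Measure.le_add_left le_rfl))

lemma totalVariation_add_le (μ ν : SignedMeasure X) :
    (μ + ν).totalVariation ≤ μ.totalVariation + ν.totalVariation := by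
  simp only [SignedMeasure.totalVariation_eq_variation]
  exact VectorMeasure.variation_add_le

lemma totalVariation_add_apply_eq_zero {μ ν : SignedMeasure X} {s : Set X}
    (hμ : μ.totalVariation s = 0) (hν : ν.totalVariation s = 0) :
    (μ + ν).totalVariation s = 0 := by
  refine le_antisymm ((totalVariation_add_le μ ν s).trans ?_) zero_le
  simp [hμ, hν]

lemma totalVariation_smul_apply_eq_zero (c : ℝ) {μ : SignedMeasure X} {s : Set X}
    (hμ : μ.totalVariation s = 0) : (c • μ).totalVariation s = 0 := by
  rw [SignedMeasure.totalVariation_eq_variation] at *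
  rw [VectorMeasure.variation_smul]
  simp [hμ]

lemma totalVariation_apply_eq_zero {μ : SignedMeasure X} {s : Set X} (hs : MeasurableSet s)
    (h : ∀ t ⊆ s, MeasurableSet t → μ t = 0) : μ.totalVariation s = 0 := by
  rw [SignedMeasure.totalVariation_eq_variation]
  refine (VectorMeasure.variation_apply_eq_zero hs).2 ?_
  exact fun t ht ht' => h t ht ht'

lemma eq_zero_of_totalVariation_univ {μ : SignedMeasure X} (h : μ.totalVariation univ = 0) :
    μ = 0 := by
  ext s hs
  have := SignedMeasure.null_of_totalVariation_zero μ (measure_mono_null (subset_univ s) h)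
  simpa using this

variable {E : Type*} [NormedAddCommGroup E] [NormedSpace ℝ E] [FiniteDimensional ℝ E]
  [MeasurableSpace E] [BorelSpace E]

/-- A signed measure that annihilates the test functions supported in an open set vanishes there:
its density with respect to its total variation is the sign `±1`, to which the fundamental lemma of
the calculus of variations applies. -/
lemma totalVariation_eq_zero_of_forall_test {U : Set E} (hU : IsOpen U) (μ : SignedMeasure E)
    (h : ∀ φ : E → ℝ, ContDiff ℝ ∞ φ → HasCompactSupport φ → tsupport φ ⊆ U →
      (∫ᵛ x, φ x ∂•μ) = 0) : μ.totalVariation U = 0 := by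
  classical
  obtain ⟨s, hs, hp, hn⟩ := μ.toJordanDecomposition.mutuallySingular
  set p := μ.toJordanDecomposition.posPart
  set q := μ.toJordanDecomposition.negPart
  set f : E → ℝ := s.indicator (fun _ => -1) + sᶜ.indicator (fun _ => 1) with hf
  have hfm : Measurable f := by
    exact (measurable_const.indicator hs).add (measurable_const.indicator hs.compl)
  have hfp : f =ᵐ[p] fun _ => 1 := by
    have : ∀ᵐ x ∂p, x ∉ s := measure_eq_zero_iff_ae_notMem.1 hp
    filter_upwards [this] with x hx
    simp [hf, hx]
  have hfq : f =ᵐ[q] fun _ => -1 := by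
    have : ∀ᵐ x ∂q, x ∉ sᶜ := measure_eq_zero_iff_ae_notMem.1 hn
    filter_upwards [this] with x hx
    simp only [mem_compl_iff, not_not] at hx
    simp [hf, hx]
  have hf0 : ∀ x, f x ≠ 0 := by
    intro x
    by_cases hx : x ∈ s <;> simp [hf, hx]
  have hfb : ∀ x, ‖f x‖ ≤ 1 := by
    intro x
    by_cases hx : x ∈ s <;> simp [hf, hx]
  have hfi : Integrable f μ.totalVariation :=
    Integrable.of_bound hfm.aestronglyMeasurable 1 (Eventually.of_forall hfb)
  have key := hU.ae_eq_zero_of_integral_contDiff_smul_eq_zero (μ := μ.totalVariation) (f := f)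
    (hfi.locallyIntegrable.locallyIntegrableOn U) ?_
  · have h2 : ∀ᵐ x ∂μ.totalVariation, x ∉ U := by
      filter_upwards [key] with x hx hxU using hf0 x (hx hxU)
    exact measure_eq_zero_iff_ae_notMem.2 h2
  · intro φ hφ hc hsupp
    have hφi : Integrable φ μ.totalVariation := hφ.continuous.integrable_of_hasCompactSupport hc
    have h0 := h φ hφ hc hsupp
    rw [signedIntegral_eq_sub μ hφi] at h0
    have hprod : Integrable (fun x => φ x • f x) μ.totalVariation := by
      have := hφi.bdd_mul (c := 1) hfm.aestronglyMeasurable (Eventually.of_forall hfb)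
      simpa [mul_comm] using this
    have h1 : Integrable (fun x => φ x • f x) p := hprod.mono_measure (Measure.le_add_right le_rfl)
    have h2 : Integrable (fun x => φ x • f x) q := hprod.mono_measure (Measure.le_add_left le_rfl)
    have e1 : ∫ x, φ x • f x ∂p = ∫ x, φ x ∂p :=
      integral_congr_ae (by filter_upwards [hfp] with x hx; simp [hx])
    have e2 : ∫ x, φ x • f x ∂q = - ∫ x, φ x ∂q := by
      rw [← integral_neg]
      exact integral_congr_ae (by filter_upwards [hfq] with x hx; simp [hx])
    calc ∫ x, φ x • f x ∂μ.totalVariation = ∫ x, φ x • f x ∂(p + q) := rfl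
      _ = 0 := by rw [integral_add_measure h1 h2, e1, e2]; linarith

end SignedMeasures

/-! ### Distributional derivatives -/

variable {d : ℕ}

lemma IsTest.integrable {Ω : Set (Vec d)} {φ : Vec d → ℝ} (hφ : IsTest Ω φ)
    (μ : Measure (Vec d)) [IsFiniteMeasureOnCompacts μ] : Integrable φ μ :=
  hφ.1.continuous.integrable_of_hasCompactSupport hφ.2.1

lemma IsTest.continuous_pderiv {Ω : Set (Vec d)} {φ : Vec d → ℝ} (hφ : IsTest Ω φ) (i : Fin d) :
    Continuous (pderiv i φ) :=
  (hφ.1.continuous_fderiv (by simp)).clm_apply continuous_const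

lemma tsupport_pderiv_subset (φ : Vec d → ℝ) (i : Fin d) : tsupport (pderiv i φ) ⊆ tsupport φ :=
  tsupport_fderiv_apply_subset ℝ _

lemma IsTest.hasCompactSupport_pderiv {Ω : Set (Vec d)} {φ : Vec d → ℝ} (hφ : IsTest Ω φ)
    (i : Fin d) : HasCompactSupport (pderiv i φ) :=
  hφ.2.1.mono' ((subset_tsupport _).trans (tsupport_pderiv_subset φ i))

lemma IsTest.integrable_mul_pderiv {Ω : Set (Vec d)} {φ : Vec d → ℝ} (hφ : IsTest Ω φ)
    (i : Fin d) {f : Vec d → ℝ} {μ : Measure (Vec d)} (hf : Integrable f μ) :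
    Integrable (fun x => f x * pderiv i φ x) μ := by
  obtain ⟨C, hC⟩ := (hφ.continuous_pderiv i).bounded_above_of_compact_support
    (hφ.hasCompactSupport_pderiv i)
  exact hf.mul_bdd (hφ.continuous_pderiv i).aestronglyMeasurable (Eventually.of_forall hC)

lemma IsTest.integrable_mul {Ω : Set (Vec d)} {φ : Vec d → ℝ} (hφ : IsTest Ω φ)
    {f : Vec d → ℝ} {μ : Measure (Vec d)} (hf : Integrable f μ) :
    Integrable (fun x => f x * φ x) μ := by
  obtain ⟨C, hC⟩ := hφ.1.continuous.bounded_above_of_compact_support hφ.2.1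
  exact hf.mul_bdd hφ.1.continuous.aestronglyMeasurable (Eventually.of_forall hC)

lemma integrable_variation {φ : Vec d → ℝ} {μ : SignedMeasure (Vec d)}
    (h : Integrable φ μ.totalVariation) : VectorMeasure.Integrable μ φ := by
  rwa [VectorMeasure.Integrable, ← SignedMeasure.totalVariation_eq_variation]

namespace HasDistribDeriv

variable {Ω : Set (Vec d)} {i : Fin d} {f g : Vec d → ℝ} {μ ν : SignedMeasure (Vec d)}

lemma unique (hΩ : IsOpen Ω) (hμ : HasDistribDeriv Ω i f μ) (hν : HasDistribDeriv Ω i f ν) :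
    μ = ν := by
  have h0 : (μ - ν).totalVariation Ωᶜ = 0 := by
    rw [sub_eq_add_neg]
    exact totalVariation_add_apply_eq_zero hμ.1 (by rw [SignedMeasure.totalVariation_neg]; exact hν.1)
  have h1 : (μ - ν).totalVariation Ω = 0 := by
    refine totalVariation_eq_zero_of_forall_test hΩ _ fun φ h1 h2 h3 => ?_
    have hφ : IsTest Ω φ := ⟨h1, h2, h3⟩
    have e := (hμ.2 φ hφ).symm.trans (hν.2 φ hφ)
    rw [VectorMeasure.integral_sub_vectorMeasure (integrable_variation (hφ.integrable _))
      (integrable_variation (hφ.integrable _))]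
    linarith
  refine sub_eq_zero.1 (eq_zero_of_totalVariation_univ ?_)
  rw [← union_compl_self Ω]
  exact measure_union_null h1 h0

lemma congr (hμ : HasDistribDeriv Ω i f μ) (h : f =ᵐ[volume.restrict Ω] g) :
    HasDistribDeriv Ω i g μ := by
  refine ⟨hμ.1, fun φ hφ => ?_⟩
  rw [← hμ.2 φ hφ]
  exact integral_congr_ae (by filter_upwards [h] with x hx; rw [hx])

lemma add (hμ : HasDistribDeriv Ω i f μ) (hν : HasDistribDeriv Ω i g ν)
    (hf : IntegrableOn f Ω) (hg : IntegrableOn g Ω) :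
    HasDistribDeriv Ω i (fun x => f x + g x) (μ + ν) := by
  refine ⟨totalVariation_add_apply_eq_zero hμ.1 hν.1, fun φ hφ => ?_⟩
  simp only [add_mul]
  rw [integral_add (hφ.integrable_mul_pderiv i hf) (hφ.integrable_mul_pderiv i hg),
    VectorMeasure.integral_add_vectorMeasure (integrable_variation (hφ.integrable _))
      (integrable_variation (hφ.integrable _)), hμ.2 φ hφ, hν.2 φ hφ]
  ring

lemma const_mul (c : ℝ) (hμ : HasDistribDeriv Ω i f μ) :
    HasDistribDeriv Ω i (fun x => c * f x) (c • μ) := by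
  refine ⟨totalVariation_smul_apply_eq_zero c hμ.1, fun φ hφ => ?_⟩
  rw [VectorMeasure.integral_smul_vectorMeasure, smul_eq_mul]
  simp only [mul_assoc]
  rw [integral_const_mul, hμ.2 φ hφ]
  ring

lemma zero : HasDistribDeriv Ω i (fun _ => 0) 0 := by
  refine ⟨by simp [SignedMeasure.totalVariation_zero], fun φ hφ => by simp⟩

lemma sum {ι : Type*} (t : Finset ι) {f : ι → Vec d → ℝ} {μ : ι → SignedMeasure (Vec d)}
    (hμ : ∀ l ∈ t, HasDistribDeriv Ω i (f l) (μ l)) (hf : ∀ l ∈ t, IntegrableOn (f l) Ω) :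
    HasDistribDeriv Ω i (fun x => ∑ l ∈ t, f l x) (∑ l ∈ t, μ l) := by
  classical
  induction t using Finset.induction_on with
  | empty => simpa using zero
  | insert a t ha ih =>
    simp only [Finset.sum_insert ha]
    refine add (hμ a (by simp)) (ih (fun l hl => hμ l (by simp [hl])) fun l hl =>
      hf l (by simp [hl])) (hf a (by simp)) ?_
    exact integrable_finsetSum _ fun l hl => hf l (by simp [hl])

end HasDistribDeriv

lemma MemBV.sum_const_mul {ι : Type*} (t : Finset ι) {Ω : Set (Vec d)} {f : ι → Vec d → ℝ}
    (hf : ∀ l ∈ t, MemBV Ω (f l)) (q : ι → ℝ) : MemBV Ω (fun x => ∑ l ∈ t, q l * f l x) := by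
  have hi : ∀ l ∈ t, IntegrableOn (fun x => q l * f l x) Ω := fun l hl =>
    (hf l hl).1.const_mul (q l)
  refine ⟨integrable_finsetSum _ hi, fun i => ?_⟩
  choose! μ hμ using fun l (hl : l ∈ t) => (hf l hl).2 i
  exact ⟨_, HasDistribDeriv.sum t (fun l hl => (hμ l hl).const_mul (q l)) hi⟩

lemma integrable_of_continuous_of_vanish {Ω : Set (Vec d)} (hb : Bornology.IsBounded Ω)
    {φ : Vec d → ℝ} (hφ : Continuous φ) (h0 : ∀ x ∉ Ω, φ x = 0) (μ : Measure (Vec d))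
    [IsFiniteMeasureOnCompacts μ] : Integrable φ μ := by
  refine hφ.integrable_of_hasCompactSupport ?_
  refine HasCompactSupport.of_support_subset_isCompact hb.isCompact_closure ?_
  intro x hx
  by_contra hxΩ
  exact hx (h0 x fun h => hxΩ (subset_closure h))

/-- Linear combinations with convergent coefficients preserve weak* convergence in `BV`. -/
lemma TendstoWeakStarBV.sum_mul {ι : Type*} [Fintype ι] {Ω : Set (Vec d)} (hΩ : IsOpen Ω)
    (hb : Bornology.IsBounded Ω) {F : ι → ℕ → Vec d → ℝ} {F₀ : ι → Vec d → ℝ}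
    (h : ∀ l, TendstoWeakStarBV Ω (F l) (F₀ l)) {q : ℕ → ι → ℝ} {q₀ : ι → ℝ}
    (hq : ∀ l, Tendsto (fun n => q n l) atTop (𝓝 (q₀ l))) :
    TendstoWeakStarBV Ω (fun n x => ∑ l, q n l * F l n x) (fun x => ∑ l, q₀ l * F₀ l x) := by
  refine ⟨fun n => MemBV.sum_const_mul _ (fun l _ => (h l).1 n) _,
    MemBV.sum_const_mul _ (fun l _ => (h l).2.1) _, ?_, ?_⟩
  · have hbound : ∀ n, ∫⁻ x in Ω, ‖(∑ l, q n l * F l n x) - ∑ l, q₀ l * F₀ l x‖ₑ ≤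
        ∑ l, (‖q n l‖ₑ * (∫⁻ x in Ω, ‖F l n x - F₀ l x‖ₑ) +
          ‖q n l - q₀ l‖ₑ * ∫⁻ x in Ω, ‖F₀ l x‖ₑ) := by
      intro n
      have hm : ∀ l, AEMeasurable (fun x => ‖F l n x - F₀ l x‖ₑ) (volume.restrict Ω) := fun l =>
        (((h l).1 n).1.sub (h l).2.1.1).aestronglyMeasurable.enorm
      have hm' : ∀ l, AEMeasurable (fun x => ‖F₀ l x‖ₑ) (volume.restrict Ω) := fun l =>
        (h l).2.1.1.aestronglyMeasurable.enorm
      calc _ ≤ ∫⁻ x in Ω, ∑ l, (‖q n l‖ₑ * ‖F l n x - F₀ l x‖ₑ +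
              ‖q n l - q₀ l‖ₑ * ‖F₀ l x‖ₑ) := by
            refine lintegral_mono fun x => ?_
            rw [← Finset.sum_sub_distrib]
            refine (enorm_sum_le _ _).trans (Finset.sum_le_sum fun l _ => ?_)
            rw [← enorm_mul, ← enorm_mul]
            refine le_trans (le_of_eq ?_) (enorm_add_le _ _)
            congr 1
            ring
        _ = _ := by
            rw [lintegral_finsetSum' _ fun l _ => by
              exact ((hm l).const_mul _).add ((hm' l).const_mul _)]
            refine Finset.sum_congr rfl fun l _ => ?_
            rw [lintegral_add_left' ((hm l).const_mul _), lintegral_const_mul'' _ (hm l),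
              lintegral_const_mul'' _ (hm' l)]
    refine tendsto_of_tendsto_of_tendsto_of_le_of_le tendsto_const_nhds ?_ (fun _ => zero_le) hbound
    have : (0 : ℝ≥0∞) = ∑ l : ι, (‖q₀ l‖ₑ * 0 + 0 * ∫⁻ x in Ω, ‖F₀ l x‖ₑ) := by simp
    rw [this]
    refine tendsto_finsetSum _ fun l _ => Tendsto.add ?_ ?_
    · exact ENNReal.Tendsto.mul (hq l).enorm (Or.inr (by simp)) (h l).2.2.1 (Or.inr (by simp))
    · refine ENNReal.Tendsto.mul_const ?_ (Or.inr ?_)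
      · have := ((hq l).sub_const (q₀ l)).enorm
        simpa using this
      · have := (h l).2.1.1.hasFiniteIntegral
        exact this.ne
  · intro i D D₀ hD hD₀ φ hφ hφ0
    have hint : ∀ μ : SignedMeasure (Vec d), VectorMeasure.Integrable μ φ := fun μ =>
      integrable_variation (integrable_of_continuous_of_vanish hb hφ hφ0 _)
    choose D' hD' using fun l n => ((h l).1 n).2 i
    choose D₀' hD₀' using fun l => (h l).2.1.2 i
    have e : ∀ n, D n = ∑ l, q n l • D' l n := fun n => (hD n).unique hΩ
      (HasDistribDeriv.sum _ (fun l _ => (hD' l n).const_mul (q n l))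
        fun l _ => ((h l).1 n).1.const_mul _)
    have e₀ : D₀ = ∑ l, q₀ l • D₀' l := hD₀.unique hΩ
      (HasDistribDeriv.sum _ (fun l _ => (hD₀' l).const_mul (q₀ l))
        fun l _ => (h l).2.1.1.const_mul _)
    rw [e₀]
    simp only [e]
    simp only [VectorMeasure.integral_finsetSum_vectorMeasure fun _ _ => hint _,
      VectorMeasure.integral_smul_vectorMeasure, smul_eq_mul]
    exact tendsto_finsetSum _ fun l _ => (hq l).mul
      ((h l).2.2.2 i (D' l) (D₀' l) (hD' l) (hD₀' l) φ hφ hφ0)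

end

/-! ### Layer coordinates and hyperplanes -/

section

/-- The splitting `x ↦ (x_d, x')` of `ℝ^d = ℝ^(m+1)` into the layer height and the remaining
coordinates; the second factor carries the sup norm. -/
def layerCoords (m : ℕ) : Vec (m + 1) ≃L[ℝ] ℝ × (Fin m → ℝ) :=
  LinearEquiv.toContinuousLinearEquiv
    { toFun := fun x => (x ⊤, fun i => x ((⊤ : Fin (m + 1)).succAbove i))
      map_add' := fun x y => by ext <;> simp
      map_smul' := fun c x => by ext <;> simp
      invFun := fun z => WithLp.toLp 2 ((⊤ : Fin (m + 1)).insertNth z.1 z.2)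
      left_inv := fun x => by
        ext i
        refine Fin.succAboveCases (⊤ : Fin (m + 1)) ?_ (fun j => ?_) i <;> simp
      right_inv := fun z => by
        ext <;> simp }

lemma layerCoords_fst {m : ℕ} (x : Vec (m + 1)) : (layerCoords m x).1 = x ⊤ := rfl

lemma layerCoords_symm_top {m : ℕ} (z : ℝ × (Fin m → ℝ)) : (layerCoords m).symm z ⊤ = z.1 := by
  rw [← layerCoords_fst, ContinuousLinearEquiv.apply_symm_apply]

lemma measurePreserving_layerCoords (m : ℕ) :
    MeasurePreserving (layerCoords m) volume volume :=
  (volume_preserving_piFinSuccAbove (fun _ => ℝ) (⊤ : Fin (m + 1))).comp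
    (PiLp.volume_preserving_ofLp (Fin (m + 1)))

variable {d : ℕ}

section HalfBall

lemma quarter_ball_subset (x ν : Vec d) (hν : ‖ν‖ = 1) {r : ℝ} (hr : 0 < r) :
    Metric.ball (x + (r / 2) • ν) (r * (1 / 4)) ⊆ Metric.ball x r ∩ {z | 0 < ⟪z - x, ν⟫} := by
  intro z hz
  rw [Metric.mem_ball, dist_eq_norm] at hz
  set w := z - (x + (r / 2) • ν) with hw
  have hzx : z - x = w + (r / 2) • ν := by rw [hw]; abel
  refine ⟨?_, ?_⟩
  · rw [Metric.mem_ball, dist_eq_norm, hzx]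
    refine (norm_add_le _ _).trans_lt ?_
    rw [norm_smul, hν, Real.norm_of_nonneg (by positivity)]
    linarith
  · change 0 < ⟪z - x, ν⟫
    rw [hzx, inner_add_left, inner_smul_left, real_inner_self_eq_norm_sq, hν]
    have := (abs_le.1 (abs_real_inner_le_norm w ν)).1
    rw [hν] at this
    simp only [conj_trivial]
    linarith

/-- A half ball contains a ball of a quarter of the radius. -/
lemma volume_half_ball_ge (x ν : Vec d) (hν : ‖ν‖ = 1) {r : ℝ} (hr : 0 < r) :
    ENNReal.ofReal ((1 / 4) ^ d) * volume (Metric.ball x r) ≤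
      volume (Metric.ball x r ∩ {z | 0 < ⟪z - x, ν⟫}) := by
  refine le_trans (le_of_eq ?_) (measure_mono (quarter_ball_subset x ν hν hr))
  rw [Measure.addHaar_ball_of_pos volume x hr,
    Measure.addHaar_ball_of_pos volume _ (by positivity : 0 < r * (1 / 4)), ← mul_assoc,
    ← ENNReal.ofReal_mul (by positivity)]
  simp [mul_pow, mul_comm]

lemma volume_half_ball_ge' (x ν : Vec d) (hν : ‖ν‖ = 1) {r : ℝ} (hr : 0 < r) :
    ENNReal.ofReal ((1 / 4) ^ d) * volume (Metric.ball x r) ≤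
      volume (Metric.ball x r ∩ {z | ⟪z - x, ν⟫ < 0}) := by
  have := volume_half_ball_ge x (-ν) (by simpa using hν) hr
  simpa [inner_neg_right] using this

end HalfBall

variable [NeZero d]

/-- The layer `{x | x_d ∈ U}` over a set `U` of heights. -/
def strip (d : ℕ) [NeZero d] (U : Set ℝ) : Set (Vec d) := {x | x ⊤ ∈ U}

/-- The unit vector `e_d`. -/
def eTop (d : ℕ) [NeZero d] : Vec d := EuclideanSpace.single ⊤ 1

lemma norm_eTop : ‖eTop d‖ = 1 := by simp [eTop]

lemma inner_eTop (x : Vec d) : ⟪x, eTop d⟫ = x ⊤ := by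
  simp [eTop, EuclideanSpace.inner_single_right]

lemma eTop_apply_top : eTop d ⊤ = 1 := by simp [eTop]

lemma continuous_top : Continuous fun x : Vec d => x ⊤ := by fun_prop

lemma isOpen_strip {U : Set ℝ} (hU : IsOpen U) : IsOpen (strip d U) := hU.preimage continuous_top

lemma measurableSet_strip {U : Set ℝ} (hU : MeasurableSet U) : MeasurableSet (strip d U) :=
  continuous_top.measurable hU

lemma volume_hyperplane (t : ℝ) : volume (strip d {t}) = 0 := by
  have h := (PiLp.volume_preserving_ofLp (Fin d)).measure_preimage
    (s := {f : Fin d → ℝ | f ⊤ = t})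
    (measurableSet_eq_fun (measurable_pi_apply _) measurable_const).nullMeasurableSet
  have h2 : volume {f : Fin d → ℝ | f ⊤ = t} = 0 := by
    rw [volume_pi]
    exact Measure.pi_hyperplane (α := fun _ : Fin d => ℝ) (fun _ => volume) ⊤ t
  rw [h2] at h
  exact h

lemma volume_strip_countable {S : Set ℝ} (hS : S.Countable) : volume (strip d S) = 0 := by
  have : strip d S = ⋃ t ∈ S, strip d {t} := by
    ext x; simp [strip]
  rw [this]
  exact (measure_biUnion_null_iff hS).2 fun t _ => volume_hyperplane t

lemma add_eTop_mem_ball (x : Vec d) {t r : ℝ} (h : |t - x ⊤| < r) :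
    x + (t - x ⊤) • eTop d ∈ Metric.ball x r ∧ (x + (t - x ⊤) • eTop d) ⊤ = t := by
  refine ⟨?_, ?_⟩
  · rw [Metric.mem_ball, dist_eq_norm, add_sub_cancel_left, norm_smul, norm_eTop, mul_one]
    exact h
  · simp [eTop_apply_top]

/-- The set of heights of a set. -/
def heights (Ω : Set (Vec d)) : Set ℝ := (fun x : Vec d => x ⊤) '' Ω

lemma isOpen_heights {Ω : Set (Vec d)} (hΩ : IsOpen Ω) : IsOpen (heights Ω) := by
  rw [Metric.isOpen_iff]
  rintro _ ⟨x, hx, rfl⟩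
  obtain ⟨r, hr, hb⟩ := Metric.isOpen_iff.1 hΩ x hx
  refine ⟨r, hr, fun t ht => ?_⟩
  obtain ⟨h1, h2⟩ := add_eTop_mem_ball x (t := t) (r := r) (by simpa [Real.dist_eq] using ht)
  exact ⟨_, hb h1, h2⟩

lemma volume_strip_inter_ne_zero {Ω : Set (Vec d)} (hΩ : IsOpen Ω) {U : Set ℝ} (hU : IsOpen U)
    {t : ℝ} (ht : t ∈ U) (ht' : t ∈ heights Ω) : volume (Ω ∩ strip d U) ≠ 0 := by
  obtain ⟨x, hx, rfl⟩ := ht'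
  exact ((hΩ.inter (isOpen_strip hU)).measure_pos volume ⟨x, hx, ht⟩).ne'

/-- The slices of an open set near a fixed height have `ℋ^{d-1}`-measure bounded below. -/
lemma exists_le_hausdorffMeasure_slice {Ω : Set (Vec d)} (hΩ : IsOpen Ω) {t₀ : ℝ}
    (ht₀ : t₀ ∈ heights Ω) : ∃ r > 0, ∃ c : ℝ≥0∞, c ≠ 0 ∧ ∀ t ∈ Metric.ball t₀ r,
      c ≤ μH[(d : ℝ) - 1] (Ω ∩ strip d {t}) := by
  obtain ⟨m, rfl⟩ : ∃ m, d = m + 1 := ⟨d - 1, (Nat.succ_pred (NeZero.ne d)).symm⟩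
  obtain ⟨x₀, hx₀, rfl⟩ := ht₀
  set e := layerCoords m
  have hopen : IsOpen (e.symm ⁻¹' Ω) := hΩ.preimage e.symm.continuous
  obtain ⟨r, hr, hb⟩ := Metric.isOpen_iff.1 hopen (e x₀) (by simpa using hx₀)
  set q : Vec (m + 1) →L[ℝ] (Fin m → ℝ) :=
    (ContinuousLinearMap.snd ℝ ℝ (Fin m → ℝ)).comp (e : Vec (m + 1) →L[ℝ] ℝ × (Fin m → ℝ)) with hq
  set K : ℝ≥0 := ‖q‖₊ + 1
  have hLip : LipschitzWith K q := q.lipschitz.weaken (by simp [K])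
  refine ⟨r, hr, volume (Metric.ball (e x₀).2 r) / (K : ℝ≥0∞) ^ (m : ℝ), ?_, fun t ht => ?_⟩
  · refine (ENNReal.div_pos (Metric.measure_ball_pos volume _ hr).ne' ?_).ne'
    exact ENNReal.rpow_ne_top_of_nonneg (by positivity) (by simp)
  · have hcast : (((m + 1 : ℕ) : ℝ) - 1) = (m : ℝ) := by push_cast; ring
    rw [hcast]
    refine ENNReal.div_le_of_le_mul' ?_
    refine le_trans ?_ (hLip.hausdorffMeasure_image_le (by positivity) _)
    have hvol : (μH[(m : ℝ)] : Measure (Fin m → ℝ)) = volume := by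
      simpa using hausdorffMeasure_pi_real (ι := Fin m)
    rw [hvol]
    refine measure_mono fun w hw => ?_
    refine ⟨e.symm (t, w), ⟨hb ?_, ?_⟩, ?_⟩
    · rw [← ball_prod_same]
      exact ⟨ht, hw⟩
    · exact layerCoords_symm_top _
    · simp [hq, e]

lemma hausdorffMeasure_slice_lt_top {O : Set (Vec d)} (hb : Bornology.IsBounded O) (t : ℝ) :
    μH[(d : ℝ) - 1] (O ∩ strip d {t}) < ⊤ := by
  obtain ⟨m, rfl⟩ : ∃ m, d = m + 1 := ⟨d - 1, (Nat.succ_pred (NeZero.ne d)).symm⟩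
  set e := layerCoords m
  have hcast : (((m + 1 : ℕ) : ℝ) - 1) = (m : ℝ) := by push_cast; ring
  rw [hcast]
  have hb' : Bornology.IsBounded ((fun x => (e x).2) '' O) := by
    have h1 := ((ContinuousLinearMap.snd ℝ ℝ (Fin m → ℝ)).comp
      (e : Vec (m + 1) →L[ℝ] ℝ × (Fin m → ℝ))).lipschitz.isBounded_image hb
    exact h1
  set B := (fun x => (e x).2) '' O
  have hLip : LipschitzWith ‖(e.symm : ℝ × (Fin m → ℝ) →L[ℝ] Vec (m + 1))‖₊
      (fun w : Fin m → ℝ => e.symm (t, w)) := by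
    have h1 := (e.symm : ℝ × (Fin m → ℝ) →L[ℝ] Vec (m + 1)).lipschitz.comp
      ((LipschitzWith.const (α := Fin m → ℝ) t).prodMk LipschitzWith.id)
    simpa using! h1
  have hsub : O ∩ strip (m + 1) {t} ⊆ (fun w : Fin m → ℝ => e.symm (t, w)) '' B := by
    rintro x ⟨hx, hxt⟩
    refine ⟨(e x).2, ⟨x, hx, rfl⟩, ?_⟩
    have : (t, (e x).2) = e x := Prod.ext (show t = x ⊤ from Eq.symm hxt) rfl
    simp [this]
  refine (measure_mono hsub).trans_lt ((hLip.hausdorffMeasure_image_le (by positivity) _).trans_lt ?_)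
  have hvol : (μH[(m : ℝ)] : Measure (Fin m → ℝ)) = volume := by
    simpa using hausdorffMeasure_pi_real (ι := Fin m)
  rw [hvol]
  exact ENNReal.mul_lt_top (ENNReal.rpow_lt_top_of_nonneg (by positivity) (by simp))
    hb'.measure_lt_top

end

/-! ### Partitions with boundaries in layers -/

section

/-- A countable locally closed set of reals with finitely many isolated points consists of these,
because by Baire's theorem the rest of it would have an isolated point too. -/
lemma subset_isolated_of_finite_isolated {C : Set ℝ} (hC : IsLocallyClosed C) (hcount : C.Countable)
    (hfin : {t ∈ C | ∃ V, IsOpen V ∧ V ∩ C = {t}}.Finite) :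
    C ⊆ {t ∈ C | ∃ V, IsOpen V ∧ V ∩ C = {t}} := by
  set Z := {t ∈ C | ∃ V, IsOpen V ∧ V ∩ C = {t}} with hZ
  have hclosed : IsClosed Z := hfin.isClosed
  suffices h : C \ Z = ∅ from sdiff_eq_empty.1 h
  by_contra hne
  obtain ⟨x₀, hx₀⟩ := nonempty_iff_ne_empty.2 hne
  have hD : IsLocallyClosed (C \ Z) := by
    rw [sdiff_eq]
    exact hC.inter hclosed.isOpen_compl.isLocallyClosed
  have : LocallyCompactSpace ↥(C \ Z) := hD.locallyCompactSpace
  have : Countable ↥(C \ Z) := (hcount.mono sdiff_subset).to_subtype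
  have : Nonempty ↥(C \ Z) := ⟨⟨x₀, hx₀⟩⟩
  obtain ⟨x, hx⟩ := nonempty_interior_of_iUnion_of_closed (X := ↥(C \ Z))
    (f := fun x => {x}) (fun x => isClosed_singleton) (eq_univ_of_forall fun y => mem_iUnion.2 ⟨y, rfl⟩)
  have hx' : IsOpen ({x} : Set ↥(C \ Z)) := by
    rw [← interior_eq_iff_isOpen]
    exact Subset.antisymm interior_subset (by
      obtain ⟨y, hy⟩ := hx
      have : y = x := (interior_subset hy : y ∈ ({x} : Set _))
      rw [this] at hy
      simpa using hy)
  obtain ⟨V, hV, hVx⟩ := isOpen_induced_iff.1 hx'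
  have hmem : x.1 ∈ V := by
    have : x ∈ Subtype.val ⁻¹' V := by rw [hVx]; rfl
    exact this
  refine x.2.2 ⟨x.2.1, V \ Z, hV.sdiff hclosed, ?_⟩
  ext y
  refine ⟨fun hy => ?_, fun hy => ?_⟩
  · have : (⟨y, hy.2, hy.1.2⟩ : ↥(C \ Z)) ∈ Subtype.val ⁻¹' V := hy.1.1
    rw [hVx] at this
    exact congrArg Subtype.val this
  · have hyx : y = x.1 := hy
    subst hyx
    exact ⟨⟨hmem, x.2.2⟩, x.2.1⟩

variable {d : ℕ}

/-- A point at which the density ratio of `E` stays away from `0` and `1` on small balls is in the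
essential boundary of `E`. -/
lemma mem_essBoundary_of_ratio {E : Set (Vec d)} {x : Vec d} {c : ℝ≥0∞} (hc : c ≠ 0)
    (h : ∀ᶠ r in 𝓝[>] (0 : ℝ),
      c ≤ volume (E ∩ Metric.ball x r) / volume (Metric.ball x r) ∧
      volume (E ∩ Metric.ball x r) / volume (Metric.ball x r) + c ≤ 1) :
    x ∈ essBoundary E := by
  refine ⟨fun h0 => ?_, fun h1 => ?_⟩
  · exact hc (le_antisymm (ge_of_tendsto h0 (h.mono fun r hr => hr.1)) zero_le)
  · have h2 : (1 : ℝ≥0∞) + c ≤ 1 :=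
      le_of_tendsto (h1.add_const c) (h.mono fun r hr => hr.2)
    have h3 : c ≤ 0 := by
      have : (1 : ℝ≥0∞) + c ≤ 1 + 0 := by simpa using h2
      exact (ENNReal.add_le_add_iff_left ENNReal.one_ne_top).1 this
    exact hc (le_antisymm h3 zero_le)

/-- If `E` fills a part `H` of `B` and misses a part `H'`, each of relative volume at least `c`, the
density ratio of `E` in `B` lies in `[c, 1 - c]`. -/
lemma ratio_bounds {E B H H' : Set (Vec d)} {c : ℝ≥0∞} (hB : volume B ≠ 0) (hB' : volume B ≠ ⊤)
    (hH : H ⊆ B) (hH' : H' ⊆ B) (hm : MeasurableSet H') (hcH : c * volume B ≤ volume H)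
    (hcH' : c * volume B ≤ volume H') (h1 : volume (H \ E) = 0) (h2 : volume (E ∩ H') = 0) :
    c ≤ volume (E ∩ B) / volume B ∧ volume (E ∩ B) / volume B + c ≤ 1 := by
  constructor
  · rw [ENNReal.le_div_iff_mul_le (Or.inl hB) (Or.inl hB')]
    refine hcH.trans ?_
    calc volume H ≤ volume (E ∩ B) + volume (H \ E) := by
          refine (measure_mono ?_).trans (measure_union_le _ _)
          intro z hz
          by_cases hzE : z ∈ E
          · exact Or.inl ⟨hzE, hH hz⟩
          · exact Or.inr ⟨hz, hzE⟩
      _ = volume (E ∩ B) := by rw [h1, add_zero]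
  · have h3 : volume (E ∩ B) + c * volume B ≤ volume B := by
      calc volume (E ∩ B) + c * volume B ≤ volume (B \ H') + volume H' := by
            refine add_le_add ?_ hcH'
            calc volume (E ∩ B) ≤ volume (B \ H') + volume (E ∩ H') := by
                  refine (measure_mono ?_).trans (measure_union_le _ _)
                  intro z hz
                  by_cases hzH : z ∈ H'
                  · exact Or.inr ⟨hz.1, hzH⟩
                  · exact Or.inl ⟨hz.2, hzH⟩
              _ = volume (B \ H') := by rw [h2, add_zero]
        _ = volume B := by
            have := measure_inter_add_sdiff (μ := volume) B hm
            rwa [inter_eq_right.2 hH', add_comm] at this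
    have hc : c = c * volume B / volume B := by
      rw [mul_div_assoc, ENNReal.div_self hB hB', mul_one]
    rw [hc, ENNReal.div_add_div_same]
    exact ENNReal.div_le_of_le_mul (by rwa [one_mul])

variable [NeZero d]

/-- The heights near which a subset `E` of `Ω` is neither null nor conull in the layers of `Ω`. -/
def switchHeights (Ω E : Set (Vec d)) : Set ℝ :=
  {t | ∀ U, IsOpen U → t ∈ U →
    volume (E ∩ strip d U) ≠ 0 ∧ volume ((Ω \ E) ∩ strip d U) ≠ 0}

lemma isClosed_switchHeights (Ω E : Set (Vec d)) : IsClosed (switchHeights Ω E) := by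
  rw [← isOpen_compl_iff, isOpen_iff_forall_mem_open]
  intro t ht
  simp only [switchHeights, mem_compl_iff] at ht
  change ¬ (∀ U, IsOpen U → t ∈ U → _) at ht
  push Not at ht
  obtain ⟨U, hU, htU, h⟩ := ht
  refine ⟨U, fun s hs hs' => ?_, hU, htU⟩
  obtain ⟨h1, h2⟩ := hs' U hU hs
  exact h2 (h h1)

lemma notMem_switchHeights {Ω E : Set (Vec d)} {t : ℝ} (ht : t ∉ switchHeights Ω E) :
    ∃ U, IsOpen U ∧ t ∈ U ∧
      (volume (E ∩ strip d U) = 0 ∨ volume ((Ω \ E) ∩ strip d U) = 0) := by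
  change ¬ (∀ U, IsOpen U → t ∈ U → _) at ht
  push Not at ht
  obtain ⟨U, hU, htU, h⟩ := ht
  exact ⟨U, hU, htU, by tauto⟩

/-- If the boundary of `E` lies in layers and the slices of `Ω` are connected, then a slice at any
other height lies in `E` or in its complement, and so do almost all slices nearby. -/
lemma switchHeights_subset {Ω E : Set (Vec d)} (hΩ : IsOpen Ω) (hEΩ : E ⊆ Ω)
    (hslice : ∀ t : ℝ, IsPreconnected (Ω ∩ strip d {t})) {S : Set ℝ} (hS : S.Countable)
    (hfr : ∀ x ∈ frontier E, x ∈ Ω → x ⊤ ∈ S) : switchHeights Ω E ∩ heights Ω ⊆ S := by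
  rintro t ⟨ht, x, hx, hxt⟩
  by_contra htS
  change x ⊤ = t at hxt
  have key : ∀ t' ∉ S, ∀ F : Set (Vec d), (F = E ∨ F = Eᶜ) → (Ω ∩ strip d {t'} ∩ F).Nonempty →
      Ω ∩ strip d {t'} ⊆ F := by
    intro t' ht' F hF hne
    have hfrF : frontier F = frontier E := by
      rcases hF with rfl | rfl
      · rfl
      · exact frontier_compl E
    have hcov : Ω ∩ strip d {t'} ⊆ interior F ∪ interior Fᶜ := by
      intro z hz
      by_contra hz'
      have : z ∈ frontier F := by
        rw [mem_union, not_or, interior_compl, mem_compl_iff, not_not] at hz'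
        exact ⟨hz'.2, hz'.1⟩
      rw [hfrF] at this
      have h1 := hfr z this hz.1
      have h2 : z ⊤ = t' := hz.2
      exact ht' (h2 ▸ h1)
    obtain ⟨z, hz, hzF⟩ := hne
    have hz1 : z ∈ interior F := by
      rcases hcov hz with h | h
      · exact h
      · exact absurd hzF (interior_subset h)
    have := (hslice t').subset_left_of_subset_union isOpen_interior isOpen_interior
      (Disjoint.mono interior_subset interior_subset disjoint_compl_right) hcov ⟨z, hz, hz1⟩
    exact this.trans interior_subset
  have hxE : ∃ F : Set (Vec d), (F = E ∨ F = Eᶜ) ∧ x ∈ interior F := by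
    by_contra hcon
    push Not at hcon
    have h1 := hcon E (Or.inl rfl)
    have h2 := hcon Eᶜ (Or.inr rfl)
    rw [interior_compl, mem_compl_iff, not_not] at h2
    exact htS (hxt ▸ hfr x ⟨h2, h1⟩ hx)
  obtain ⟨F, hF, hxF⟩ := hxE
  obtain ⟨r, hr, hb⟩ := Metric.isOpen_iff.1 (hΩ.inter isOpen_interior) x ⟨hx, hxF⟩
  have hsub : (Ω \ F) ∩ strip d (Metric.ball t r) ⊆ strip d S := by
    rintro z ⟨⟨hzΩ, hzF⟩, hzt⟩
    by_contra hzS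
    have hlt : |z ⊤ - x ⊤| < r := by
      rw [hxt, ← Real.dist_eq]; exact hzt
    obtain ⟨h1, h2⟩ := add_eTop_mem_ball x hlt
    have h3 := hb h1
    exact hzF (key (z ⊤) hzS F hF ⟨_, ⟨h3.1, h2⟩, interior_subset h3.2⟩ ⟨hzΩ, rfl⟩)
  have hnull : volume ((Ω \ F) ∩ strip d (Metric.ball t r)) = 0 :=
    measure_mono_null hsub (volume_strip_countable hS)
  obtain ⟨h1, h2⟩ := ht _ Metric.isOpen_ball (Metric.mem_ball_self hr)
  rcases hF with rfl | rfl
  · exact h2 hnull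
  · refine h1 (le_antisymm ?_ zero_le)
    refine (measure_mono ?_).trans_eq hnull
    rintro z ⟨hz1, hz2⟩
    exact ⟨⟨hEΩ hz1, fun h => h hz1⟩, hz2⟩

/-- Off the switching heights, each height has a neighbourhood in which `E` is null or conull in the
layers of `Ω`; on an interval of heights only one of the two cases occurs, by connectedness. -/
lemma null_or_conull_of_disjoint_switchHeights {Ω E : Set (Vec d)} (hΩ : IsOpen Ω) {J : Set ℝ}
    (hJ : IsPreconnected J) (hJΩ : J ⊆ heights Ω)
    (hdisj : ∀ t ∈ J, t ∉ switchHeights Ω E) :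
    volume (E ∩ strip d J) = 0 ∨ volume ((Ω \ E) ∩ strip d J) = 0 := by
  have local_null : ∀ F : Set (Vec d), J ⊆ ⋃₀ {U | IsOpen U ∧ volume (F ∩ strip d U) = 0} →
      volume (F ∩ strip d J) = 0 := by
    intro F hF
    refine measure_null_of_locally_null _ fun x hx => ?_
    obtain ⟨U, ⟨hU, hU0⟩, hxU⟩ := hF hx.2
    refine ⟨F ∩ strip d U, ?_, hU0⟩
    exact mem_nhdsWithin.2 ⟨strip d U, isOpen_strip hU, hxU, fun z hz => ⟨hz.2.1, hz.1⟩⟩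
  set N := ⋃₀ {U | IsOpen U ∧ volume (E ∩ strip d U) = 0}
  set C := ⋃₀ {U | IsOpen U ∧ volume ((Ω \ E) ∩ strip d U) = 0}
  have hN : IsOpen N := isOpen_sUnion fun U hU => hU.1
  have hC : IsOpen C := isOpen_sUnion fun U hU => hU.1
  have hcov : J ⊆ N ∪ C := by
    intro t ht
    obtain ⟨U, hU, htU, h | h⟩ := notMem_switchHeights (hdisj t ht)
    · exact Or.inl ⟨U, ⟨hU, h⟩, htU⟩
    · exact Or.inr ⟨U, ⟨hU, h⟩, htU⟩
  have hNC : J ∩ (N ∩ C) = ∅ := by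
    by_contra hne
    obtain ⟨t, htJ, ⟨U, ⟨hU, hU0⟩, htU⟩, ⟨V, ⟨hV, hV0⟩, htV⟩⟩ := nonempty_iff_ne_empty.2 hne
    refine volume_strip_inter_ne_zero hΩ (hU.inter hV) ⟨htU, htV⟩ (hJΩ htJ) ?_
    refine measure_mono_null ?_ (measure_union_null hU0 hV0)
    rintro z ⟨hz, hzU, hzV⟩
    by_cases hzE : z ∈ E
    · exact Or.inl ⟨hzE, hzU⟩
    · exact Or.inr ⟨⟨hz, hzE⟩, hzV⟩
  rcases isPreconnected_iff_subset_of_disjoint.1 hJ N C hN hC hcov hNC with h | h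
  · exact Or.inl (local_null E h)
  · exact Or.inr (local_null (Ω \ E) h)

/-- At an isolated switching height, `E` fills one side of the slice and is null on the other. -/
lemma slice_subset_essBoundary {Ω E : Set (Vec d)} (hΩ : IsOpen Ω) {t : ℝ}
    {I : Set ℝ} (hI : IsOpen I) (hIΩ : I ⊆ heights Ω)
    (ht : t ∈ {t ∈ switchHeights Ω E ∩ I | ∃ V, IsOpen V ∧ V ∩ (switchHeights Ω E ∩ I) = {t}}) :
    Ω ∩ strip d {t} ⊆ essBoundary E := by
  obtain ⟨⟨htE, htI⟩, V, hV, hVt⟩ := ht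
  have htV : t ∈ V := by
    have : t ∈ V ∩ (switchHeights Ω E ∩ I) := by rw [hVt]; rfl
    exact this.1
  obtain ⟨δ, hδ, hb⟩ := Metric.isOpen_iff.1 (hV.inter hI) t ⟨htV, htI⟩
  have hout : ∀ s ∈ Metric.ball t δ, s ≠ t → s ∉ switchHeights Ω E := by
    intro s hs hst hsE
    have : s ∈ V ∩ (switchHeights Ω E ∩ I) := ⟨(hb hs).1, hsE, (hb hs).2⟩
    rw [hVt] at this
    exact hst this
  rw [Real.ball_eq_Ioo] at hb hout
  have hL := null_or_conull_of_disjoint_switchHeights (E := E) hΩ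
    (isPreconnected_Ioo (a := t - δ) (b := t))
    (fun s hs => hIΩ (hb ⟨hs.1, hs.2.trans (by linarith)⟩).2)
    (fun s hs => hout s ⟨hs.1, hs.2.trans (by linarith)⟩ hs.2.ne)
  have hR := null_or_conull_of_disjoint_switchHeights (E := E) hΩ
    (isPreconnected_Ioo (a := t) (b := t + δ))
    (fun s hs => hIΩ (hb ⟨lt_trans (by linarith) hs.1, hs.2⟩).2)
    (fun s hs => hout s ⟨lt_trans (by linarith) hs.1, hs.2⟩ hs.1.ne')
  have hglue : ∀ F : Set (Vec d), volume (F ∩ strip d (Ioo (t - δ) t)) = 0 →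
      volume (F ∩ strip d (Ioo t (t + δ))) = 0 →
      volume (F ∩ strip d (Ioo (t - δ) (t + δ))) = 0 := by
    intro F h1 h2
    refine measure_mono_null ?_ (measure_union_null (measure_union_null h1 h2) (volume_hyperplane t))
    rintro z ⟨hzF, hz⟩
    rcases lt_trichotomy (z ⊤) t with h | h | h
    · exact Or.inl (Or.inl ⟨hzF, hz.1, h⟩)
    · exact Or.inr h
    · exact Or.inl (Or.inr ⟨hzF, h, hz.2⟩)
  have htIoo : t ∈ Ioo (t - δ) (t + δ) := ⟨by linarith, by linarith⟩
  obtain ⟨hE1, hE2⟩ := htE _ isOpen_Ioo htIoo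
  rintro x ⟨hx, hxt⟩
  change x ⊤ = t at hxt
  obtain ⟨ρ, hρ, hbρ⟩ := Metric.isOpen_iff.1 hΩ x hx
  set c := ENNReal.ofReal ((1 / 4) ^ d)
  have hc : c ≠ 0 := by simp [c]
  refine mem_essBoundary_of_ratio hc ?_
  filter_upwards [Ioo_mem_nhdsGT (lt_min hδ hρ)] with r hr
  have hr0 : 0 < r := hr.1
  have hrδ : r < δ := hr.2.trans_le (min_le_left _ _)
  have hrρ : r < ρ := hr.2.trans_le (min_le_right _ _)
  set e := eTop d
  set Hp := Metric.ball x r ∩ {z | 0 < ⟪z - x, e⟫}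
  set Hn := Metric.ball x r ∩ {z | ⟪z - x, e⟫ < 0}
  have habs : ∀ z ∈ Metric.ball x r, |z ⊤ - t| < r := by
    intro z hz
    have h1 := abs_real_inner_le_norm (z - x) e
    rw [norm_eTop, mul_one, inner_eTop] at h1
    rw [mem_ball_iff_norm] at hz
    have h2 : (z - x) ⊤ = z ⊤ - t := by rw [← hxt]; rfl
    rw [h2] at h1
    linarith
  have hp : ∀ z ∈ Hp, z ∈ Ω ∧ z ∈ strip d (Ioo t (t + δ)) := by
    rintro z ⟨hz, hz2⟩
    have h1 := abs_lt.1 (habs z hz)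
    change 0 < ⟪z - x, e⟫ at hz2
    rw [inner_eTop] at hz2
    have h2 : (z - x) ⊤ = z ⊤ - t := by rw [← hxt]; rfl
    rw [h2] at hz2
    exact ⟨hbρ (Metric.ball_subset_ball hrρ.le hz), by linarith, by linarith⟩
  have hn : ∀ z ∈ Hn, z ∈ Ω ∧ z ∈ strip d (Ioo (t - δ) t) := by
    rintro z ⟨hz, hz2⟩
    have h1 := abs_lt.1 (habs z hz)
    change ⟪z - x, e⟫ < 0 at hz2
    rw [inner_eTop] at hz2
    have h2 : (z - x) ⊤ = z ⊤ - t := by rw [← hxt]; rfl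
    rw [h2] at hz2
    exact ⟨hbρ (Metric.ball_subset_ball hrρ.le hz), by linarith, by linarith⟩
  have hB0 := (Metric.measure_ball_pos volume x hr0).ne'
  have hBt : volume (Metric.ball x r) ≠ ⊤ := measure_ball_lt_top.ne
  have hgep := volume_half_ball_ge x e norm_eTop hr0
  have hgen := volume_half_ball_ge' x e norm_eTop hr0
  have hmp : MeasurableSet Hp := by
    refine measurableSet_ball.inter (measurableSet_lt measurable_const ?_)
    exact Continuous.measurable (by fun_prop)
  have hmn : MeasurableSet Hn := by
    refine measurableSet_ball.inter (measurableSet_lt ?_ measurable_const)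
    exact Continuous.measurable (by fun_prop)
  rcases hL with hL | hL <;> rcases hR with hR | hR
  · exact absurd (hglue _ hL hR) hE1
  · refine ratio_bounds hB0 hBt (H := Hp) (H' := Hn) inter_subset_left inter_subset_left hmn
      hgep hgen (measure_mono_null ?_ hR) (measure_mono_null ?_ hL)
    · exact fun z hz => ⟨⟨(hp z hz.1).1, hz.2⟩, (hp z hz.1).2⟩
    · exact fun z hz => ⟨hz.1, (hn z hz.2).2⟩
  · refine ratio_bounds hB0 hBt (H := Hn) (H' := Hp) inter_subset_left inter_subset_left hmp
      hgen hgep (measure_mono_null ?_ hL) (measure_mono_null ?_ hR)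
    · exact fun z hz => ⟨⟨(hn z hz.1).1, hz.2⟩, (hn z hz.1).2⟩
    · exact fun z hz => ⟨hz.1, (hp z hz.2).2⟩
  · exact absurd (hglue _ hL hR) hE2

/-- Only finitely many components of a layer partition switch near a given height, each of them
finitely often: every isolated switching height carries a slice of essential boundary, of measure
bounded below, and the total perimeter is finite. -/
lemma LayerPartition.exists_ball_finite {Ω : Set (Vec d)} (hΩ : IsOpen Ω)
    (hslice : ∀ t : ℝ, IsPreconnected (Ω ∩ strip d {t})) {P : ℕ → Set (Vec d)}
    (hP : LayerPartition Ω P) {t₀ : ℝ} (ht₀ : t₀ ∈ heights Ω) :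
    ∃ r > 0, Metric.ball t₀ r ⊆ heights Ω ∧
      ((⋃ j, switchHeights Ω (P j)) ∩ Metric.ball t₀ r).Finite := by
  obtain ⟨r₁, hr₁, c, hc, hcle⟩ := exists_le_hausdorffMeasure_slice hΩ ht₀
  obtain ⟨r₂, hr₂, hb₂⟩ := Metric.isOpen_iff.1 (isOpen_heights hΩ) t₀ ht₀
  set r := min r₁ r₂
  have hr : 0 < r := lt_min hr₁ hr₂
  set I := Metric.ball t₀ r
  have hIΩ : I ⊆ heights Ω := (Metric.ball_subset_ball (min_le_right _ _)).trans hb₂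
  refine ⟨r, hr, hIΩ, ?_⟩
  set C : ℕ → Set ℝ := fun j => switchHeights Ω (P j) ∩ I
  set Z : ℕ → Set ℝ := fun j => {t ∈ C j | ∃ V, IsOpen V ∧ V ∩ C j = {t}}
  obtain ⟨s, hs⟩ := hP.2
  have hcount : ∀ j, (C j).Countable := fun j => by
    refine (countable_range s).mono fun t ht => ?_
    refine switchHeights_subset hΩ (hP.1.subset j) hslice (countable_range s) ?_ ⟨ht.1, hIΩ ht.2⟩
    intro x hx hxΩ
    obtain ⟨i, hi⟩ := mem_iUnion.1 (hs ⟨mem_iUnion.2 ⟨j, hx⟩, hxΩ⟩)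
    exact ⟨i, hi.symm⟩
  have hcard : ∀ j (F : Finset ℝ), (F : Set ℝ) ⊆ Z j →
      (F.card : ℝ≥0∞) * c ≤ μH[(d : ℝ) - 1] (essBoundary (P j)) := by
    intro j F hF
    calc (F.card : ℝ≥0∞) * c = ∑ t ∈ F, c := by simp
      _ ≤ ∑ t ∈ F, μH[(d : ℝ) - 1] (Ω ∩ strip d {t}) := Finset.sum_le_sum fun t ht =>
          hcle t (Metric.ball_subset_ball (min_le_left _ _) (hF ht).1.2)
      _ = μH[(d : ℝ) - 1] (⋃ t ∈ F, Ω ∩ strip d {t}) := by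
          refine (measure_biUnion_finset ?_ fun t _ =>
            hΩ.measurableSet.inter (measurableSet_strip (measurableSet_singleton t))).symm
          intro a _ b _ hab
          refine disjoint_left.2 fun x hxa hxb => hab ?_
          exact (show x ⊤ = a from hxa.2).symm.trans hxb.2
      _ ≤ _ := measure_mono (iUnion₂_subset fun t ht =>
          slice_subset_essBoundary hΩ Metric.isOpen_ball hIΩ (hF ht))
  have hper : ∀ j, μH[(d : ℝ) - 1] (essBoundary (P j)) ≠ ⊤ := fun j =>
    ENNReal.ne_top_of_tsum_ne_top hP.1.perimeter.ne j
  have hZfin : ∀ j, (Z j).Finite := by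
    intro j
    by_contra hinf
    obtain ⟨n, hn⟩ := ENNReal.exists_nat_mul_gt hc (hper j)
    obtain ⟨F, hF, hFn⟩ := Set.Infinite.exists_subset_card_eq hinf n
    have := hcard j F hF
    rw [hFn] at this
    exact absurd hn (not_lt.2 this)
  have hJ : {j | (Z j).Nonempty}.Finite := by
    refine (ENNReal.finite_const_le_of_tsum_ne_top hP.1.perimeter.ne hc).subset ?_
    rintro j ⟨t, ht⟩
    have := hcard j {t} (by simpa using ht)
    simpa using this
  refine (hJ.biUnion fun j _ => hZfin j).subset ?_
  rintro t ⟨htU, htI⟩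
  obtain ⟨j, hj⟩ := mem_iUnion.1 htU
  have htZ : t ∈ Z j := subset_isolated_of_finite_isolated
    ((isClosed_switchHeights Ω (P j)).isLocallyClosed.inter Metric.isOpen_ball.isLocallyClosed)
    (hcount j) (hZfin j) ⟨hj, htI⟩
  exact mem_iUnion₂.2 ⟨j, ⟨t, htZ⟩, htZ⟩

/-- The switching heights of a layer partition are locally finite in the heights of `Ω`. -/
lemma LayerPartition.finite_inter_compact {Ω : Set (Vec d)} (hΩ : IsOpen Ω)
    (hslice : ∀ t : ℝ, IsPreconnected (Ω ∩ strip d {t})) {P : ℕ → Set (Vec d)}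
    (hP : LayerPartition Ω P) {K : Set ℝ} (hK : IsCompact K) (hKΩ : K ⊆ heights Ω) :
    ((⋃ j, switchHeights Ω (P j)) ∩ K).Finite := by
  have : ∀ K', IsCompact K' → K' ⊆ K → ((⋃ j, switchHeights Ω (P j)) ∩ K').Finite := by
    intro K' hK' hsub
    refine hK'.induction_on (p := fun A => ((⋃ j, switchHeights Ω (P j)) ∩ A).Finite)
      (by simp) (fun A B hAB hB => hB.subset (inter_subset_inter_right _ hAB))
      (fun A B hA hB => by rw [inter_union_distrib_left]; exact hA.union hB) fun t ht => ?_
    obtain ⟨r, hr, -, hfin⟩ := hP.exists_ball_finite hΩ hslice (hKΩ (hsub ht))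
    exact ⟨_, mem_nhdsWithin_of_mem_nhds (Metric.ball_mem_nhds t hr), hfin⟩
  exact this K hK le_rfl

lemma LayerPartition.countable_inter_heights {Ω : Set (Vec d)} (hΩ : IsOpen Ω)
    (hslice : ∀ t : ℝ, IsPreconnected (Ω ∩ strip d {t})) {P : ℕ → Set (Vec d)}
    (hP : LayerPartition Ω P) : ((⋃ j, switchHeights Ω (P j)) ∩ heights Ω).Countable := by
  obtain ⟨s, hs⟩ := hP.2
  refine (countable_range s).mono ?_
  rintro t ⟨ht, htΩ⟩
  obtain ⟨j, hj⟩ := mem_iUnion.1 ht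
  refine switchHeights_subset hΩ (hP.1.subset j) hslice (countable_range s) ?_ ⟨hj, htΩ⟩
  intro x hx hxΩ
  obtain ⟨i, hi⟩ := mem_iUnion.1 (hs ⟨mem_iUnion.2 ⟨j, hx⟩, hxΩ⟩)
  exact ⟨i, hi.symm⟩

/-- Away from the switching heights, one component fills the layers of `Ω`. -/
lemma LayerPartition.exists_conull {Ω : Set (Vec d)} (hΩ : IsOpen Ω)
    (hslice : ∀ t : ℝ, IsPreconnected (Ω ∩ strip d {t})) {P : ℕ → Set (Vec d)}
    (hP : LayerPartition Ω P) {t : ℝ} (ht : t ∈ heights Ω)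
    (hsw : ∀ j, t ∉ switchHeights Ω (P j)) :
    ∃ j, ∃ U, IsOpen U ∧ t ∈ U ∧ volume ((Ω \ P j) ∩ strip d U) = 0 := by
  obtain ⟨r, hr, hsub, hfin⟩ := hP.exists_ball_finite hΩ hslice ht
  have hopen := (Metric.isOpen_ball (x := t) (ε := r)).sdiff hfin.isClosed
  obtain ⟨δ, hδ, hb⟩ := Metric.isOpen_iff.1 hopen t ⟨Metric.mem_ball_self hr, fun h => by
    obtain ⟨j, hj⟩ := mem_iUnion.1 h.1
    exact hsw j hj⟩
  set U := Metric.ball t δ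
  have hU : IsPreconnected U := (convex_ball t δ).isPreconnected
  by_contra hcon
  push Not at hcon
  have hnull : ∀ j, volume (P j ∩ strip d U) = 0 := by
    intro j
    refine (null_or_conull_of_disjoint_switchHeights (E := P j) hΩ hU
      (fun s hs => hsub (hb hs).1) fun s hs hsj => (hb hs).2 ⟨mem_iUnion.2 ⟨j, hsj⟩, (hb hs).1⟩).resolve_right ?_
    exact hcon j U Metric.isOpen_ball (Metric.mem_ball_self hδ)
  refine volume_strip_inter_ne_zero hΩ (U := U) Metric.isOpen_ball (Metric.mem_ball_self hδ) ht ?_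
  refine measure_mono_null ?_ (measure_union_null hP.1.cover (measure_iUnion_null hnull))
  rintro z ⟨hz, hzU⟩
  by_cases h : z ∈ ⋃ j, P j
  · obtain ⟨j, hj⟩ := mem_iUnion.1 h
    exact Or.inr (mem_iUnion.2 ⟨j, hj, hzU⟩)
  · exact Or.inl ⟨hz, h⟩

end

/-! ### One-sided traces on hyperplanes -/

lemma exists_Icc_of_compact_subset_Ioo {a b : ℝ} (hab : a < b) {K : Set ℝ} (hK : IsCompact K)
    (hKab : K ⊆ Ioo a b) : ∃ c e, a < c ∧ c ≤ e ∧ e < b ∧ K ⊆ Icc c e := by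
  rcases K.eq_empty_or_nonempty with rfl | hne
  · exact ⟨(a + b) / 2, (a + b) / 2, by linarith, le_rfl, by linarith, empty_subset _⟩
  · obtain ⟨c, hc⟩ := hK.exists_isLeast hne
    obtain ⟨e, he⟩ := hK.exists_isGreatest hne
    exact ⟨c, e, (hKab hc.1).1, hc.2 he.1, (hKab he.1).2, fun x hx => ⟨hc.2 hx, he.2 hx⟩⟩

/-- The lemma of du Bois-Reymond on an interval. -/
lemma exists_const_of_integral_mul_deriv_eq_zero {a b : ℝ} (hab : a < b) {G : ℝ → ℝ}
    (hG : IntegrableOn G (Ioo a b))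
    (h : ∀ η : ℝ → ℝ, ContDiff ℝ ∞ η → HasCompactSupport η → tsupport η ⊆ Ioo a b →
      ∫ t in Ioo a b, G t * deriv η t = 0) :
    ∃ C, ∀ᵐ t ∂(volume.restrict (Ioo a b)), G t = C := by
  let f : ContDiffBump ((a + b) / 2) := ⟨(b - a) / 8, (b - a) / 4, by linarith, by linarith⟩
  set ρ : ℝ → ℝ := f.normed volume with hρdef
  have hρ : ContDiff ℝ ∞ ρ := f.contDiff_normed
  have hρc : HasCompactSupport ρ := f.hasCompactSupport_normed
  have hρs : tsupport ρ ⊆ Ioo a b := by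
    rw [hρdef, f.tsupport_normed_eq, Real.closedBall_eq_Icc]
    intro x hx
    have h1 : f.rOut = (b - a) / 4 := rfl
    rw [h1] at hx
    exact ⟨by linarith [hx.1], by linarith [hx.2]⟩
  have hρ1 : ∫ t, ρ t = 1 := f.integral_normed
  set C := ∫ t in Ioo a b, G t * ρ t with hC
  have hbd : ∀ η : ℝ → ℝ, ContDiff ℝ ∞ η → HasCompactSupport η →
      IntegrableOn (fun t => G t * η t) (Ioo a b) := by
    intro η hη hηc
    obtain ⟨M, hM⟩ := hη.continuous.bounded_above_of_compact_support hηc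
    exact hG.mul_bdd hη.continuous.aestronglyMeasurable (Eventually.of_forall hM)
  have hres : ∀ η : ℝ → ℝ, tsupport η ⊆ Ioo a b → ∀ H : ℝ → ℝ,
      ∫ t in Ioo a b, H t * η t = ∫ t, H t * η t := by
    intro η hη H
    refine setIntegral_eq_integral_of_forall_compl_eq_zero fun x hx => ?_
    rw [image_eq_zero_of_notMem_tsupport fun hx' => hx (hη hx'), mul_zero]
  refine ⟨C, ?_⟩
  have key := (isOpen_Ioo (a := a) (b := b)).ae_eq_zero_of_integral_contDiff_smul_eq_zero
    (μ := volume) (f := fun t => G t - C)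
    (IntegrableOn.locallyIntegrableOn (hG.sub (integrableOn_const (by simp)))) ?_
  · rw [ae_restrict_iff' measurableSet_Ioo]
    filter_upwards [key] with t ht htI using sub_eq_zero.1 (ht htI)
  · intro η hη hηc hηs
    set κ := ∫ t, η t with hκ
    set g : ℝ → ℝ := fun t => η t - κ * ρ t with hg
    have hgd : ContDiff ℝ ∞ g := hη.sub (contDiff_const.mul hρ)
    have hηi := hη.continuous.integrable_of_hasCompactSupport hηc (μ := volume)
    have hρi := hρ.continuous.integrable_of_hasCompactSupport hρc (μ := volume)
    have hg0 : ∫ t, g t = 0 := by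
      rw [hg, integral_sub hηi (hρi.const_mul κ), integral_const_mul, hρ1]
      simp [hκ]
    have hK : IsCompact (tsupport η ∪ tsupport ρ) := IsCompact.union hηc hρc
    obtain ⟨c, e, hac, hce, heb, hKce⟩ :=
      exists_Icc_of_compact_subset_Ioo hab hK (union_subset hηs hρs)
    have hgz : ∀ t, t ∉ Icc c e → g t = 0 := by
      intro t ht
      have h1 : η t = 0 := image_eq_zero_of_notMem_tsupport fun h => ht (hKce (Or.inl h))
      have h2 : ρ t = 0 := image_eq_zero_of_notMem_tsupport fun h => ht (hKce (Or.inr h))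
      simp [hg, h1, h2]
    set ζ : ℝ → ℝ := fun t => ∫ x in a..t, g x with hζ
    have hζd : ∀ t, HasDerivAt ζ (g t) t := fun t =>
      intervalIntegral.integral_hasDerivAt_right (hgd.continuous.intervalIntegrable _ _)
        (hgd.continuous.stronglyMeasurableAtFilter _ _) hgd.continuous.continuousAt
    have hderiv : deriv ζ = g := funext fun t => (hζd t).deriv
    have hζc : ContDiff ℝ ∞ ζ := by
      rw [contDiff_infty_iff_deriv, hderiv]
      exact ⟨fun t => (hζd t).differentiableAt, hgd⟩
    have hζz : ∀ t, t ∉ Icc c e → ζ t = 0 := by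
      intro t ht
      by_cases htc : t < c
      · refine intervalIntegral.integral_zero_ae (Eventually.of_forall fun x hx => hgz x ?_)
        intro hx'
        have : x ≤ max a t := hx.2
        exact absurd hx'.1 (not_le.2 (this.trans_lt (max_lt hac htc)))
      · have hte : e < t := by
          by_contra h'
          exact ht ⟨not_lt.1 htc, not_lt.1 h'⟩
        have hsupp : Function.support g ⊆ Ioc a t := by
          intro x hx
          by_contra hx'
          exact hx (hgz x fun hxc => hx' ⟨hac.trans_le hxc.1, hxc.2.trans hte.le⟩)
        simp only [hζ]
        rw [intervalIntegral.integral_eq_integral_of_support_subset hsupp, hg0]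
    have hζt : tsupport ζ ⊆ Icc c e :=
      closure_minimal (fun x hx => by by_contra hx'; exact hx (hζz x hx')) isClosed_Icc
    have hz := h ζ hζc (isCompact_Icc.of_isClosed_subset (isClosed_tsupport _) hζt)
      (hζt.trans fun x hx => ⟨hac.trans_le hx.1, hx.2.trans_lt heb⟩)
    rw [hderiv] at hz
    have hz' : (∫ t in Ioo a b, G t * η t) = κ * C := by
      have : (fun t => G t * g t) = fun t => G t * η t - κ * (G t * ρ t) := by
        ext t; simp only [hg]; ring
      rw [this, integral_sub (hbd η hη hηc) ((hbd ρ hρ hρc).const_mul κ), integral_const_mul,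
        sub_eq_zero] at hz
      exact hz
    have e1 : ∫ t, η t • (G t - C) = ∫ t in Ioo a b, (G t - C) * η t := by
      rw [hres η hηs]
      simp only [smul_eq_mul, mul_comm]
    rw [e1]
    simp only [sub_mul]
    rw [integral_sub (hbd η hη hηc) (hηi.const_mul C).integrableOn, hz', integral_const_mul]
    have e2 := hres η hηs (fun _ => 1)
    simp only [one_mul] at e2
    rw [e2]
    ring

/-- The distribution function of a finite measure `p` has the distributional derivative `p`. -/
lemma integral_measureReal_Iic_mul_deriv (p : Measure ℝ) [IsFiniteMeasure p] {η : ℝ → ℝ}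
    (hη : ContDiff ℝ ∞ η) (hc : HasCompactSupport η) :
    Integrable (fun t => p.real (Iic t) * deriv η t) ∧
    ∫ t, p.real (Iic t) * deriv η t = - ∫ τ, η τ ∂p := by
  have hd : Integrable (deriv η) := by
    refine Continuous.integrable_of_hasCompactSupport ?_ hc.deriv
    exact hη.continuous_deriv (by simp)
  set k : ℝ × ℝ → ℝ := fun z => (if z.2 ≤ z.1 then 1 else 0) * deriv η z.1 with hk
  have hint : Integrable k (volume.prod p) := by
    have h1 : Integrable (fun z : ℝ × ℝ => deriv η z.1 * (1 : ℝ)) (volume.prod p) :=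
      hd.mul_prod (integrable_const (1 : ℝ))
    simp only [mul_one] at h1
    refine h1.bdd_mul (c := 1) ?_ (Eventually.of_forall fun z => ?_)
    · exact (Measurable.ite (measurableSet_le measurable_snd measurable_fst) measurable_const
        measurable_const).aestronglyMeasurable
    · by_cases h : z.2 ≤ z.1 <;> simp [h]
  have hinner : ∀ t, ∫ τ, k (t, τ) ∂p = p.real (Iic t) * deriv η t := by
    intro t
    simp only [hk]
    rw [integral_mul_const]
    congr 1
    have : (fun τ => if τ ≤ t then (1 : ℝ) else 0) = (Iic t).indicator 1 := by
      ext τ; simp [indicator_apply]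
    rw [this, integral_indicator_one measurableSet_Iic]
  have hinner2 : ∀ τ, ∫ t, k (t, τ) = - η τ := by
    intro τ
    have : (fun t => k (t, τ)) = (Ici τ).indicator (deriv η) := by
      ext t; by_cases h : τ ≤ t <;> simp [hk, h]
    rw [this, integral_indicator measurableSet_Ici, integral_Ici_eq_integral_Ioi]
    exact HasCompactSupport.integral_Ioi_deriv_eq (hη.of_le (by simp)) hc τ
  refine ⟨?_, ?_⟩
  · have := hint.integral_prod_left
    simpa only [hinner] using this
  · have h1 := integral_integral_swap (f := fun t τ => k (t, τ)) hint
    simp only [hinner, hinner2] at h1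
    rw [h1, integral_neg]

/-- A function on an interval whose distributional derivative is a difference of two finite
measures is, up to a constant, the difference of their distribution functions. -/
lemma ae_eq_const_add_measureReal_Iic {a b : ℝ} (hab : a < b) {F : ℝ → ℝ}
    (hF : IntegrableOn F (Ioo a b)) (p q : Measure ℝ) [IsFiniteMeasure p] [IsFiniteMeasure q]
    (h : ∀ η : ℝ → ℝ, ContDiff ℝ ∞ η → HasCompactSupport η → tsupport η ⊆ Ioo a b →
      ∫ t in Ioo a b, F t * deriv η t = -((∫ τ, η τ ∂p) - ∫ τ, η τ ∂q)) :
    ∃ C, ∀ᵐ t ∂(volume.restrict (Ioo a b)), F t = C + (p.real (Iic t) - q.real (Iic t)) := by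
  have hmono : ∀ μ : Measure ℝ, IsFiniteMeasure μ → Integrable (fun t => μ.real (Iic t))
      (volume.restrict (Ioo a b)) := by
    intro μ hμ
    have hm : Monotone fun t => μ.real (Iic t) := fun s t hst =>
      measureReal_mono (Iic_subset_Iic.2 hst)
    refine Integrable.of_bound hm.measurable.aestronglyMeasurable (μ.real univ)
      (Eventually.of_forall fun t => ?_)
    rw [Real.norm_of_nonneg measureReal_nonneg]
    exact measureReal_mono (subset_univ _)
  have hzero : ∀ η : ℝ → ℝ, ContDiff ℝ ∞ η → HasCompactSupport η → tsupport η ⊆ Ioo a b →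
      ∫ t in Ioo a b, (F t - (p.real (Iic t) - q.real (Iic t))) * deriv η t = 0 := by
    intro η hη hc hs
    obtain ⟨hpi, hp⟩ := integral_measureReal_Iic_mul_deriv p hη hc
    obtain ⟨hqi, hq⟩ := integral_measureReal_Iic_mul_deriv q hη hc
    have hres : ∀ H : ℝ → ℝ, ∫ t in Ioo a b, H t * deriv η t = ∫ t, H t * deriv η t := by
      intro H
      refine setIntegral_eq_integral_of_forall_compl_eq_zero fun x hx => ?_
      rw [image_eq_zero_of_notMem_tsupport fun hx' => hx (hs (tsupport_deriv_subset hx')),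
        mul_zero]
    have hFi : IntegrableOn (fun t => F t * deriv η t) (Ioo a b) := by
      have hcont := hη.continuous_deriv (by simp)
      obtain ⟨M, hM⟩ := hcont.bounded_above_of_compact_support hc.deriv
      exact hF.mul_bdd hcont.aestronglyMeasurable (Eventually.of_forall hM)
    simp only [sub_mul]
    have hpq : IntegrableOn (fun t => p.real (Iic t) * deriv η t - q.real (Iic t) * deriv η t)
        (Ioo a b) := hpi.integrableOn.sub hqi.integrableOn
    rw [integral_sub hFi hpq, integral_sub hpi.integrableOn hqi.integrableOn, h η hη hc hs, hres, hres, hp, hq]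
    ring
  obtain ⟨C, hC⟩ := exists_const_of_integral_mul_deriv_eq_zero hab
    (hF.sub ((hmono p inferInstance).sub (hmono q inferInstance))) hzero
  refine ⟨C, hC.mono fun t ht => ?_⟩
  simp only [Pi.sub_apply] at ht
  linarith

/-! ### Slices of a function with a derivative measure -/

/-- Test functions, bounded by `1`, that converge pointwise to the indicator function of a bounded
open set. -/
lemma exists_test_tendsto_indicator {E : Type*} [NormedAddCommGroup E] [NormedSpace ℝ E]
    [FiniteDimensional ℝ E] {A : Set E} (hA : IsOpen A) (hb : Bornology.IsBounded A) :
    ∃ φ : ℕ → E → ℝ, (∀ n, ContDiff ℝ ∞ (φ n) ∧ HasCompactSupport (φ n) ∧ tsupport (φ n) ⊆ A ∧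
      ∀ x, ‖φ n x‖ ≤ 1) ∧
      ∀ x, Tendsto (fun n => φ n x) atTop (𝓝 (A.indicator (fun _ => 1) x)) := by
  obtain ⟨f, hf, hfd, hfr⟩ := hA.exists_contDiff_support_eq
  have hf0 : ∀ x, 0 ≤ f x := fun x => (hfr ⟨x, rfl⟩).1
  have hfd' : ContDiff ℝ ∞ f := hfd.of_le (by exact_mod_cast le_top)
  have hsub : ∀ n : ℕ, tsupport (fun x => Real.smoothTransition (n * f x - 1)) ⊆
      {x | 1 ≤ n * f x} := by
    intro n
    refine closure_minimal (fun x hx => ?_) (isClosed_le continuous_const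
      (continuous_const.mul hfd.continuous))
    by_contra h'
    refine hx (Real.smoothTransition.zero_of_nonpos ?_)
    have : n * f x < 1 := not_le.1 h'
    linarith
  have hsubA : ∀ n : ℕ, {x | 1 ≤ n * f x} ⊆ A := by
    intro n x hx
    change 1 ≤ n * f x at hx
    rw [← hf]
    intro h0
    rw [h0, mul_zero] at hx
    linarith
  refine ⟨fun n x => Real.smoothTransition (n * f x - 1), fun n => ⟨?_, ?_, (hsub n).trans (hsubA n),
    fun x => ?_⟩, fun x => ?_⟩
  · exact (Real.smoothTransition.contDiff (n := ⊤)).comp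
      ((contDiff_const.mul hfd').sub contDiff_const)
  · exact Metric.isCompact_of_isClosed_isBounded (isClosed_tsupport _)
      (hb.subset ((hsub n).trans (hsubA n)))
  · rw [Real.norm_of_nonneg (Real.smoothTransition.nonneg _)]
    exact Real.smoothTransition.le_one _
  · by_cases hx : x ∈ A
    · rw [indicator_of_mem hx]
      have hpos : 0 < f x := (hf0 x).lt_of_ne' (by rw [← hf] at hx; exact hx)
      obtain ⟨N, hN⟩ := exists_nat_gt (2 / f x)
      refine tendsto_const_nhds.congr' ?_
      filter_upwards [eventually_ge_atTop N] with n hn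
      refine (Real.smoothTransition.one_of_one_le ?_).symm
      have h1 : (2 : ℝ) < N * f x := (div_lt_iff₀ hpos).1 hN
      have h2 : (N : ℝ) * f x ≤ n * f x := by gcongr
      linarith
    · rw [indicator_of_notMem hx]
      have h0 : f x = 0 := by
        rw [← hf] at hx
        simpa using hx
      simp only [h0, mul_zero]
      rw [Real.smoothTransition.zero_of_nonpos (by norm_num)]
      exact tendsto_const_nhds

section Slices

variable {m : ℕ} {a b : ℝ} {Q : Set (Fin m → ℝ)} {v : ℝ × (Fin m → ℝ) → ℝ}
  {p q : Measure (ℝ × (Fin m → ℝ))}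

/-- The difference `p - q` of two measures is the derivative of `v` in the first variable, in the
open box `(a, b) × Q`; the test functions are products. -/
def HasFstDeriv (a b : ℝ) (Q : Set (Fin m → ℝ)) (v : ℝ × (Fin m → ℝ) → ℝ)
    (p q : Measure (ℝ × (Fin m → ℝ))) : Prop :=
  ∀ η : ℝ → ℝ, ContDiff ℝ ∞ η → HasCompactSupport η → tsupport η ⊆ Ioo a b →
    ∀ φ : (Fin m → ℝ) → ℝ, ContDiff ℝ ∞ φ → HasCompactSupport φ → tsupport φ ⊆ Q →
    ∫ z in Ioo a b ×ˢ Q, v z * (deriv η z.1 * φ z.2) =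
      -((∫ z, η z.1 * φ z.2 ∂p) - ∫ z, η z.1 * φ z.2 ∂q)

/-- The defining identity for test functions in the first variable alone, on `(a, b) × A` with an
open `A`; the product test functions exhaust the indicator function of `A`. -/
lemma HasFstDeriv.integral_open [IsFiniteMeasure p] [IsFiniteMeasure q]
    (h : HasFstDeriv a b Q v p q) (hv : IntegrableOn v (Ioo a b ×ˢ Q))
    {A : Set (Fin m → ℝ)} (hA : IsOpen A) (hb : Bornology.IsBounded A) (hAQ : A ⊆ Q) {η : ℝ → ℝ}
    (hη : ContDiff ℝ ∞ η) (hc : HasCompactSupport η) (hs : tsupport η ⊆ Ioo a b) :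
    ∫ z in Ioo a b ×ˢ A, v z * deriv η z.1 =
      -((∫ z in univ ×ˢ A, η z.1 ∂p) - ∫ z in univ ×ˢ A, η z.1 ∂q) := by
  obtain ⟨φ, hφ, hlim⟩ := exists_test_tendsto_indicator hA hb
  have hcont := hη.continuous_deriv (by simp)
  obtain ⟨M, hM⟩ := hη.continuous.bounded_above_of_compact_support hc
  obtain ⟨M', hM'⟩ := hcont.bounded_above_of_compact_support hc.deriv
  have hmA : MeasurableSet ((univ : Set ℝ) ×ˢ A) := MeasurableSet.univ.prod hA.measurableSet
  have hright : ∀ μ : Measure (ℝ × (Fin m → ℝ)), IsFiniteMeasure μ →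
      Tendsto (fun n => ∫ z, η z.1 * φ n z.2 ∂μ) atTop (𝓝 (∫ z in univ ×ˢ A, η z.1 ∂μ)) := by
    intro μ hμ
    rw [← integral_indicator hmA]
    refine tendsto_integral_of_dominated_convergence (fun _ => M) (fun n => ?_)
      (integrable_const M) (fun n => Eventually.of_forall fun z => ?_)
      (Eventually.of_forall fun z => ?_)
    · exact ((hη.continuous.comp continuous_fst).mul
        ((hφ n).1.continuous.comp continuous_snd)).aestronglyMeasurable
    · rw [norm_mul]
      calc ‖η z.1‖ * ‖φ n z.2‖ ≤ M * 1 := by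
            refine mul_le_mul (hM _) ((hφ n).2.2.2 _) (norm_nonneg _) ?_
            exact (norm_nonneg _).trans (hM z.1)
        _ = M := mul_one M
    · have := (hlim z.2).const_mul (η z.1)
      convert this using 2
      by_cases hz : z.2 ∈ A <;> simp [hz, indicator]
  have hleft : Tendsto (fun n => ∫ z in Ioo a b ×ˢ Q, v z * (deriv η z.1 * φ n z.2)) atTop
      (𝓝 (∫ z in Ioo a b ×ˢ A, v z * deriv η z.1)) := by
    have hset : Ioo a b ×ˢ A = (Ioo a b ×ˢ Q) ∩ (univ ×ˢ A) := by
      rw [prod_inter_prod, inter_univ, inter_eq_right.2 hAQ]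
    rw [hset, inter_comm, ← Measure.restrict_restrict hmA, ← integral_indicator hmA]
    refine tendsto_integral_of_dominated_convergence (fun z => M' * ‖v z‖) (fun n => ?_)
      (hv.norm.const_mul M') (fun n => Eventually.of_forall fun z => ?_)
      (Eventually.of_forall fun z => ?_)
    · exact hv.aestronglyMeasurable.mul ((hcont.comp continuous_fst).mul
        ((hφ n).1.continuous.comp continuous_snd)).aestronglyMeasurable
    · rw [norm_mul, norm_mul, mul_comm]
      refine mul_le_mul_of_nonneg_right ?_ (norm_nonneg _)
      calc ‖deriv η z.1‖ * ‖φ n z.2‖ ≤ M' * 1 := by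
            refine mul_le_mul (hM' _) ((hφ n).2.2.2 _) (norm_nonneg _) ?_
            exact (norm_nonneg _).trans (hM' z.1)
        _ = M' := mul_one M'
    · have := ((hlim z.2).const_mul (deriv η z.1)).const_mul (v z)
      convert this using 2
      by_cases hz : z.2 ∈ A <;> simp [hz, indicator]
  refine tendsto_nhds_unique hleft ?_
  have := ((hright p inferInstance).sub (hright q inferInstance)).neg
  refine this.congr fun n => ?_
  exact (h η hη hc hs (φ n) (hφ n).1 (hφ n).2.1 ((hφ n).2.2.1.trans hAQ)).symm

/-- The integrals of the slices of `v` over `A` have, as a function of the height, the difference of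
the marginals of `p` and `q` as their derivative. -/
lemma HasFstDeriv.ae_slice_eq [IsFiniteMeasure p] [IsFiniteMeasure q] (hab : a < b)
    (h : HasFstDeriv a b Q v p q) (hv : IntegrableOn v (Ioo a b ×ˢ Q))
    {A : Set (Fin m → ℝ)} (hA : IsOpen A) (hb : Bornology.IsBounded A) (hAQ : A ⊆ Q) :
    ∃ C, ∀ᵐ t ∂(volume.restrict (Ioo a b)),
      ∫ x in A, v (t, x) = C + (p.real (Iic t ×ˢ A) - q.real (Iic t ×ˢ A)) := by
  have hmA : MeasurableSet ((univ : Set ℝ) ×ˢ A) := MeasurableSet.univ.prod hA.measurableSet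
  have hvA : IntegrableOn v (Ioo a b ×ˢ A) := hv.mono_set (prod_mono_right hAQ)
  have hvA' : Integrable v ((volume.restrict (Ioo a b)).prod (volume.restrict A)) := by
    rwa [Measure.prod_restrict]
  have hreal : ∀ μ : Measure (ℝ × (Fin m → ℝ)), ∀ t,
      ((μ.restrict (univ ×ˢ A)).map Prod.fst).real (Iic t) = μ.real (Iic t ×ˢ A) := by
    intro μ t
    rw [map_measureReal_apply measurable_fst measurableSet_Iic,
      measureReal_restrict_apply (measurable_fst measurableSet_Iic)]
    congr 1
    ext z; simp
  have hmap : ∀ (μ : Measure (ℝ × (Fin m → ℝ))) (η : ℝ → ℝ), Continuous η →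
      ∫ τ, η τ ∂((μ.restrict (univ ×ˢ A)).map Prod.fst) = ∫ z in univ ×ˢ A, η z.1 ∂μ :=
    fun μ η hη => integral_map measurable_fst.aemeasurable hη.aestronglyMeasurable
  have hweak : ∀ η : ℝ → ℝ, ContDiff ℝ ∞ η → HasCompactSupport η → tsupport η ⊆ Ioo a b →
      ∫ t in Ioo a b, (∫ x in A, v (t, x)) * deriv η t =
        -((∫ τ, η τ ∂((p.restrict (univ ×ˢ A)).map Prod.fst)) -
          ∫ τ, η τ ∂((q.restrict (univ ×ˢ A)).map Prod.fst)) := by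
    intro η hη hc hs
    rw [hmap _ _ hη.continuous, hmap _ _ hη.continuous, ← h.integral_open hv hA hb hAQ hη hc hs]
    have hcont := hη.continuous_deriv (by simp)
    obtain ⟨M, hM⟩ := hcont.bounded_above_of_compact_support hc.deriv
    have hint : Integrable (fun z : ℝ × (Fin m → ℝ) => v z * deriv η z.1)
        ((volume.restrict (Ioo a b)).prod (volume.restrict A)) :=
      hvA'.mul_bdd (hcont.comp continuous_fst).aestronglyMeasurable
        (Eventually.of_forall fun z => hM z.1)
    rw [Measure.volume_eq_prod, ← Measure.prod_restrict, integral_prod _ hint]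
    simp only [integral_mul_const]
  obtain ⟨C, hC⟩ := ae_eq_const_add_measureReal_Iic hab hvA'.integral_prod_left
    ((p.restrict (univ ×ˢ A)).map Prod.fst) ((q.restrict (univ ×ˢ A)).map Prod.fst) hweak
  refine ⟨C, hC.mono fun t ht => ?_⟩
  rw [ht, hreal, hreal]

/-- For almost all heights `t₁ < t₂`, the increment of the slices of `v` is the mass of the
derivative between them, as a set function on the slice. -/
lemma HasFstDeriv.exists_slices [IsFiniteMeasure p] [IsFiniteMeasure q] (hab : a < b)
    (h : HasFstDeriv a b Q v p q) (hv : IntegrableOn v (Ioo a b ×ˢ Q)) (hQ : IsOpen Q)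
    (hQb : Bornology.IsBounded Q) :
    ∃ G : Set ℝ, G ⊆ Ioo a b ∧ volume (Ioo a b \ G) = 0 ∧
      (∀ t ∈ G, IntegrableOn (fun x => v (t, x)) Q) ∧
      ∀ t₁ ∈ G, ∀ t₂ ∈ G, t₁ < t₂ → ∀ A ⊆ Q, MeasurableSet A →
        (∫ x in A, v (t₂, x)) - ∫ x in A, v (t₁, x) =
          p.real (Ioc t₁ t₂ ×ˢ A) - q.real (Ioc t₁ t₂ ×ˢ A) := by
  -- a countable family of open sets, closed under intersections, that generates the Borel sets
  set B := TopologicalSpace.countableBasis (Fin m → ℝ)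
  have hBc : Countable B := (TopologicalSpace.countable_countableBasis _).to_subtype
  set S : Finset B → Set (Fin m → ℝ) := fun F => ⋂ U ∈ F, (U : Set (Fin m → ℝ)) with hS
  have hSo : ∀ F, IsOpen (S F) := fun F => isOpen_biInter_finset fun U _ =>
    TopologicalSpace.isOpen_of_mem_countableBasis U.2
  have hSpi : IsPiSystem (range S) := by
    classical
    rintro _ ⟨F, rfl⟩ _ ⟨F', rfl⟩ -
    refine ⟨F ∪ F', ?_⟩
    ext x
    simp only [hS, mem_iInter, Finset.mem_union, mem_inter_iff]
    exact ⟨fun hx => ⟨fun U hU => hx U (Or.inl hU), fun U hU => hx U (Or.inr hU)⟩,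
      fun hx U hU => hU.elim (hx.1 U) (hx.2 U)⟩
  have hgen : (inferInstance : MeasurableSpace (Fin m → ℝ)) =
      MeasurableSpace.generateFrom (range S) := by
    refine le_antisymm ?_ ?_
    · rw [BorelSpace.measurable_eq (α := Fin m → ℝ),
        (TopologicalSpace.isBasis_countableBasis (Fin m → ℝ)).borel_eq_generateFrom]
      refine MeasurableSpace.generateFrom_mono fun U hU => ⟨{⟨U, hU⟩}, ?_⟩
      exact Finset.set_biInter_singleton (⟨U, hU⟩ : B) fun V : B => (V : Set (Fin m → ℝ))
    · refine MeasurableSpace.generateFrom_le ?_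
      rintro _ ⟨F, rfl⟩
      exact (hSo F).measurableSet
  choose C hC using fun F => h.ae_slice_eq hab hv ((hSo F).inter hQ)
    (hQb.subset inter_subset_right) inter_subset_right
  have hvQ : Integrable v ((volume.restrict (Ioo a b)).prod (volume.restrict Q)) := by
    rwa [Measure.prod_restrict]
  have hgood : ∀ᵐ t ∂(volume.restrict (Ioo a b)), IntegrableOn (fun x => v (t, x)) Q ∧
      ∀ F, ∫ x in S F ∩ Q, v (t, x) =
        C F + (p.real (Iic t ×ˢ (S F ∩ Q)) - q.real (Iic t ×ˢ (S F ∩ Q))) := by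
    filter_upwards [hvQ.prod_right_ae, ae_all_iff.2 hC] with t h1 h2
    exact ⟨h1, h2⟩
  set G := {t ∈ Ioo a b | IntegrableOn (fun x => v (t, x)) Q ∧
      ∀ F, ∫ x in S F ∩ Q, v (t, x) =
        C F + (p.real (Iic t ×ˢ (S F ∩ Q)) - q.real (Iic t ×ˢ (S F ∩ Q)))} with hG
  refine ⟨G, fun t ht => ht.1, ?_, fun t ht => ht.2.1, ?_⟩
  · rw [ae_restrict_iff' measurableSet_Ioo] at hgood
    refine measure_mono_null ?_ (ae_iff.1 hgood)
    rintro t ⟨htI, htG⟩ htc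
    exact htG ⟨htI, htc htI⟩
  · intro t₁ ht₁ t₂ ht₂ hlt
    have hIoc : ∀ (μ : Measure (ℝ × (Fin m → ℝ))) [IsFiniteMeasure μ] (A : Set (Fin m → ℝ)),
        MeasurableSet A →
        μ.real (Ioc t₁ t₂ ×ˢ A) = μ.real (Iic t₂ ×ˢ A) - μ.real (Iic t₁ ×ˢ A) := by
      intro μ _ A hA
      rw [← measureReal_sdiff (prod_mono_left (Iic_subset_Iic.2 hlt.le))
        (measurableSet_Iic.prod hA)]
      congr 1
      ext z
      simp only [mem_prod, mem_Ioc, Set.mem_sdiff, mem_Iic]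
      constructor
      · rintro ⟨⟨h1, h2⟩, h3⟩
        exact ⟨⟨h2, h3⟩, fun h4 => absurd h1 (not_lt.2 h4.1)⟩
      · rintro ⟨⟨h1, h2⟩, h3⟩
        exact ⟨⟨not_le.1 fun h4 => h3 ⟨h4, h2⟩, h1⟩, h2⟩
    set f : (Fin m → ℝ) → ℝ := fun x => v (t₂, x) - v (t₁, x) with hf
    have hfi : Integrable f (volume.restrict Q) := ht₂.2.1.sub ht₁.2.1
    set p' := (p.restrict (Ioc t₁ t₂ ×ˢ Q)).map Prod.snd
    set q' := (q.restrict (Ioc t₁ t₂ ×ˢ Q)).map Prod.snd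
    have hmap : ∀ (μ : Measure (ℝ × (Fin m → ℝ))) [IsFiniteMeasure μ] (A : Set (Fin m → ℝ)),
        MeasurableSet A → ((μ.restrict (Ioc t₁ t₂ ×ˢ Q)).map Prod.snd).real A =
          μ.real (Ioc t₁ t₂ ×ˢ (A ∩ Q)) := by
      intro μ _ A hA
      rw [map_measureReal_apply measurable_snd hA,
        measureReal_restrict_apply (measurable_snd hA)]
      congr 1
      ext z
      simp only [mem_inter_iff, mem_preimage, mem_prod]
      tauto
    have hle : ∀ A : Set (Fin m → ℝ), MeasurableSet A →
        (volume.restrict Q).withDensityᵥ f A =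
          (∫ x in A ∩ Q, v (t₂, x)) - ∫ x in A ∩ Q, v (t₁, x) := by
      intro A hA
      rw [withDensityᵥ_apply hfi hA, Measure.restrict_restrict hA, hf,
        integral_sub (ht₂.2.1.mono_set inter_subset_right)
          (ht₁.2.1.mono_set inter_subset_right)]
    have hre : ∀ A : Set (Fin m → ℝ), MeasurableSet A →
        (p'.toSignedMeasure - q'.toSignedMeasure) A =
          p.real (Ioc t₁ t₂ ×ˢ (A ∩ Q)) - q.real (Ioc t₁ t₂ ×ˢ (A ∩ Q)) := by
      intro A hA
      rw [Measure.toSignedMeasure_sub_apply hA, hmap p A hA, hmap q A hA]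
    have hstep : ∀ F, (volume.restrict Q).withDensityᵥ f (S F) =
        (p'.toSignedMeasure - q'.toSignedMeasure) (S F) := by
      intro F
      rw [hle _ (hSo F).measurableSet, hre _ (hSo F).measurableSet, ht₁.2.2 F, ht₂.2.2 F,
        hIoc p _ ((hSo F).inter hQ).measurableSet, hIoc q _ ((hSo F).inter hQ).measurableSet]
      ring
    have heq : (volume.restrict Q).withDensityᵥ f = p'.toSignedMeasure - q'.toSignedMeasure := by
      refine VectorMeasure.ext_of_generateFrom (range S) ?_ hgen hSpi ?_
      · rintro _ ⟨F, rfl⟩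
        exact hstep F
      · have := hstep ∅
        simpa [hS] using this
    intro A hAQ hA
    have := hle A hA
    rw [heq, hre A hA, inter_eq_left.2 hAQ] at this
    exact this.symm

end Slices

/-! ### Traces as densities -/

section Traces

variable {m : ℕ} {Q : Set (Fin m → ℝ)}

/-- If the slices `v t` differ from a fixed set function by signed measures `D t` that are small
along a sequence of `t`, then this set function is absolutely continuous; its density is the
trace. -/
lemma exists_trace (hQ : MeasurableSet Q) {v : ℝ → (Fin m → ℝ) → ℝ} {G : Set ℝ}
    (hint : ∀ t ∈ G, IntegrableOn (v t) Q) (D : ℝ → SignedMeasure (Fin m → ℝ))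
    (hD : ∀ t ∈ G, ∀ t' ∈ G, ∀ A ⊆ Q, MeasurableSet A →
      (∫ x in A, v t x) - ∫ x in A, v t' x = D t A - D t' A)
    (τ : ℕ → ℝ) (hτ : ∀ n, τ n ∈ G) (e : ℕ → ℝ) (he : Tendsto e atTop (𝓝 0))
    (hsmall : ∀ n A, |D (τ n) A| ≤ e n) :
    ∃ w : (Fin m → ℝ) → ℝ, Measurable w ∧ IntegrableOn w Q ∧ ∀ t ∈ G, ∀ A ⊆ Q, MeasurableSet A →
      (∫ x in A, v t x) - ∫ x in A, w x = D t A := by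
  set T : SignedMeasure (Fin m → ℝ) :=
    (volume.restrict Q).withDensityᵥ (v (τ 0)) - (D (τ 0)).restrict Q with hT
  have hTA : ∀ A, MeasurableSet A → ∀ n, T A = (∫ x in A ∩ Q, v (τ n) x) - D (τ n) (A ∩ Q) := by
    intro A hA n
    have h1 := hD (τ 0) (hτ 0) (τ n) (hτ n) (A ∩ Q) inter_subset_right (hA.inter hQ)
    rw [hT, sub_apply, withDensityᵥ_apply (hint _ (hτ 0)) hA,
      Measure.restrict_restrict hA, VectorMeasure.restrict_apply _ hQ hA]
    linarith
  have hac : T ≪ᵥ (volume.restrict Q).toENNRealVectorMeasure := by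
    refine VectorMeasure.AbsolutelyContinuous.mk fun A hA hA0 => ?_
    rw [Measure.toENNRealVectorMeasure_apply_measurable hA, Measure.restrict_apply hA] at hA0
    have hb : ∀ n, |T A| ≤ e n := by
      intro n
      rw [hTA A hA n, setIntegral_measure_zero _ hA0, zero_sub, abs_neg]
      exact hsmall n _
    have : |T A| ≤ 0 := ge_of_tendsto' he hb
    exact abs_nonpos_iff.1 this
  have hRN := T.withDensityᵥ_rnDeriv_eq (volume.restrict Q) hac
  refine ⟨T.rnDeriv (volume.restrict Q), SignedMeasure.measurable_rnDeriv _ _,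
    SignedMeasure.integrable_rnDeriv _ _, fun t ht A hAQ hA => ?_⟩
  have h1 : T A = ∫ x in A, T.rnDeriv (volume.restrict Q) x := by
    conv_lhs => rw [← hRN]
    rw [withDensityᵥ_apply (SignedMeasure.integrable_rnDeriv _ _) hA,
      Measure.restrict_restrict hA, inter_eq_left.2 hAQ]
  have h2 := hTA A hA 0
  rw [inter_eq_left.2 hAQ] at h2
  have h3 := hD t ht (τ 0) (hτ 0) A hAQ hA
  rw [← h1, h2]
  linarith

/-- The signed measure `A ↦ μ (S × A)`. -/
def sliceMeasure (μ : SignedMeasure (ℝ × (Fin m → ℝ))) (S : Set ℝ) :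
    SignedMeasure (Fin m → ℝ) :=
  (μ.restrict (S ×ˢ univ)).map Prod.snd

lemma sliceMeasure_apply (μ : SignedMeasure (ℝ × (Fin m → ℝ))) {S : Set ℝ} (hS : MeasurableSet S)
    {A : Set (Fin m → ℝ)} (hA : MeasurableSet A) : sliceMeasure μ S A = μ (S ×ˢ A) := by
  rw [sliceMeasure, VectorMeasure.map_apply _ measurable_snd hA,
    VectorMeasure.restrict_apply _ (hS.prod MeasurableSet.univ) (measurable_snd hA)]
  congr 1
  ext z
  simp only [mem_inter_iff, mem_preimage, mem_prod, mem_univ, and_true]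
  tauto

lemma variation_sliceMeasure_le (μ : SignedMeasure (ℝ × (Fin m → ℝ))) {S : Set ℝ}
    {A : Set (Fin m → ℝ)} (hA : MeasurableSet A) :
    (sliceMeasure μ S).variation A ≤ μ.totalVariation (S ×ˢ A) := by
  rw [SignedMeasure.totalVariation_eq_variation]
  calc (sliceMeasure μ S).variation A
      ≤ ((μ.restrict (S ×ˢ univ)).variation.map Prod.snd) A :=
        VectorMeasure.variation_map_le A
    _ = (μ.restrict (S ×ˢ univ)).variation (Prod.snd ⁻¹' A) := Measure.map_apply measurable_snd hA
    _ ≤ (μ.variation.restrict (S ×ˢ univ)) (Prod.snd ⁻¹' A) :=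
        VectorMeasure.variation_restrict_le _
    _ = μ.variation (S ×ˢ A) := by
        rw [Measure.restrict_apply (measurable_snd hA)]
        congr 1
        ext z
        simp only [mem_inter_iff, mem_preimage, mem_prod, mem_univ, and_true]
        tauto

/-- If the difference of the integrals of `v` and `w` is the set function `D`, then its variation
bounds the `L¹`-distance of `v` and `w`. -/
lemma lintegral_enorm_sub_le {v w : (Fin m → ℝ) → ℝ} (hQ : MeasurableSet Q)
    (hv : IntegrableOn v Q) (hw : IntegrableOn w Q) (D : SignedMeasure (Fin m → ℝ))
    (h : ∀ A ⊆ Q, MeasurableSet A → (∫ x in A, v x) - ∫ x in A, w x = D A)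
    {A : Set (Fin m → ℝ)} (hAQ : A ⊆ Q) (hA : MeasurableSet A) :
    ∫⁻ x in A, ‖v x - w x‖ₑ ≤ D.variation A := by
  have hvw : Integrable (fun x => v x - w x) (volume.restrict Q) := hv.sub hw
  have heq : (volume.restrict Q).withDensityᵥ (fun x => v x - w x) = D.restrict Q := by
    ext B hB
    rw [withDensityᵥ_apply hvw hB, Measure.restrict_restrict hB,
      VectorMeasure.restrict_apply _ hQ hB, ← h _ inter_subset_right (hB.inter hQ),
      integral_sub (hv.mono_set inter_subset_right) (hw.mono_set inter_subset_right)]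
  have hvar := Measure.variation_withDensityᵥ hvw
  rw [heq] at hvar
  calc ∫⁻ x in A, ‖v x - w x‖ₑ = (D.restrict Q).variation A := by
        rw [hvar, withDensity_apply _ hA, Measure.restrict_restrict hA, inter_eq_left.2 hAQ]
    _ ≤ (D.variation.restrict Q) A := VectorMeasure.variation_restrict_le _
    _ ≤ D.variation A := Measure.restrict_apply_le _ _

lemma measurableSet_punctured (s r : ℝ) : MeasurableSet {t : ℝ | 0 < |t - s| ∧ |t - s| ≤ r} :=
  have hf : Measurable fun t : ℝ => |t - s| := by fun_prop
  (measurableSet_lt measurable_const hf).inter (measurableSet_le hf measurable_const)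

lemma tendsto_measure_punctured (ν : Measure (ℝ × (Fin m → ℝ))) [IsFiniteMeasure ν] (s : ℝ) :
    Tendsto (fun n : ℕ => ν ({t | 0 < |t - s| ∧ |t - s| ≤ 1 / ((n : ℝ) + 1)} ×ˢ univ)) atTop
      (𝓝 0) := by
  have hm := measurableSet_punctured s
  have h0 : ⋂ n : ℕ, ({t : ℝ | 0 < |t - s| ∧ |t - s| ≤ 1 / ((n : ℝ) + 1)} ×ˢ
      (univ : Set (Fin m → ℝ))) = ∅ := by
    ext z
    simp only [mem_iInter, mem_empty_iff_false, iff_false, not_forall]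
    by_cases hz : 0 < |z.1 - s|
    · obtain ⟨n, hn⟩ := exists_nat_one_div_lt hz
      exact ⟨n, fun h => absurd h.1.2 (not_le.2 hn)⟩
    · exact ⟨0, fun h => hz h.1.1⟩
  have := tendsto_measure_iInter_atTop (μ := ν)
    (s := fun n : ℕ => {t : ℝ | 0 < |t - s| ∧ |t - s| ≤ 1 / ((n : ℝ) + 1)} ×ˢ
      (univ : Set (Fin m → ℝ)))
    (fun n => ((hm _).prod MeasurableSet.univ).nullMeasurableSet) ?_ ⟨0, measure_ne_top _ _⟩
  · rwa [h0, measure_empty] at this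
  · intro k n hkn z hz
    refine ⟨⟨hz.1.1, hz.1.2.trans ?_⟩, hz.2⟩
    exact one_div_le_one_div_of_le (by positivity) (by exact_mod_cast Nat.succ_le_succ hkn)

/-- The measure of a shrinking punctured layer has density zero at almost all points of the
hyperplane. -/
lemma ae_tendsto_punctured_density (ν : Measure (ℝ × (Fin m → ℝ))) [IsFiniteMeasure ν] (s : ℝ) :
    ∀ᵐ x : Fin m → ℝ, Tendsto (fun r => ν ({t | 0 < |t - s| ∧ |t - s| ≤ r} ×ˢ
      Metric.closedBall x r) / volume (Metric.closedBall x r)) (𝓝[>] (0 : ℝ)) (𝓝 0) := by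
  set S : ℝ → Set ℝ := fun r => {t | 0 < |t - s| ∧ |t - s| ≤ r} with hS
  have hm : ∀ r : ℝ, MeasurableSet (S r) := measurableSet_punctured s
  set ρ : ℕ → Measure (Fin m → ℝ) := fun n =>
    (ν.restrict (S (1 / ((n : ℝ) + 1)) ×ˢ univ)).map Prod.snd with hρ
  have hρA : ∀ n A, MeasurableSet A → ρ n A = ν (S (1 / ((n : ℝ) + 1)) ×ˢ A) := by
    intro n A hA
    rw [hρ, Measure.map_apply measurable_snd hA, Measure.restrict_apply (measurable_snd hA)]
    congr 1
    ext z
    simp only [mem_inter_iff, mem_preimage, mem_prod, mem_univ, and_true]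
    tauto
  have hinf : ∀ᵐ x : Fin m → ℝ, ⨅ n, (ρ n).rnDeriv volume x = 0 := by
    have hmeas : Measurable fun x => ⨅ n, (ρ n).rnDeriv volume x :=
      Measurable.iInf fun n => Measure.measurable_rnDeriv _ _
    refine (lintegral_eq_zero_iff hmeas).1 (le_antisymm ?_ zero_le)
    refine ge_of_tendsto' (tendsto_measure_punctured ν s) fun n => ?_
    calc ∫⁻ x, ⨅ n, (ρ n).rnDeriv volume x ≤ ∫⁻ x, (ρ n).rnDeriv volume x :=
          lintegral_mono fun x => iInf_le _ n
      _ ≤ ρ n univ := Measure.lintegral_rnDeriv_le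
      _ = _ := hρA n _ MeasurableSet.univ
  filter_upwards [hinf, ae_all_iff.2 fun n => Besicovitch.ae_tendsto_rnDeriv (ρ n) volume]
    with x hx0 hx
  rw [ENNReal.tendsto_nhds_zero]
  intro ε hε
  have hlt : ⨅ n, (ρ n).rnDeriv volume x < ε := by rwa [hx0]
  obtain ⟨n, hn⟩ := iInf_lt_iff.1 hlt
  filter_upwards [(hx n).eventually (gt_mem_nhds hn), Ioo_mem_nhdsGT (Nat.one_div_pos_of_nat (n := n))]
    with r hr hr'
  refine le_trans ?_ hr.le
  rw [hρA n _ Metric.isClosed_closedBall.measurableSet]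
  gcongr
  exact fun t ht => ⟨ht.1, ht.2.trans hr'.2.le⟩

end Traces

/-! ### One-sided approximate limits -/

section OneSided

variable {m : ℕ} {Q : Set (Fin m → ℝ)} {a b s : ℝ}

lemma abs_apply_le_totalVariation {α : Type*} [MeasurableSpace α] (μ : SignedMeasure α)
    (A : Set α) : |μ A| ≤ (μ.totalVariation A).toReal := by
  rw [SignedMeasure.totalVariation_eq_variation]
  have h : μ.variation A ≠ ⊤ := by
    rw [← SignedMeasure.totalVariation_eq_variation]
    exact measure_ne_top _ _
  exact VectorMeasure.norm_measure_le_variation h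

/-- A conull set of heights contains a sequence that tends to the left end point. -/
lemma exists_seq_mem_conull {G : Set ℝ} (hG : volume (Ioo a b \ G) = 0) (hab : a < b) :
    ∃ τ : ℕ → ℝ, (∀ n, τ n ∈ G ∧ τ n ∈ Ioo a b) ∧
      (∀ n, |τ n - a| ≤ 1 / ((n : ℝ) + 1)) := by
  have key : ∀ n : ℕ, ∃ t, (t ∈ G ∧ t ∈ Ioo a b) ∧ |t - a| ≤ 1 / ((n : ℝ) + 1) := by
    intro n
    have hn : (0 : ℝ) < 1 / ((n : ℝ) + 1) := by positivity
    by_contra! hcon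
    have hsub : Ioo a (min b (a + 1 / ((n : ℝ) + 1))) ⊆ Ioo a b \ G := by
      intro t ht
      have h1 := lt_min_iff.1 ht.2
      refine ⟨⟨ht.1, h1.1⟩, fun hG' => ?_⟩
      have := hcon t ⟨hG', ht.1, h1.1⟩
      rw [abs_of_pos (sub_pos.2 ht.1)] at this
      linarith
    have h0 := measure_mono_null hsub hG
    rw [Real.volume_Ioo, ENNReal.ofReal_eq_zero, sub_nonpos] at h0
    exact absurd h0 (not_le.2 (lt_min hab (by linarith)))
  choose τ h1 h2 using key
  exact ⟨τ, h1, h2⟩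

lemma exists_seq_mem_conull_left {G : Set ℝ} (hG : volume (Ioo a b \ G) = 0) (hab : a < b) :
    ∃ τ : ℕ → ℝ, (∀ n, τ n ∈ G ∧ τ n ∈ Ioo a b) ∧
      (∀ n, |τ n - b| ≤ 1 / ((n : ℝ) + 1)) := by
  have hG' : volume (Ioo (-b) (-a) \ (Neg.neg ⁻¹' G)) = 0 := by
    have : Ioo (-b) (-a) \ (Neg.neg ⁻¹' G) = Neg.neg ⁻¹' (Ioo a b \ G) := by
      ext t
      simp only [Set.mem_sdiff, mem_Ioo, mem_preimage]
      constructor <;> rintro ⟨⟨h1, h2⟩, h3⟩ <;> exact ⟨⟨by linarith, by linarith⟩, h3⟩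
    rw [this]
    exact (Measure.measurePreserving_neg (volume : Measure ℝ)).quasiMeasurePreserving.preimage_null hG
  obtain ⟨τ, h1, h2⟩ := exists_seq_mem_conull hG' (neg_lt_neg hab)
  refine ⟨fun n => -τ n, fun n => ⟨(h1 n).1, ?_⟩, fun n => ?_⟩
  · have := (h1 n).2
    exact ⟨by linarith [this.2], by linarith [this.1]⟩
  · rw [abs_sub_comm]
    have := h2 n
    rwa [show τ n - -b = b - -τ n by ring] at this

/-- A function on `(a, b) × Q` whose first derivative is a signed measure `μ` has traces from both
sides on `{s} × Q`; the difference of the traces is the density of `μ` there. -/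
lemma exists_onesided_traces (hQ : MeasurableSet Q) (hs : s ∈ Ioo a b)
    {v : ℝ × (Fin m → ℝ) → ℝ} (μ : SignedMeasure (ℝ × (Fin m → ℝ))) {G : Set ℝ}
    (hGab : volume (Ioo a b \ G) = 0)
    (hint : ∀ t ∈ G, IntegrableOn (fun x => v (t, x)) Q)
    (hG : ∀ t₁ ∈ G, ∀ t₂ ∈ G, t₁ < t₂ → ∀ A ⊆ Q, MeasurableSet A →
        (∫ x in A, v (t₂, x)) - ∫ x in A, v (t₁, x) = μ (Ioc t₁ t₂ ×ˢ A)) :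
    ∃ wp wm : (Fin m → ℝ) → ℝ, (Measurable wp ∧ IntegrableOn wp Q) ∧
      (Measurable wm ∧ IntegrableOn wm Q) ∧
      (∀ t ∈ G, s < t → ∀ A ⊆ Q, MeasurableSet A → ∫⁻ x in A, ‖v (t, x) - wp x‖ₑ ≤
        μ.totalVariation ({t' | 0 < |t' - s| ∧ |t' - s| ≤ |t - s|} ×ˢ A)) ∧
      (∀ t ∈ G, t < s → ∀ A ⊆ Q, MeasurableSet A → ∫⁻ x in A, ‖v (t, x) - wm x‖ₑ ≤
        μ.totalVariation ({t' | 0 < |t' - s| ∧ |t' - s| ≤ |t - s|} ×ˢ A)) ∧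
      ∀ A ⊆ Q, MeasurableSet A → μ ({s} ×ˢ A) = (∫ x in A, wp x) - ∫ x in A, wm x := by
  have hGr : volume (Ioo s b \ G) = 0 :=
    measure_mono_null (Set.sdiff_subset_sdiff_left (Ioo_subset_Ioo_left hs.1.le)) hGab
  have hGl : volume (Ioo a s \ G) = 0 :=
    measure_mono_null (Set.sdiff_subset_sdiff_left (Ioo_subset_Ioo_right hs.2.le)) hGab
  obtain ⟨τ, hτ, hτs⟩ := exists_seq_mem_conull hGr hs.2
  obtain ⟨θ, hθ, hθs⟩ := exists_seq_mem_conull_left hGl hs.1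
  set e : ℕ → ℝ := fun n => (μ.totalVariation
    ({t | 0 < |t - s| ∧ |t - s| ≤ 1 / ((n : ℝ) + 1)} ×ˢ (univ : Set (Fin m → ℝ)))).toReal with he_def
  have he : Tendsto e atTop (𝓝 0) := by
    have := (ENNReal.tendsto_toReal ENNReal.zero_ne_top).comp
      (tendsto_measure_punctured μ.totalVariation s)
    rwa [ENNReal.toReal_zero] at this
  have hsmall : ∀ (S : Set ℝ) (n : ℕ), MeasurableSet S →
      S ⊆ {t | 0 < |t - s| ∧ |t - s| ≤ 1 / ((n : ℝ) + 1)} → ∀ A, |sliceMeasure μ S A| ≤ e n := by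
    intro S n hS hsub A
    by_cases hA : MeasurableSet A
    · rw [sliceMeasure_apply μ hS hA]
      refine (abs_apply_le_totalVariation μ _).trans ?_
      exact ENNReal.toReal_mono (measure_ne_top _ _)
        (measure_mono (prod_mono hsub (subset_univ _)))
    · rw [VectorMeasure.not_measurable _ hA, abs_zero]
      exact ENNReal.toReal_nonneg
  have hsplit : ∀ S T : Set ℝ, MeasurableSet S → MeasurableSet T → Disjoint S T →
      ∀ A : Set (Fin m → ℝ), MeasurableSet A → μ ((S ∪ T) ×ˢ A) = μ (S ×ˢ A) + μ (T ×ˢ A) := by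
    intro S T hS hT hST A hA
    rw [union_prod, VectorMeasure.of_union (disjoint_prod.2 (Or.inl hST)) (hS.prod hA)
      (hT.prod hA)]
  -- the trace from the right
  have hDr : ∀ t ∈ G ∩ Ioi s, ∀ t' ∈ G ∩ Ioi s, ∀ A ⊆ Q, MeasurableSet A →
      (∫ x in A, v (t, x)) - ∫ x in A, v (t', x) =
        sliceMeasure μ (Ioc s t) A - sliceMeasure μ (Ioc s t') A := by
    have aux : ∀ t ∈ G ∩ Ioi s, ∀ t' ∈ G ∩ Ioi s, t < t' → ∀ A ⊆ Q, MeasurableSet A →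
        (∫ x in A, v (t, x)) - ∫ x in A, v (t', x) =
          sliceMeasure μ (Ioc s t) A - sliceMeasure μ (Ioc s t') A := by
      intro t ht t' ht' hlt A hAQ hA
      rw [sliceMeasure_apply μ measurableSet_Ioc hA, sliceMeasure_apply μ measurableSet_Ioc hA,
        ← Ioc_union_Ioc_eq_Ioc (le_of_lt ht.2) hlt.le,
        hsplit _ _ measurableSet_Ioc measurableSet_Ioc (Ioc_disjoint_Ioc_of_le le_rfl) A hA]
      linarith [hG t ht.1 t' ht'.1 hlt A hAQ hA]
    intro t ht t' ht' A hAQ hA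
    rcases lt_trichotomy t t' with h | h | h
    · exact aux t ht t' ht' h A hAQ hA
    · rw [h]; ring
    · linarith [aux t' ht' t ht h A hAQ hA]
  obtain ⟨wp, hwpm, hwpi, hwp⟩ := exists_trace hQ (v := fun t x => v (t, x)) (G := G ∩ Ioi s)
    (fun t ht => hint t ht.1) (fun t => sliceMeasure μ (Ioc s t)) hDr τ
    (fun n => ⟨(hτ n).1, (hτ n).2.1⟩) e he (fun n => hsmall _ n measurableSet_Ioc (by
      intro t ht
      have h1 : 0 < t - s := sub_pos.2 ht.1
      refine ⟨abs_pos.2 h1.ne', le_trans ?_ (hτs n)⟩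
      rw [abs_of_pos h1, abs_of_pos (sub_pos.2 (hτ n).2.1)]
      linarith [ht.2]))
  -- the trace from the left
  have hDl : ∀ t ∈ G ∩ Iio s, ∀ t' ∈ G ∩ Iio s, ∀ A ⊆ Q, MeasurableSet A →
      (∫ x in A, v (t, x)) - ∫ x in A, v (t', x) =
        (-sliceMeasure μ (Ioo t s)) A - (-sliceMeasure μ (Ioo t' s)) A := by
    have aux : ∀ t ∈ G ∩ Iio s, ∀ t' ∈ G ∩ Iio s, t < t' → ∀ A ⊆ Q, MeasurableSet A →
        (∫ x in A, v (t, x)) - ∫ x in A, v (t', x) =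
          (-sliceMeasure μ (Ioo t s)) A - (-sliceMeasure μ (Ioo t' s)) A := by
      intro t ht t' ht' hlt A hAQ hA
      rw [neg_apply, neg_apply, sliceMeasure_apply μ measurableSet_Ioo hA,
        sliceMeasure_apply μ measurableSet_Ioo hA,
        ← Ioc_union_Ioo_eq_Ioo hlt.le ht'.2,
        hsplit _ _ measurableSet_Ioc measurableSet_Ioo
          (Set.disjoint_left.2 fun x hx hx' => absurd hx.2 (not_le.2 hx'.1)) A hA]
      linarith [hG t ht.1 t' ht'.1 hlt A hAQ hA]
    intro t ht t' ht' A hAQ hA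
    rcases lt_trichotomy t t' with h | h | h
    · exact aux t ht t' ht' h A hAQ hA
    · rw [h]; ring
    · linarith [aux t' ht' t ht h A hAQ hA]
  obtain ⟨wm, hwmm, hwmi, hwm⟩ := exists_trace hQ (v := fun t x => v (t, x)) (G := G ∩ Iio s)
    (fun t ht => hint t ht.1) (fun t => -sliceMeasure μ (Ioo t s)) hDl θ
    (fun n => ⟨(hθ n).1, (hθ n).2.2⟩) e he (fun n A => by
      rw [neg_apply, abs_neg]
      refine hsmall _ n measurableSet_Ioo ?_ A
      intro t ht
      have h1 : t - s < 0 := sub_neg.2 ht.2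
      refine ⟨abs_pos.2 h1.ne, le_trans ?_ (hθs n)⟩
      rw [abs_of_neg h1, abs_of_neg (sub_neg.2 (hθ n).2.2)]
      linarith [ht.1])
  refine ⟨wp, wm, ⟨hwpm, hwpi⟩, ⟨hwmm, hwmi⟩, fun t ht hst A hAQ hA => ?_,
    fun t ht hst A hAQ hA => ?_, fun A hAQ hA => ?_⟩
  · refine (lintegral_enorm_sub_le hQ (hint t ht) hwpi _ (hwp t ⟨ht, hst⟩) hAQ hA).trans ?_
    refine (variation_sliceMeasure_le μ hA).trans (measure_mono (prod_mono_left ?_))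
    intro t' ht'
    have h1 : 0 < t' - s := sub_pos.2 ht'.1
    refine ⟨abs_pos.2 h1.ne', ?_⟩
    rw [abs_of_pos h1, abs_of_pos (sub_pos.2 hst)]
    linarith [ht'.2]
  · refine (lintegral_enorm_sub_le hQ (hint t ht) hwmi _ (hwm t ⟨ht, hst⟩) hAQ hA).trans ?_
    rw [VectorMeasure.variation_neg]
    refine (variation_sliceMeasure_le μ hA).trans (measure_mono (prod_mono_left ?_))
    intro t' ht'
    have h1 : t' - s < 0 := sub_neg.2 ht'.2
    refine ⟨abs_pos.2 h1.ne, ?_⟩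
    rw [abs_of_neg h1, abs_of_neg (sub_neg.2 hst)]
    linarith [ht'.1]
  · have h1 := hwp (τ 0) ⟨(hτ 0).1, (hτ 0).2.1⟩ A hAQ hA
    have h2 := hwm (θ 0) ⟨(hθ 0).1, (hθ 0).2.2⟩ A hAQ hA
    have h3 := hG (θ 0) (hθ 0).1 (τ 0) (hτ 0).1 ((hθ 0).2.2.trans (hτ 0).2.1) A hAQ hA
    rw [neg_apply, sliceMeasure_apply μ measurableSet_Ioo hA] at h2
    rw [sliceMeasure_apply μ measurableSet_Ioc hA] at h1
    rw [← Ioc_union_Ioc_eq_Ioc (hθ 0).2.2.le (hτ 0).2.1.le,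
      hsplit _ _ measurableSet_Ioc measurableSet_Ioc (Ioc_disjoint_Ioc_of_le le_rfl) A hA,
      ← Ioo_union_right (hθ 0).2.2,
      hsplit _ _ measurableSet_Ioo (measurableSet_singleton _)
        (Set.disjoint_left.2 fun x hx hx' => absurd hx.2 (by rw [hx']; exact lt_irrefl _)) A hA] at h3
    linarith

/-- Around almost every point `x` of the hyperplane, the trace `w x` is the one-sided approximate
limit of `v`. -/
lemma ae_tendsto_trace (hQ : IsOpen Q) {v : ℝ × (Fin m → ℝ) → ℝ} {w : (Fin m → ℝ) → ℝ}
    (ν : Measure (ℝ × (Fin m → ℝ))) [IsFiniteMeasure ν]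
    (hwm : Measurable w) (hw : IntegrableOn w Q) (J : ℝ → Set ℝ)
    (hJm : ∀ r, MeasurableSet (J r)) (hJs : ∀ r, ∀ t ∈ J r, |t - s| ≤ r) (hJv : ∀ r, volume (J r) ≤ ENNReal.ofReal r)
    (hv : ∀ᶠ r in 𝓝[>] (0 : ℝ), ∀ᵐ t ∂(volume.restrict (J r)), ∀ A ⊆ Q, MeasurableSet A →
      ∫⁻ x in A, ‖v (t, x) - w x‖ₑ ≤
        ν ({t' | 0 < |t' - s| ∧ |t' - s| ≤ |t - s|} ×ˢ A)) :
    ∀ᵐ x ∂(volume.restrict Q), Tendsto (fun r => (∫⁻ z in J r ×ˢ Metric.closedBall x r,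
      ‖v z - w x‖ₑ) / (ENNReal.ofReal r * volume (Metric.closedBall x r))) (𝓝[>] (0 : ℝ)) (𝓝 0) := by
  have hL := (Besicovitch.vitaliFamily (volume : Measure (Fin m → ℝ))).ae_tendsto_lintegral_enorm_sub_div_of_integrable
    ((integrable_indicator_iff hQ.measurableSet).2 hw)
  filter_upwards [ae_restrict_of_ae hL, ae_restrict_of_ae (ae_tendsto_punctured_density ν s),
    ae_restrict_mem hQ.measurableSet] with x hx1 hx2 hxQ
  have hx1' := hx1.comp (Besicovitch.tendsto_filterAt volume x)
  have hsum := hx2.add hx1'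
  rw [add_zero] at hsum
  obtain ⟨r₀, hr₀, hball⟩ := Metric.isOpen_iff.1 hQ x hxQ
  refine tendsto_of_tendsto_of_tendsto_of_le_of_le' tendsto_const_nhds hsum
    (Eventually.of_forall fun _ => zero_le) ?_
  filter_upwards [hv, Ioo_mem_nhdsGT hr₀] with r hr hr'
  set B := Metric.closedBall x r with hB
  have hBQ : B ⊆ Q := (Metric.closedBall_subset_ball hr'.2).trans hball
  have hBm : MeasurableSet B := Metric.isClosed_closedBall.measurableSet
  set N := ν ({t | 0 < |t - s| ∧ |t - s| ≤ r} ×ˢ B) with hN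
  set I := ∫⁻ y in B, ‖Q.indicator w y - Q.indicator w x‖ₑ with hI
  have hI' : ∫⁻ y in B, ‖w y - w x‖ₑ = I := by
    refine setLIntegral_congr_fun hBm fun y hy => ?_
    simp only [indicator_of_mem (hBQ hy), indicator_of_mem hxQ]
  have hmain : ∫⁻ z in J r ×ˢ B, ‖v z - w x‖ₑ ≤ ENNReal.ofReal r * (N + I) := by
    calc ∫⁻ z in J r ×ˢ B, ‖v z - w x‖ₑ
        ≤ ∫⁻ t in J r, ∫⁻ y in B, ‖v (t, y) - w x‖ₑ := by
          rw [Measure.volume_eq_prod, ← Measure.prod_restrict]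
          exact lintegral_prod_le _
      _ ≤ ∫⁻ _ in J r, (N + I) := by
          refine lintegral_mono_ae ?_
          have hJ' : ∀ᵐ t ∂(volume.restrict (J r)), |t - s| ≤ r :=
            ae_restrict_of_forall_mem (hJm r) (hJs r)
          filter_upwards [hr, hJ'] with t ht htJ
          calc ∫⁻ y in B, ‖v (t, y) - w x‖ₑ
              ≤ ∫⁻ y in B, (‖v (t, y) - w y‖ₑ + ‖w y - w x‖ₑ) := by
                refine lintegral_mono fun y => ?_
                rw [← sub_add_sub_cancel (v (t, y)) (w y) (w x)]
                exact enorm_add_le _ _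
            _ = (∫⁻ y in B, ‖v (t, y) - w y‖ₑ) + ∫⁻ y in B, ‖w y - w x‖ₑ :=
                lintegral_add_right _ (by fun_prop)
            _ ≤ N + I := by
                rw [hI']
                refine add_le_add ((ht B hBQ hBm).trans (measure_mono (prod_mono_left ?_))) le_rfl
                exact fun t' ht' => ⟨ht'.1, ht'.2.trans htJ⟩
      _ = (N + I) * volume (J r) := by rw [setLIntegral_const]
      _ ≤ ENNReal.ofReal r * (N + I) := by
          rw [mul_comm]
          gcongr
          exact hJv r
  have hr0 : ENNReal.ofReal r ≠ 0 := by
    rw [Ne, ENNReal.ofReal_eq_zero, not_le]; exact hr'.1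
  calc (∫⁻ z in J r ×ˢ B, ‖v z - w x‖ₑ) / (ENNReal.ofReal r * volume B)
      ≤ (ENNReal.ofReal r * (N + I)) / (ENNReal.ofReal r * volume B) := by gcongr
    _ = (N + I) / volume B := ENNReal.mul_div_mul_left _ _ hr0 ENNReal.ofReal_ne_top
    _ = N / volume B + I / volume B := ENNReal.add_div

/-- The one-sided approximate limits of `v` at almost all points of the hyperplane `{s} × Q`, and
the restriction of its first derivative to this hyperplane. -/
lemma HasFstDeriv.exists_limits (hQ : IsOpen Q) (hQb : Bornology.IsBounded Q) (hs : s ∈ Ioo a b)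
    {v : ℝ × (Fin m → ℝ) → ℝ} (hv : IntegrableOn v (Ioo a b ×ˢ Q))
    (μ : SignedMeasure (ℝ × (Fin m → ℝ))) {p q : Measure (ℝ × (Fin m → ℝ))} [IsFiniteMeasure p]
    [IsFiniteMeasure q] (hμ : ∀ S, MeasurableSet S → μ S = p.real S - q.real S)
    (h : HasFstDeriv a b Q v p q) :
    ∃ wp wm : (Fin m → ℝ) → ℝ, Measurable wp ∧ Measurable wm ∧
      (∀ᵐ x ∂(volume.restrict Q), Tendsto (fun r => (∫⁻ z in Ioo s (s + r) ×ˢ Metric.closedBall x r,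
        ‖v z - wp x‖ₑ) / (ENNReal.ofReal r * volume (Metric.closedBall x r)))
          (𝓝[>] (0 : ℝ)) (𝓝 0)) ∧
      (∀ᵐ x ∂(volume.restrict Q), Tendsto (fun r => (∫⁻ z in Ioo (s - r) s ×ˢ Metric.closedBall x r,
        ‖v z - wm x‖ₑ) / (ENNReal.ofReal r * volume (Metric.closedBall x r)))
          (𝓝[>] (0 : ℝ)) (𝓝 0)) ∧
      ∀ A ⊆ Q, MeasurableSet A → μ ({s} ×ˢ A) = (∫ x in A, wp x) - ∫ x in A, wm x := by
  obtain ⟨G, -, hG0, hGi, hG⟩ := h.exists_slices (hs.1.trans hs.2) hv hQ hQb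
  have hG' : ∀ t₁ ∈ G, ∀ t₂ ∈ G, t₁ < t₂ → ∀ A ⊆ Q, MeasurableSet A →
      (∫ x in A, v (t₂, x)) - ∫ x in A, v (t₁, x) = μ (Ioc t₁ t₂ ×ˢ A) := by
    intro t₁ h₁ t₂ h₂ h12 A hAQ hA
    rw [hG t₁ h₁ t₂ h₂ h12 A hAQ hA, hμ _ (measurableSet_Ioc.prod hA)]
  obtain ⟨wp, wm, ⟨hpm, hpi⟩, ⟨hmm, hmi⟩, hp, hm, hμs⟩ :=
    exists_onesided_traces hQ.measurableSet hs μ hG0 hGi hG'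
  have hGae : ∀ S ⊆ Ioo a b, ∀ᵐ t ∂(volume.restrict S), t ∈ G := by
    intro S hS
    have : ∀ᵐ t ∂(volume.restrict (Ioo a b)), t ∈ G := by
      rw [ae_restrict_iff' measurableSet_Ioo, ae_iff]
      refine measure_mono_null ?_ hG0
      intro t ht
      rw [mem_ofPred_eq, Classical.not_imp] at ht
      exact ht
    exact ae_restrict_of_ae_restrict_of_subset hS this
  refine ⟨wp, wm, hpm, hmm, ?_, ?_, hμs⟩
  · refine ae_tendsto_trace (s := s) hQ μ.totalVariation hpm hpi (fun r => Ioo s (s + r))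
      (fun r => measurableSet_Ioo) (fun r t ht => ?_) (fun r => ?_) ?_
    · rw [abs_of_pos (sub_pos.2 ht.1)]
      linarith [ht.2]
    · rw [Real.volume_Ioo, add_sub_cancel_left]
    · filter_upwards [Ioo_mem_nhdsGT (sub_pos.2 hs.2)] with r hr
      filter_upwards [hGae (Ioo s (s + r)) (Ioo_subset_Ioo hs.1.le (by linarith [hr.2])),
        ae_restrict_mem measurableSet_Ioo] with t ht htr A hAQ hA
      exact hp t ht htr.1 A hAQ hA
  · refine ae_tendsto_trace (s := s) hQ μ.totalVariation hmm hmi (fun r => Ioo (s - r) s)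
      (fun r => measurableSet_Ioo) (fun r t ht => ?_) (fun r => ?_) ?_
    · rw [abs_of_neg (sub_neg.2 ht.2)]
      linarith [ht.1]
    · rw [Real.volume_Ioo, sub_sub_cancel]
    · filter_upwards [Ioo_mem_nhdsGT (sub_pos.2 hs.1)] with r hr
      filter_upwards [hGae (Ioo (s - r) s) (Ioo_subset_Ioo (by linarith [hr.2]) hs.2.le),
        ae_restrict_mem measurableSet_Ioo] with t ht htr A hAQ hA
      exact hm t ht htr.2 A hAQ hA

end OneSided

/-! ### Derivatives and hyperplanes -/

section LayerDerivative

lemma apply_eq_real_sub_real {X : Type*} [MeasurableSpace X] (μ : SignedMeasure X) {S : Set X}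
    (hS : MeasurableSet S) : μ S = μ.toJordanDecomposition.posPart.real S -
      μ.toJordanDecomposition.negPart.real S := by
  conv_lhs => rw [← SignedMeasure.toSignedMeasure_toJordanDecomposition μ]
  rw [JordanDecomposition.toSignedMeasure, sub_apply,
    Measure.toSignedMeasure_apply_measurable hS, Measure.toSignedMeasure_apply_measurable hS]

variable {d : ℕ}

lemma IsTest.mul_left {O : Set (Vec d)} {φ η : Vec d → ℝ} (hφ : IsTest O φ)
    (hη : ContDiff ℝ ∞ η) : IsTest O (fun x => η x * φ x) :=
  ⟨hη.mul hφ.1, hφ.2.1.mul_left, (tsupport_mul_subset_right).trans hφ.2.2⟩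

/-- A smooth function on `ℝ` with compact support, values in `[0, 1]`, equal to `1` at `0`. -/
lemma exists_bump : ∃ χ : ℝ → ℝ, ContDiff ℝ ∞ χ ∧ χ 0 = 1 ∧ (∀ t, |χ t| ≤ 1) ∧
    ∀ t, 1 ≤ |t| → χ t = 0 := by
  let f : ContDiffBump (0 : ℝ) := ⟨1 / 2, 1, by norm_num, by norm_num⟩
  refine ⟨f, f.contDiff, f.one_of_mem_closedBall (by simp [f]), fun t => ?_, fun t ht => ?_⟩
  · rw [abs_of_nonneg f.nonneg]
    exact f.le_one
  · exact f.zero_of_le_dist (by simpa [f] using ht)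

/-- The sequence `χ (n t)` tends to the indicator function of `{0}`. -/
lemma tendsto_bump {χ : ℝ → ℝ} (h0 : χ 0 = 1) (h1 : ∀ t, 1 ≤ |t| → χ t = 0) (t : ℝ) :
    Tendsto (fun n : ℕ => χ (n * t)) atTop (𝓝 (({0} : Set ℝ).indicator (fun _ => 1) t)) := by
  by_cases ht : t = 0
  · subst ht
    simp [h0]
  · rw [indicator_of_notMem (by simpa using ht)]
    refine tendsto_const_nhds.congr' ?_
    obtain ⟨N, hN⟩ := exists_nat_ge (1 / |t|)
    filter_upwards [eventually_ge_atTop N] with n hn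
    refine (h1 _ ?_).symm
    rw [abs_mul, Nat.abs_cast]
    have : 0 < |t| := abs_pos.2 ht
    rw [div_le_iff₀ this] at hN
    exact hN.trans (by gcongr)

variable [NeZero d]

/-- The derivatives along a hyperplane do not charge it. -/
lemma HasDistribDeriv.totalVariation_strip_of_ne {O : Set (Vec d)} (hO : IsOpen O) {i : Fin d}
    (hi : i ≠ ⊤) {f : Vec d → ℝ} (hf : IntegrableOn f O) {μ : SignedMeasure (Vec d)}
    (h : HasDistribDeriv O i f μ) (s : ℝ) : μ.totalVariation (strip d {s}) = 0 := by
  obtain ⟨χ, hχ, hχ0, hχ1, hχs⟩ := exists_bump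
  set p := μ.toJordanDecomposition.posPart with hp
  set q := μ.toJordanDecomposition.negPart with hq
  have hS : MeasurableSet (strip d {s}) := measurableSet_strip (measurableSet_singleton s)
  set ν : SignedMeasure (Vec d) :=
    (p.restrict (strip d {s})).toSignedMeasure - (q.restrict (strip d {s})).toSignedMeasure with hν
  have hlim : ∀ x : Vec d, Tendsto (fun n : ℕ => χ (n * (x ⊤ - s))) atTop
      (𝓝 ((strip d {s}).indicator (fun _ => 1) x)) := by
    intro x
    have h1 := tendsto_bump hχ0 hχs (x ⊤ - s)
    have h2 : (strip d {s}).indicator (fun _ => (1 : ℝ)) x =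
        ({0} : Set ℝ).indicator (fun _ => 1) (x ⊤ - s) := by
      simp only [indicator, strip, mem_singleton_iff, sub_eq_zero]
      rfl
    rwa [h2]
  have hcut : ∀ n : ℕ, ContDiff ℝ ∞ fun x : Vec d => χ (n * (x ⊤ - s)) := fun n =>
    hχ.comp (contDiff_const.mul ((by fun_prop : ContDiff ℝ ∞ fun x : Vec d => x ⊤).sub
      contDiff_const))
  have hν0 : ν.totalVariation O = 0 := by
    refine totalVariation_eq_zero_of_forall_test hO ν fun φ h1 h2 h3 => ?_
    have hφ : IsTest O φ := ⟨h1, h2, h3⟩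
    have hbd : ∀ (ρ : Measure (Vec d)) [IsFiniteMeasure ρ], Tendsto
        (fun n : ℕ => ∫ x, χ (n * (x ⊤ - s)) * φ x ∂ρ) atTop
        (𝓝 (∫ x in strip d {s}, φ x ∂ρ)) := by
      intro ρ _
      rw [← integral_indicator hS]
      refine tendsto_integral_of_dominated_convergence (fun x => ‖φ x‖)
        (fun n => ((hcut n).continuous.mul h1.continuous).aestronglyMeasurable)
        (hφ.integrable ρ).norm (fun n => Eventually.of_forall fun x => ?_)
        (Eventually.of_forall fun x => ?_)
      · rw [norm_mul]
        exact mul_le_of_le_one_left (norm_nonneg _) (hχ1 _)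
      · have := (hlim x).mul_const (φ x)
        simpa only [← indicator_mul_left, one_mul] using this
    have hleft : Tendsto (fun n : ℕ => ∫ x in O, f x * pderiv i (fun z => χ (n * (z ⊤ - s)) * φ z) x)
        atTop (𝓝 0) := by
      have hpd : ∀ (n : ℕ) x, pderiv i (fun z => χ (n * (z ⊤ - s)) * φ z) x =
          χ (n * (x ⊤ - s)) * pderiv i φ x := by
        intro n x
        have hd1 : DifferentiableAt ℝ (fun z : Vec d => χ (n * (z ⊤ - s))) x :=
          ((hcut n).differentiable (by simp)).differentiableAt
        have hd2 : DifferentiableAt ℝ φ x := (h1.differentiable (by simp)).differentiableAt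
        unfold pderiv
        rw [fderiv_fun_mul hd1 hd2]
        have hz : fderiv ℝ (fun z : Vec d => χ (n * (z ⊤ - s))) x (EuclideanSpace.single i 1) = 0 := by
          rw [← hd1.lineDeriv_eq_fderiv]
          unfold lineDeriv
          have : (fun t : ℝ => χ (n * ((x + t • EuclideanSpace.single i (1 : ℝ)) ⊤ - s))) =
              fun _ => χ (n * (x ⊤ - s)) := by
            funext t
            simp [hi.symm]
          rw [this, deriv_const]
        simp [hz]
      have h0 : (0 : ℝ) = ∫ x in O, (strip d {s}).indicator (fun _ => 1) x * (f x * pderiv i φ x) := by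
        symm
        refine integral_eq_zero_of_ae ?_
        have := measure_eq_zero_iff_ae_notMem.1 (volume_hyperplane (d := d) s)
        filter_upwards [ae_restrict_of_ae this] with x hx
        simp [indicator_of_notMem hx]
      rw [h0]
      refine tendsto_integral_of_dominated_convergence (fun x => ‖f x * pderiv i φ x‖)
        (fun n => ?_) (hφ.integrable_mul_pderiv i hf).norm
        (fun n => Eventually.of_forall fun x => ?_) (Eventually.of_forall fun x => ?_)
      · simp_rw [hpd]
        have : (fun x => f x * (χ (n * (x ⊤ - s)) * pderiv i φ x)) =
            fun x => χ (n * (x ⊤ - s)) * (f x * pderiv i φ x) := by funext x; ring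
        rw [this]
        exact (hcut n).continuous.aestronglyMeasurable.mul
          (hφ.integrable_mul_pderiv i hf).aestronglyMeasurable
      · rw [hpd, mul_left_comm, norm_mul]
        exact mul_le_of_le_one_left (norm_nonneg _) (hχ1 _)
      · simp_rw [hpd]
        have := (hlim x).mul_const (f x * pderiv i φ x)
        refine this.congr fun n => ?_
        ring
    have hright : ∀ n : ℕ, (∫ x in O, f x * pderiv i (fun z => χ (n * (z ⊤ - s)) * φ z) x) =
        -((∫ x, χ (n * (x ⊤ - s)) * φ x ∂p) - ∫ x, χ (n * (x ⊤ - s)) * φ x ∂q) := by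
      intro n
      have ht := hφ.mul_left (hcut n)
      rw [h.2 _ ht, signedIntegral_eq_sub _ (ht.integrable _)]
    rw [hν, signedIntegral_sub_toSignedMeasure _ _ (hφ.integrable _) (hφ.integrable _)]
    have := tendsto_nhds_unique hleft ((((hbd p).sub (hbd q)).neg).congr fun n => (hright n).symm)
    linarith
  have hdecomp : strip d {s} ⊆ (strip d {s} ∩ O) ∪ Oᶜ := by
    intro x hx
    by_cases hxO : x ∈ O
    · exact Or.inl ⟨hx, hxO⟩
    · exact Or.inr hxO
  refine measure_mono_null hdecomp (measure_union_null ?_ h.1)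
  refine totalVariation_apply_eq_zero (hS.inter hO.measurableSet) fun t ht htm => ?_
  have h1 : ν t = 0 := SignedMeasure.null_of_totalVariation_zero ν
    (measure_mono_null (fun x hx => (ht hx).2) hν0)
  rw [hν, sub_apply, Measure.toSignedMeasure_apply_measurable htm,
    Measure.toSignedMeasure_apply_measurable htm, measureReal_restrict_apply htm,
    measureReal_restrict_apply htm, inter_eq_left.2 (fun x hx => (ht hx).1)] at h1
  rw [apply_eq_real_sub_real μ htm]
  exact h1

end LayerDerivative

section Boxes

variable {m : ℕ}

/-- The derivative in direction `e_d`, in layer coordinates on a box. -/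
lemma HasDistribDeriv.hasFstDeriv {O : Set (Vec (m + 1))} {f : Vec (m + 1) → ℝ}
    {μ : SignedMeasure (Vec (m + 1))} (hO : IsOpen O)
    (h : HasDistribDeriv O ⊤ f μ) {a b : ℝ} {Q : Set (Fin m → ℝ)}
    (hbox : layerCoords m ⁻¹' (Ioo a b ×ˢ Q) ⊆ O) :
    HasFstDeriv a b Q (f ∘ (layerCoords m).symm)
      (μ.toJordanDecomposition.posPart.map (layerCoords m))
      (μ.toJordanDecomposition.negPart.map (layerCoords m)) := by
  intro η hη hηc hηs φ hφ hφc hφs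
  set e := layerCoords m with he
  have hemeas : MeasurableEmbedding e := e.toHomeomorph.measurableEmbedding
  set ψ : Vec (m + 1) → ℝ := fun x => η (e x).1 * φ (e x).2 with hψ
  have hψsupp : Function.support ψ ⊆ e ⁻¹' (tsupport η ×ˢ tsupport φ) := by
    intro x hx
    exact ⟨subset_tsupport _ (left_ne_zero_of_mul hx), subset_tsupport _ (right_ne_zero_of_mul hx)⟩
  have hψclosed : IsClosed (e ⁻¹' (tsupport η ×ˢ tsupport φ)) :=
    ((isClosed_tsupport η).prod (isClosed_tsupport φ)).preimage e.continuous
  have hψcpt : IsCompact (e ⁻¹' (tsupport η ×ˢ tsupport φ)) :=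
    e.toHomeomorph.isCompact_preimage.2 (hηc.isCompact.prod hφc.isCompact)
  have htest : IsTest O ψ := by
    refine ⟨?_, ?_, ?_⟩
    · exact (hη.comp (contDiff_fst.comp e.contDiff)).mul (hφ.comp (contDiff_snd.comp e.contDiff))
    · exact HasCompactSupport.of_support_subset_isCompact hψcpt hψsupp
    · refine (closure_minimal hψsupp hψclosed).trans (Subset.trans ?_ hbox)
      exact preimage_mono (prod_mono hηs hφs)
  have hpd : ∀ x, pderiv ⊤ ψ x = deriv η (e x).1 * φ (e x).2 := by
    intro x
    have hd : DifferentiableAt ℝ ψ x := (htest.1.differentiable (by simp)).differentiableAt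
    unfold pderiv
    rw [← hd.lineDeriv_eq_fderiv]
    unfold lineDeriv
    have h1 : ∀ t : ℝ, e (x + t • EuclideanSpace.single ⊤ (1 : ℝ)) = ((e x).1 + t, (e x).2) := by
      intro t
      refine Prod.ext ?_ ?_
      · simp [he, layerCoords]
      · funext i
        simp [he, layerCoords, Fin.succAbove_ne]
    have h2 : (fun t : ℝ => ψ (x + t • EuclideanSpace.single ⊤ (1 : ℝ))) =
        fun t => η ((e x).1 + t) * φ (e x).2 := by
      funext t
      rw [hψ]
      simp only [h1]
    rw [h2, deriv_mul_const_field, deriv_comp_const_add]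
    simp
  have hmain := h.2 ψ htest
  have hL : ∫ z in Ioo a b ×ˢ Q, (f ∘ e.symm) z * (deriv η z.1 * φ z.2) =
      ∫ x in O, f x * pderiv ⊤ ψ x := by
    rw [← (measurePreserving_layerCoords m).setIntegral_preimage_emb hemeas]
    simp only [Function.comp]
    have : ∀ x, f x * (deriv η (e x).1 * φ (e x).2) = f x * pderiv ⊤ ψ x := fun x => by rw [hpd]
    simp only [← he, this, ContinuousLinearEquiv.symm_apply_apply]
    symm
    refine setIntegral_eq_of_subset_of_forall_sdiff_eq_zero hO.measurableSet hbox fun x hx => ?_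
    rw [hpd]
    by_cases h1 : (e x).1 ∈ Ioo a b
    · have h2 : (e x).2 ∉ Q := fun h2 => hx.2 ⟨h1, h2⟩
      rw [image_eq_zero_of_notMem_tsupport (f := φ) fun h3 => h2 (hφs h3), mul_zero, mul_zero]
    · have h2 : deriv η (e x).1 = 0 := by
        by_contra h3
        exact h1 (hηs (support_deriv_subset h3))
      rw [h2, zero_mul, mul_zero]
  rw [hL, hmain, signedIntegral_eq_sub _ (htest.integrable _)]
  rw [hemeas.integral_map, hemeas.integral_map]

end Boxes

/-! ### Derivatives on hyperplanes are carried by the jump set -/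

lemma enorm_le_sum {d : ℕ} (v : Vec d) : ‖v‖ₑ ≤ ∑ k, ‖v k‖ₑ := by
  have hv : v = ∑ k, EuclideanSpace.single k (v k) := by
    ext i
    simp
  conv_lhs => rw [hv]
  refine (enorm_sum_le _ _).trans (Finset.sum_le_sum fun k _ => ?_)
  rw [← ofReal_norm, ← ofReal_norm, EuclideanSpace.single, PiLp.norm_single]

section TraceTheorem

variable {m : ℕ}

/-- Approximate limits on half balls from approximate limits, componentwise, on the larger
cylinders. -/
lemma tendsto_laverage_of_cylinder {O : Set (Vec (m + 1))} (hO : IsOpen O)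
    {w : Vec (m + 1) → Vec (m + 1)} (hw : IntegrableOn w O) {x₀ : Vec (m + 1)} (hx₀ : x₀ ∈ O)
    (c : Vec (m + 1)) (H : ℝ → Set (Vec (m + 1))) (K : ℝ → Set (ℝ × (Fin m → ℝ)))
    (hHK : ∀ r, 0 < r → H r ⊆ layerCoords m ⁻¹' (K r)) (hHb : ∀ r, H r ⊆ Metric.ball x₀ r)
    (hHv : ∀ r, 0 < r → ENNReal.ofReal ((1 / 4) ^ (m + 1)) * volume (Metric.ball x₀ r) ≤
      volume (H r))
    (h : ∀ k, Tendsto (fun r => (∫⁻ z in K r, ‖w ((layerCoords m).symm z) k - c k‖ₑ) /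
      (ENNReal.ofReal r * volume (Metric.closedBall (layerCoords m x₀).2 r)))
        (𝓝[>] (0 : ℝ)) (𝓝 0)) :
    Tendsto (fun r => ⨍⁻ z in H r, ‖w z - c‖ₑ ∂volume) (𝓝[>] (0 : ℝ)) (𝓝 0) := by
  set e := layerCoords m with he
  have hemeas : MeasurableEmbedding e := e.toHomeomorph.measurableEmbedding
  set V₀ := volume (Metric.ball (0 : Vec (m + 1)) 1) with hV₀
  set V₁ := volume (Metric.closedBall (0 : Fin m → ℝ) 1) with hV₁
  set q := ENNReal.ofReal ((1 / 4) ^ (m + 1)) with hq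
  have hq0 : q ≠ 0 := by
    rw [hq, Ne, ENNReal.ofReal_eq_zero, not_le]; positivity
  have hV₀0 : V₀ ≠ 0 := (Metric.measure_ball_pos volume _ one_pos).ne'
  have hV₀t : V₀ ≠ ⊤ := measure_ball_lt_top.ne
  have hV₁0 : V₁ ≠ 0 := (Metric.measure_closedBall_pos volume _ one_pos).ne'
  have hV₁t : V₁ ≠ ⊤ := measure_closedBall_lt_top.ne
  set C := V₁ / (q * V₀) with hC
  have hqV0 : q * V₀ ≠ 0 := mul_ne_zero hq0 hV₀0
  have hqVt : q * V₀ ≠ ⊤ := ENNReal.mul_ne_top ENNReal.ofReal_ne_top hV₀t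
  have hCt : C ≠ ⊤ := ENNReal.div_ne_top hV₁t hqV0
  have hsum := (tendsto_finsetSum Finset.univ fun k _ => h k)
  rw [Finset.sum_const_zero] at hsum
  have hsum' := ENNReal.Tendsto.const_mul hsum (Or.inr hCt)
  rw [mul_zero] at hsum'
  obtain ⟨ρ, hρ, hball⟩ := Metric.isOpen_iff.1 hO x₀ hx₀
  refine tendsto_of_tendsto_of_tendsto_of_le_of_le' tendsto_const_nhds hsum'
    (Eventually.of_forall fun _ => zero_le) ?_
  filter_upwards [Ioo_mem_nhdsGT hρ] with r hr
  have hr0 := hr.1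
  have hHO : H r ⊆ O := (hHb r).trans ((Metric.ball_subset_ball hr.2.le).trans hball)
  have hwH : IntegrableOn w (H r) := hw.mono_set hHO
  set D := ENNReal.ofReal r * volume (Metric.closedBall (e x₀).2 r) with hD
  have hD' : D = ENNReal.ofReal (r ^ (m + 1)) * V₁ := by
    rw [hD, Measure.addHaar_closedBall volume _ hr0.le, ← mul_assoc,
      ← ENNReal.ofReal_mul hr0.le, Module.finrank_fin_fun, pow_succ, mul_comm (r ^ m),
      hV₁, Measure.addHaar_unitClosedBall_eq_addHaar_unitBall]
  have hRpos : ENNReal.ofReal (r ^ (m + 1)) ≠ 0 := by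
    rw [Ne, ENNReal.ofReal_eq_zero, not_le]; positivity
  have hD0 : D ≠ 0 := by rw [hD']; exact mul_ne_zero hRpos hV₁0
  have hDt : D ≠ ⊤ := by rw [hD']; exact ENNReal.mul_ne_top ENNReal.ofReal_ne_top hV₁t
  have hB : volume (Metric.ball x₀ r) = ENNReal.ofReal (r ^ (m + 1)) * V₀ := by
    rw [Measure.addHaar_ball_of_pos volume _ hr0, finrank_euclideanSpace_fin]
  have hDH : D ≤ C * volume (H r) := by
    calc D = C * (q * V₀) * ENNReal.ofReal (r ^ (m + 1)) := by
          rw [hC, ENNReal.div_mul_cancel hqV0 hqVt, hD', mul_comm]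
      _ = C * (q * volume (Metric.ball x₀ r)) := by rw [hB]; ring
      _ ≤ C * volume (H r) := by gcongr; exact hHv r hr0
  set N := ∑ k, ∫⁻ z in K r, ‖w (e.symm z) k - c k‖ₑ with hN
  have hNle : ∫⁻ z in H r, ‖w z - c‖ₑ ≤ N := by
    calc ∫⁻ z in H r, ‖w z - c‖ₑ ≤ ∫⁻ z in H r, ∑ k, ‖w z k - c k‖ₑ :=
          lintegral_mono fun z => enorm_le_sum (w z - c)
      _ = ∑ k, ∫⁻ z in H r, ‖w z k - c k‖ₑ := by
          refine lintegral_finsetSum' _ fun k _ => ?_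
          have : AEStronglyMeasurable (fun z => w z k) (volume.restrict (H r)) :=
            (EuclideanSpace.proj (𝕜 := ℝ) k).continuous.comp_aestronglyMeasurable
              hwH.aestronglyMeasurable
          exact (this.sub aestronglyMeasurable_const).enorm
      _ ≤ N := by
          refine Finset.sum_le_sum fun k _ => ?_
          rw [← (measurePreserving_layerCoords m).setLIntegral_comp_preimage_emb hemeas]
          simp only [← he, ContinuousLinearEquiv.symm_apply_apply]
          exact lintegral_mono_set (hHK r hr0)
  have hH0 : volume (H r) ≠ 0 := by
    intro h0
    rw [h0, mul_zero] at hDH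
    exact hD0 (le_antisymm hDH zero_le)
  have hHt : volume (H r) ≠ ⊤ := ((measure_mono (hHb r)).trans_lt measure_ball_lt_top).ne
  rw [setLAverage_eq]
  refine ENNReal.div_le_of_le_mul ?_
  have hS : ∑ k, (∫⁻ z in K r, ‖w (e.symm z) k - c k‖ₑ) / D = N / D := by
    simp only [hN, div_eq_mul_inv, Finset.sum_mul]
  rw [hS]
  calc ∫⁻ z in H r, ‖w z - c‖ₑ ≤ N / D * D := by rw [ENNReal.div_mul_cancel hD0 hDt]; exact hNle
    _ ≤ N / D * (C * volume (H r)) := by gcongr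
    _ = C * (N / D) * volume (H r) := by ring

/-- On a box, the part of a hyperplane outside the jump set is not charged by the derivative. -/
lemma totalVariation_box_diff_jumpSet {O : Set (Vec (m + 1))} (hO : IsOpen O)
    {w : Vec (m + 1) → Vec (m + 1)} (hw : IntegrableOn w O)
    {D : Fin (m + 1) → SignedMeasure (Vec (m + 1))}
    (hD : ∀ k, HasDistribDeriv O ⊤ (fun x => w x k) (D k)) {a b s : ℝ} (hs : s ∈ Ioo a b)
    {Q : Set (Fin m → ℝ)} (hQ : IsOpen Q) (hQb : Bornology.IsBounded Q)
    (hbox : layerCoords m ⁻¹' (Ioo a b ×ˢ Q) ⊆ O) (k : Fin (m + 1)) :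
    (D k).totalVariation (layerCoords m ⁻¹' ({s} ×ˢ Q) \ jumpSet O w) = 0 := by
  set e := layerCoords m with he
  have hemeas : MeasurableEmbedding e := e.toHomeomorph.measurableEmbedding
  have hint : ∀ k, IntegrableOn ((fun x => w x k) ∘ e.symm) (Ioo a b ×ˢ Q) := by
    intro k
    rw [← (measurePreserving_layerCoords m).integrableOn_comp_preimage hemeas]
    have : ((fun x => w x k) ∘ e.symm) ∘ e = fun x => w x k := by
      funext x; simp
    rw [← he, this]
    exact ((EuclideanSpace.proj (𝕜 := ℝ) k).integrable_comp (hw.mono_set hbox) :)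
  have hμ : ∀ k S, MeasurableSet S → ((D k).map e) S =
      ((D k).toJordanDecomposition.posPart.map e).real S -
      ((D k).toJordanDecomposition.negPart.map e).real S := by
    intro k S hS
    rw [VectorMeasure.map_apply _ hemeas.measurable hS,
      map_measureReal_apply hemeas.measurable hS, map_measureReal_apply hemeas.measurable hS]
    exact apply_eq_real_sub_real _ (hemeas.measurable hS)
  have key := fun k => HasFstDeriv.exists_limits hQ hQb hs (hint k) ((D k).map e) (hμ k)
    ((hD k).hasFstDeriv hO hbox)
  choose wp wm hpm hmm hp hm hjump using key
  -- Outside the null set `Z` both one-sided approximate limits exist; there a point with different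
  -- limits is a jump point with normal `e_d`. What remains are the points where the traces agree,
  -- on which the density `wp k - wm k` of the derivative vanishes.
  have hgood := (ae_all_iff.2 hp).and (ae_all_iff.2 hm)
  obtain ⟨Z, hZ, hZm, hZ0⟩ := exists_measurable_superset_of_null (ae_iff.1 hgood)
  rw [Measure.restrict_apply hZm] at hZ0
  set A₀ : Set (Fin m → ℝ) := (Z ∩ Q) ∪ ({x | ∀ k, wp k x = wm k x} ∩ Q) with hA₀
  have hEm : MeasurableSet {x | ∀ k, wp k x = wm k x} := by
    have : {x | ∀ k, wp k x = wm k x} = ⋂ k, {x | wp k x = wm k x} := by ext; simp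
    rw [this]
    exact MeasurableSet.iInter fun k => measurableSet_eq_fun (hpm k) (hmm k)
  have hA₀m : MeasurableSet A₀ :=
    (hZm.inter hQ.measurableSet).union (hEm.inter hQ.measurableSet)
  have hA₀Q : A₀ ⊆ Q := union_subset inter_subset_right inter_subset_right
  have hsub : e ⁻¹' ({s} ×ˢ Q) \ jumpSet O w ⊆ e ⁻¹' ({s} ×ˢ A₀) := by
    rintro x₀ ⟨⟨hx1, hx2⟩, hxJ⟩
    refine ⟨hx1, ?_⟩
    by_contra hxA
    have hxZ : (e x₀).2 ∉ Z := fun h => hxA (Or.inl ⟨h, hx2⟩)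
    have hxE : ¬ ∀ k, wp k (e x₀).2 = wm k (e x₀).2 := fun h => hxA (Or.inr ⟨h, hx2⟩)
    have hlim := not_not.1 fun h => hxZ (hZ h)
    have hx1' : x₀ ⊤ = s := hx1
    have hxO : x₀ ∈ O := hbox ⟨by rw [show (e x₀).1 = s from hx1]; exact hs, hx2⟩
    have hball2 : ∀ (r : ℝ) (z : Vec (m + 1)), 0 < r → z ∈ Metric.ball x₀ r →
        (e z).2 ∈ Metric.closedBall (e x₀).2 r ∧ |z ⊤ - s| < r := by
      intro r z hr hz
      rw [Metric.mem_ball, dist_eq_norm] at hz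
      refine ⟨?_, ?_⟩
      · rw [Metric.mem_closedBall, dist_pi_le_iff hr.le]
        intro i
        rw [Real.dist_eq]
        exact (PiLp.norm_apply_le (z - x₀) _).trans hz.le
      · rw [← hx1']
        exact (PiLp.norm_apply_le (z - x₀) ⊤).trans_lt hz
    refine hxJ ⟨hxO, WithLp.toLp 2 fun k => wp k (e x₀).2, WithLp.toLp 2 fun k => wm k (e x₀).2,
      eTop (m + 1), ?_, norm_eTop, ?_, ?_⟩
    · intro h
      refine hxE fun k => ?_
      have := congrArg (fun v : Vec (m + 1) => v k) h
      simpa using this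
    · refine tendsto_laverage_of_cylinder hO hw hxO _ _
        (fun r => Ioo s (s + r) ×ˢ Metric.closedBall (e x₀).2 r)
        (fun r hr z hz => ?_) (fun r => inter_subset_left)
        (fun r hr => volume_half_ball_ge _ _ norm_eTop hr) hlim.1
      obtain ⟨h1, h2⟩ := hball2 r z hr hz.1
      have h3 : 0 < ⟪z - x₀, eTop (m + 1)⟫ := hz.2
      rw [inner_eTop, PiLp.sub_apply, hx1'] at h3
      exact ⟨⟨by rw [layerCoords_fst]; linarith,
        by rw [layerCoords_fst]; linarith [(abs_lt.1 h2).2]⟩, h1⟩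
    · refine tendsto_laverage_of_cylinder hO hw hxO _ _
        (fun r => Ioo (s - r) s ×ˢ Metric.closedBall (e x₀).2 r)
        (fun r hr z hz => ?_) (fun r => inter_subset_left)
        (fun r hr => volume_half_ball_ge' _ _ norm_eTop hr) hlim.2
      obtain ⟨h1, h2⟩ := hball2 r z hr hz.1
      have h3 : ⟪z - x₀, eTop (m + 1)⟫ < 0 := hz.2
      rw [inner_eTop, PiLp.sub_apply, hx1'] at h3
      exact ⟨⟨by rw [layerCoords_fst]; linarith [(abs_lt.1 h2).1],
        by rw [layerCoords_fst]; linarith⟩, h1⟩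
  refine measure_mono_null hsub (totalVariation_apply_eq_zero
    (hemeas.measurable ((measurableSet_singleton s).prod hA₀m)) fun t ht htm => ?_)
  set A : Set (Fin m → ℝ) := (fun x' => e.symm (s, x')) ⁻¹' t with hA
  have hAm : MeasurableSet A := by
    have : Continuous fun x' : Fin m → ℝ => e.symm (s, x') :=
      e.symm.continuous.comp (by fun_prop)
    exact this.measurable htm
  have htA : t = e ⁻¹' ({s} ×ˢ A) := by
    ext x
    constructor
    · intro hx
      have h1 : (e x).1 = s := (ht hx).1
      refine ⟨h1, ?_⟩
      change e.symm (s, (e x).2) ∈ t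
      rw [← h1, Prod.mk.eta, e.symm_apply_apply]
      exact hx
    · rintro ⟨h1, h2⟩
      change e.symm (s, (e x).2) ∈ t at h2
      have h1 : (e x).1 = s := h1
      rwa [← h1, Prod.mk.eta, e.symm_apply_apply] at h2
  have hAA₀ : A ⊆ A₀ := by
    intro x' hx'
    have := (ht hx').2
    rwa [e.apply_symm_apply] at this
  have h1 := hjump k A (hAA₀.trans hA₀Q) hAm
  rw [VectorMeasure.map_apply _ hemeas.measurable ((measurableSet_singleton s).prod hAm),
    ← htA] at h1
  rw [h1, sub_eq_zero]
  refine setIntegral_congr_ae hAm ?_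
  filter_upwards [measure_eq_zero_iff_ae_notMem.1 hZ0] with x hx hxA
  rcases hAA₀ hxA with h | h
  · exact absurd h hx
  · exact h.1 k

/-- The statement for `∂_d`, by a cover of the hyperplane with boxes. -/
lemma totalVariation_top_strip_diff_jumpSet {O : Set (Vec (m + 1))} (hO : IsOpen O)
    {w : Vec (m + 1) → Vec (m + 1)} (hw : IntegrableOn w O)
    {D : Fin (m + 1) → SignedMeasure (Vec (m + 1))}
    (hD : ∀ k, HasDistribDeriv O ⊤ (fun x => w x k) (D k)) (s : ℝ) (k : Fin (m + 1)) :
    (D k).totalVariation (strip (m + 1) {s} \ jumpSet O w) = 0 := by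
  have hdecomp : strip (m + 1) {s} \ jumpSet O w ⊆ ((strip (m + 1) {s} ∩ O) \ jumpSet O w) ∪ Oᶜ := by
    intro x hx
    by_cases hxO : x ∈ O
    · exact Or.inl ⟨⟨hx.1, hxO⟩, hx.2⟩
    · exact Or.inr hxO
  refine measure_mono_null hdecomp (measure_union_null ?_ (hD k).1)
  refine measure_null_of_locally_null _ fun x hx => ?_
  set e := layerCoords m with he
  have hopen : IsOpen (e.symm ⁻¹' O) := hO.preimage e.symm.continuous
  have hxO : e x ∈ e.symm ⁻¹' O := by
    rw [mem_preimage, e.symm_apply_apply]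
    exact hx.1.2
  obtain ⟨r, hr, hb⟩ := Metric.isOpen_iff.1 hopen (e x) hxO
  have hxs : (e x).1 = s := hx.1.1
  have hbox : e ⁻¹' (Ioo (s - r) (s + r) ×ˢ Metric.ball (e x).2 r) ⊆ O := by
    intro z hz
    have h1 : e z ∈ Metric.ball (e x) r := by
      rw [← ball_prod_same, hxs, Real.ball_eq_Ioo]
      exact hz
    have h2 := hb h1
    rwa [mem_preimage, e.symm_apply_apply] at h2
  have hnhd : e ⁻¹' (univ ×ˢ Metric.ball (e x).2 r) ∈ 𝓝 x :=
    ((isOpen_univ.prod Metric.isOpen_ball).preimage e.continuous).mem_nhds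
      ⟨trivial, Metric.mem_ball_self hr⟩
  have hnull := totalVariation_box_diff_jumpSet hO hw hD (a := s - r) (b := s + r) (s := s)
    ⟨sub_lt_self s hr, lt_add_of_pos_right s hr⟩ Metric.isOpen_ball Metric.isBounded_ball hbox k
  refine ⟨_, ?_, hnull⟩
  filter_upwards [mem_nhdsWithin_of_mem_nhds hnhd, self_mem_nhdsWithin] with z hz hz'
  have h1 : (e z).1 ∈ ({s} : Set ℝ) := hz'.1.1
  exact ⟨⟨h1, hz.2⟩, hz'.2⟩

end TraceTheorem

/-- The derivative of an integrable map does not charge the part of a hyperplane `{x_d = s}` that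
lies outside its jump set. -/
theorem totalVariation_strip_diff_jumpSet {d : ℕ} [NeZero d] {O : Set (Vec d)} (hO : IsOpen O)
    {w : Vec d → Vec d} (hw : IntegrableOn w O) {D : Fin d → Fin d → SignedMeasure (Vec d)}
    (hD : ∀ k i, HasDistribDeriv O i (fun x => w x k) (D k i)) (s : ℝ) (k i : Fin d) :
    (D k i).totalVariation (strip d {s} \ jumpSet O w) = 0 := by
  by_cases hi : i = ⊤
  swap
  · refine measure_mono_null sdiff_subset ((hD k i).totalVariation_strip_of_ne hO hi ?_ s)
    exact (EuclideanSpace.proj (𝕜 := ℝ) k).integrable_comp hw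
  subst hi
  obtain ⟨m, rfl⟩ : ∃ m, d = m + 1 := ⟨d - 1, (Nat.succ_pred (NeZero.ne d)).symm⟩
  exact totalVariation_top_strip_diff_jumpSet hO hw (fun k => hD k ⊤) s k

/-! ### Pointwise convergence along subsequences -/

section Subsequences

/-- `L¹`-convergence to zero gives almost everywhere convergence along a subsequence. -/
lemma exists_subseq_ae_tendsto_zero {α : Type*} [MeasurableSpace α] {μ : Measure α}
    {G : ℕ → α → ℝ≥0∞} (hG : ∀ n, AEMeasurable (G n) μ)
    (h : Tendsto (fun n => ∫⁻ x, G n x ∂μ) atTop (𝓝 0)) :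
    ∃ φ : ℕ → ℕ, StrictMono φ ∧ ∀ᵐ x ∂μ, Tendsto (fun k => G (φ k) x) atTop (𝓝 0) := by
  obtain ⟨δ, hδ0, hδ⟩ := ENNReal.exists_pos_sum_of_countable (one_ne_zero (α := ℝ≥0∞)) ℕ
  obtain ⟨φ, hφ, hφG⟩ := extraction_forall_of_eventually' (P := fun k n => ∫⁻ x, G n x ∂μ ≤ δ k)
    fun k => by
      have := h.eventually (ge_mem_nhds (show (0 : ℝ≥0∞) < δ k by exact_mod_cast hδ0 k))
      exact (eventually_atTop.1 this)
  refine ⟨φ, hφ, ?_⟩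
  have hsum : ∫⁻ x, ∑' k, G (φ k) x ∂μ ≠ ⊤ := by
    rw [lintegral_tsum fun k => hG (φ k)]
    exact ((ENNReal.tsum_le_tsum hφG).trans_lt (hδ.trans ENNReal.one_lt_top)).ne
  filter_upwards [ae_lt_top' (AEMeasurable.tsum fun k => hG (φ k)) hsum] with x hx
  exact ENNReal.tendsto_atTop_zero_of_tsum_ne_top hx.ne

variable {d : ℕ} {Ω : Set (Vec d)} {P : ℕ → Set (Vec d)}

lemma IsCaccioppoliPartition.ae_exists_unique (hP : IsCaccioppoliPartition Ω P)
    (hΩ : MeasurableSet Ω) :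
    ∀ᵐ x ∂(volume.restrict Ω), ∃ j, x ∈ P j ∧ ∀ i, x ∈ P i → i = j := by
  have h1 : ∀ᵐ x : Vec d, ∀ i j, i ≠ j → x ∉ P i ∩ P j := by
    refine ae_all_iff.2 fun i => ae_all_iff.2 fun j => ?_
    by_cases hij : i = j
    · exact Eventually.of_forall fun x h => absurd hij h
    · filter_upwards [measure_eq_zero_iff_ae_notMem.1 (hP.disjoint i j hij)] with x hx _
      exact hx
  filter_upwards [ae_restrict_of_ae h1, ae_restrict_mem hΩ,
    ae_restrict_of_ae (measure_eq_zero_iff_ae_notMem.1 hP.cover)] with x hx hxΩ hxc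
  have : x ∈ ⋃ j, P j := by
    by_contra h
    exact hxc ⟨hxΩ, h⟩
  obtain ⟨j, hj⟩ := mem_iUnion.1 this
  refine ⟨j, hj, fun i hi => ?_⟩
  by_contra hij
  exact hx i j hij ⟨hi, hj⟩

lemma tsum_indicator_eq {α E : Type*} [AddCommMonoid E] [TopologicalSpace E] {P : ℕ → Set α}
    (f : ℕ → α → E) {x : α} {j : ℕ} (hj : x ∈ P j) (huniq : ∀ i, x ∈ P i → i = j) :
    ∑' i, (P i).indicator (f i) x = f j x := by
  rw [tsum_eq_single j fun i hi => indicator_of_notMem (fun h => hi (huniq i h)) _,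
    indicator_of_mem hj]

lemma phaseField_eq {R : Mat d} {M : ℕ → Mat d} {x : Vec d} {j : ℕ} (hj : x ∈ P j)
    (huniq : ∀ i, x ∈ P i → i = j) : phaseField R P M x = R * M j :=
  tsum_indicator_eq _ hj huniq

lemma rescaledDisp_eq {ε : ℝ} {y : Vec d → Vec d} {R : Mat d} {M : ℕ → Mat d} {t : ℕ → Vec d}
    {x : Vec d} {j : ℕ} (hj : x ∈ P j) (huniq : ∀ i, x ∈ P i → i = j) :
    rescaledDisp ε y R P M t x = ε⁻¹ • (y x - (act (R * M j) x + t j)) := by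
  rw [rescaledDisp, tsum_indicator_eq (fun j z => act (R * M j) z + t j) hj huniq]

/-- If each component of the partitions converges in measure, the sum over `j` of the indicator
functions of the symmetric differences `Pε n j ∆ P j`, with the summable weights `2⁻ʲ`, converges to
zero in `L¹`. Pointwise convergence of this one function controls all components at once. -/
lemma tendsto_lintegral_tsum_symmDiff (hΩt : volume Ω ≠ ⊤) {Pε : ℕ → ℕ → Set (Vec d)}
    (hPε : ∀ n j, MeasurableSet (Pε n j)) (hP : ∀ j, MeasurableSet (P j))
    (h : ∀ j, Tendsto (fun n => volume (Pε n j ∆ P j)) atTop (𝓝 0)) :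
    Tendsto (fun n => ∫⁻ x in Ω, ∑' j, (Pε n j ∆ P j).indicator (fun _ => (2⁻¹ : ℝ≥0∞) ^ j) x)
      atTop (𝓝 0) := by
  have hm : ∀ n j, MeasurableSet (Pε n j ∆ P j) := fun n j => (hPε n j).symmDiff (hP j)
  have heq : ∀ n, ∫⁻ x in Ω, ∑' j, (Pε n j ∆ P j).indicator (fun _ => (2⁻¹ : ℝ≥0∞) ^ j) x =
      ∫⁻ j, (2⁻¹ : ℝ≥0∞) ^ j * volume.restrict Ω (Pε n j ∆ P j) ∂(Measure.count : Measure ℕ) := by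
    intro n
    rw [lintegral_tsum fun j => (measurable_const.indicator (hm n j)).aemeasurable, lintegral_count]
    congr 1
    funext j
    rw [lintegral_indicator (hm n j), setLIntegral_const]
  simp_rw [heq]
  rw [show (0 : ℝ≥0∞) = ∫⁻ _ : ℕ, 0 ∂(Measure.count : Measure ℕ) by simp]
  refine tendsto_lintegral_of_dominated_convergence (fun j => (2⁻¹ : ℝ≥0∞) ^ j * volume Ω)
    (fun n => measurable_of_countable _) (fun n => Eventually.of_forall fun j => ?_) ?_
    (Eventually.of_forall fun j => ?_)
  · dsimp only
    refine mul_le_mul' le_rfl ((measure_mono (subset_univ _)).trans_eq ?_)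
    rw [Measure.restrict_apply_univ]
  · rw [lintegral_count, ENNReal.tsum_mul_right]
    refine ENNReal.mul_ne_top ?_ hΩt
    rw [ENNReal.tsum_geometric]
    simp
  · have h1 : Tendsto (fun n => volume.restrict Ω (Pε n j ∆ P j)) atTop (𝓝 0) :=
      tendsto_of_tendsto_of_tendsto_of_le_of_le tendsto_const_nhds (h j) (fun _ => zero_le)
        fun n => Measure.restrict_apply_le _ _
    have h2 := ENNReal.Tendsto.const_mul (a := (2⁻¹ : ℝ≥0∞) ^ j) h1
      (Or.inr (ENNReal.pow_ne_top (by simp)))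
    rwa [mul_zero] at h2

variable [NeZero d] {κ p : ℝ} {ε : ℕ → ℝ} {yε : ℕ → Vec d → Vec d}
  {Rε : ℕ → Mat d} {Pε : ℕ → ℕ → Set (Vec d)} {Mε : ℕ → ℕ → Mat d} {tε : ℕ → ℕ → Vec d}
  {y u : Vec d → Vec d}

/-- Along a subsequence, almost everywhere: the membership in the components becomes stationary,
and the phase fields and the rescaled displacements converge. -/
lemma Represents.exists_subseq (h : Represents Ω κ p ε yε Rε Pε Mε tε y u P)
    (hΩt : volume Ω ≠ ⊤) {ns : ℕ → ℕ} (hns : Tendsto ns atTop atTop) :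
    ∃ φ : ℕ → ℕ, StrictMono φ ∧ ∀ᵐ x ∂(volume.restrict Ω),
      (∀ j, ∀ᶠ k in atTop, (x ∈ Pε (ns (φ k)) j ↔ x ∈ P j)) ∧
      Tendsto (fun k => phaseField (Rε (ns (φ k))) (Pε (ns (φ k))) (Mε (ns (φ k))) x) atTop
        (𝓝 (grad Ω y x)) ∧
      Tendsto (fun k => rescaledDisp (ε (ns (φ k))) (yε (ns (φ k))) (Rε (ns (φ k)))
        (Pε (ns (φ k))) (Mε (ns (φ k))) (tε (ns (φ k))) x) atTop (𝓝 (u x)) := by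
  have h1 : TendstoInMeasure (volume.restrict Ω) (fun k => rescaledDisp (ε (ns k)) (yε (ns k))
      (Rε (ns k)) (Pε (ns k)) (Mε (ns k)) (tε (ns k))) atTop u :=
    fun δ hδ => (h.disp_tendsto δ hδ).comp hns
  obtain ⟨φ₁, hφ₁, hae₁⟩ := h1.exists_seq_tendsto_ae
  have hn₁ : Tendsto (ns ∘ φ₁) atTop atTop := hns.comp hφ₁.tendsto_atTop
  have hmS : ∀ n j, MeasurableSet (Pε n j ∆ P j) := fun n j =>
    ((h.part n).measurableSet j).symmDiff (h.limit_part.1.measurableSet j)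
  set G : ℕ → Vec d → ℝ≥0∞ := fun n x =>
    (∑' j, (Pε n j ∆ P j).indicator (fun _ => (2⁻¹ : ℝ≥0∞) ^ j) x) +
    ∑ k, ∑ i, ‖phaseField (Rε n) (Pε n) (Mε n) x k i - grad Ω y x k i‖ₑ with hG
  have hm2 : ∀ n k i, AEMeasurable
      (fun x => ‖phaseField (Rε n) (Pε n) (Mε n) x k i - grad Ω y x k i‖ₑ)
      (volume.restrict Ω) := fun n k i =>
    ((((h.phase_tendsto k i).1 n).1.aestronglyMeasurable).sub
      (h.phase_tendsto k i).2.1.1.aestronglyMeasurable).enorm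
  have hm1 : ∀ n, Measurable
      fun x => ∑' j, (Pε n j ∆ P j).indicator (fun _ => (2⁻¹ : ℝ≥0∞) ^ j) x := fun n =>
    Measurable.tsum fun j => measurable_const.indicator (hmS n j)
  have hGm : ∀ n, AEMeasurable (G n) (volume.restrict Ω) := fun n =>
    (hm1 n).aemeasurable.add
      (Finset.aemeasurable_fun_sum _ fun k _ => Finset.aemeasurable_fun_sum _ fun i _ => hm2 n k i)
  have hGlim : Tendsto (fun n => ∫⁻ x in Ω, G n x) atTop (𝓝 0) := by
    have hpart := tendsto_lintegral_tsum_symmDiff hΩt (fun n => (h.part n).measurableSet)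
      h.limit_part.1.measurableSet h.part_tendsto
    have hph := tendsto_finsetSum (Finset.univ : Finset (Fin d)) fun k _ =>
      tendsto_finsetSum (Finset.univ : Finset (Fin d)) fun i _ => (h.phase_tendsto k i).2.2.1
    have hadd := hpart.add hph
    simp only [Finset.sum_const_zero, add_zero] at hadd
    refine hadd.congr fun n => ?_
    rw [hG, lintegral_add_left (hm1 n), lintegral_finsetSum' _ fun k _ =>
      Finset.aemeasurable_fun_sum _ fun i _ => hm2 n k i]
    congr 1
    refine Finset.sum_congr rfl fun k _ => ?_
    rw [lintegral_finsetSum' _ fun i _ => hm2 n k i]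
  obtain ⟨φ₂, hφ₂, hae₂⟩ := exists_subseq_ae_tendsto_zero (G := fun k => G (ns (φ₁ k)))
    (fun k => hGm _) (hGlim.comp hn₁)
  refine ⟨φ₁ ∘ φ₂, hφ₁.comp hφ₂, ?_⟩
  filter_upwards [hae₁, hae₂] with x hx1 hx2
  refine ⟨fun j => ?_, ?_, hx1.comp hφ₂.tendsto_atTop⟩
  · have hlt : (0 : ℝ≥0∞) < (2⁻¹ : ℝ≥0∞) ^ j :=
      ENNReal.pow_pos (ENNReal.inv_pos.2 ENNReal.ofNat_ne_top) j
    filter_upwards [hx2.eventually (gt_mem_nhds hlt)] with k hk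
    by_contra hne
    have hmem : x ∈ Pε (ns (φ₁ (φ₂ k))) j ∆ P j := by
      rw [mem_symmDiff]
      by_cases h' : x ∈ P j <;> simp_all
    refine absurd hk (not_lt.2 ?_)
    refine le_trans ?_ (le_add_right (ENNReal.le_tsum j))
    rw [indicator_of_mem hmem]
  · refine tendsto_pi_nhds.2 fun a => tendsto_pi_nhds.2 fun b => ?_
    rw [tendsto_iff_edist_tendsto_0]
    refine tendsto_of_tendsto_of_tendsto_of_le_of_le tendsto_const_nhds hx2
      (fun _ => zero_le) fun k => ?_
    rw [edist_eq_enorm_sub]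
    refine le_trans ?_ le_add_self
    refine le_trans ?_ (Finset.single_le_sum (fun _ _ => zero_le) (Finset.mem_univ a))
    exact Finset.single_le_sum
      (f := fun i => ‖phaseField (Rε (ns (φ₁ (φ₂ k)))) (Pε (ns (φ₁ (φ₂ k))))
        (Mε (ns (φ₁ (φ₂ k)))) x a i - grad Ω y x a i‖ₑ) (fun _ _ => zero_le) (Finset.mem_univ b)

end Subsequences

/-! ### Affine maps -/

section Affine

variable {d : ℕ}

lemma act_add (F G : Mat d) (x : Vec d) : act (F + G) x = act F x + act G x := by
  simp [act]

lemma act_sub (F G : Mat d) (x : Vec d) : act (F - G) x = act F x - act G x := by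
  simp [act]

lemma act_smul (c : ℝ) (F : Mat d) (x : Vec d) : act (c • F) x = c • act F x := by
  simp [act]

lemma act_vec_add (F : Mat d) (x y : Vec d) : act F (x + y) = act F x + act F y := map_add _ _ _

lemma act_vec_sub (F : Mat d) (x y : Vec d) : act F (x - y) = act F x - act F y := map_sub _ _ _

lemma act_vec_smul (F : Mat d) (c : ℝ) (x : Vec d) : act F (c • x) = c • act F x := map_smul _ _ _

lemma act_apply (F : Mat d) (x : Vec d) (k : Fin d) : act F x k = ∑ i, F k i * x i := by
  simp [act, Matrix.toLpLin_apply, Matrix.mulVec, dotProduct]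

lemma continuous_act : Continuous fun z : Mat d × Vec d => act z.1 z.2 := by
  have h : Continuous fun z : Mat d × Vec d => fun k => ∑ i, z.1 k i * z.2 i := by
    refine continuous_pi fun k => ?_
    refine continuous_finsetSum _ fun i _ => ?_
    have h1 : Continuous fun z : Mat d × Vec d => z.1 k i :=
      continuous_fst.matrix_elem k i
    have h2 : Continuous fun z : Mat d × Vec d => z.2 i := by fun_prop
    exact h1.mul h2
  refine ((PiLp.continuous_toLp 2 _).comp h).congr fun z => ?_
  ext k
  simp [act_apply]

/-- If affine maps converge at the points of a set of positive measure, their coefficients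
converge. -/
lemma exists_tendsto_affine {F : ℕ → Mat d} {b : ℕ → Vec d} {A : Set (Vec d)}
    (hA : volume A ≠ 0) (h : ∀ x ∈ A, ∃ l, Tendsto (fun n => act (F n) x + b n) atTop (𝓝 l)) :
    ∃ F₀ b₀, Tendsto F atTop (𝓝 F₀) ∧ Tendsto b atTop (𝓝 b₀) := by
  let V : AffineSubspace ℝ (Vec d) :=
    { carrier := {x | ∃ l, Tendsto (fun n => act (F n) x + b n) atTop (𝓝 l)}
      smul_vsub_vadd_mem' := by
        rintro c x y z ⟨lx, hx⟩ ⟨ly, hy⟩ ⟨lz, hz⟩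
        refine ⟨c • (lx - ly) + lz, (((hx.sub hy).const_smul c).add hz).congr fun n => ?_⟩
        simp only [vsub_eq_sub, vadd_eq_add, act_vec_add, act_vec_smul, act_vec_sub]
        module }
  have hV : V = ⊤ := by
    by_contra hne
    exact hA (measure_mono_null (fun x hx => h x hx) (Measure.addHaar_affineSubspace volume V hne))
  have hall : ∀ x, ∃ l, Tendsto (fun n => act (F n) x + b n) atTop (𝓝 l) := fun x => by
    have : x ∈ V := by rw [hV]; trivial
    exact this
  obtain ⟨b₀, hb⟩ := hall 0
  have hb' : Tendsto b atTop (𝓝 b₀) := hb.congr fun n => by simp [act]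
  have hcol : ∀ k i, ∃ l, Tendsto (fun n => F n k i) atTop (𝓝 l) := by
    intro k i
    obtain ⟨l, hl⟩ := hall (EuclideanSpace.single i 1)
    have h1 := (hl.sub hb')
    refine ⟨(l - b₀) k, ?_⟩
    have h2 := ((by fun_prop : Continuous fun x : Vec d => x k).tendsto _).comp h1
    refine h2.congr fun n => ?_
    simp [act_apply]
  choose l hl using hcol
  exact ⟨Matrix.of l, b₀, tendsto_pi_nhds.2 fun k => tendsto_pi_nhds.2 fun i => hl k i, hb'⟩

end Affine

/-! ### Rotations and wells -/

section Wells

variable {d : ℕ}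

lemma rotations_mul_transpose {R : Mat d} (hR : R ∈ rotations d) : R * R.transpose = 1 :=
  Matrix.mem_orthogonalGroup_iff _ _ |>.1 (Matrix.mem_specialOrthogonalGroup_iff.1 hR).1

lemma rotations_transpose_mul {R : Mat d} (hR : R ∈ rotations d) : R.transpose * R = 1 :=
  Matrix.mem_orthogonalGroup_iff' _ _ |>.1 (Matrix.mem_specialOrthogonalGroup_iff.1 hR).1

lemma rotations_det {R : Mat d} (hR : R ∈ rotations d) : R.det = 1 :=
  (Matrix.mem_specialOrthogonalGroup_iff.1 hR).2

lemma mem_rotations {R : Mat d} (h : R * R.transpose = 1) (hd : R.det = 1) : R ∈ rotations d :=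
  Matrix.mem_specialOrthogonalGroup_iff.2 ⟨(Matrix.mem_orthogonalGroup_iff _ _).2 h, hd⟩

variable [NeZero d] {κ : ℝ}

lemma det_wellB : (wellB d κ).det = 1 + κ := by
  rw [wellB, Matrix.det_diagonal, Finset.prod_ite_eq' Finset.univ]
  simp

lemma wells_det_pos (hκ : 0 < κ) {M : Mat d} (hM : M ∈ wells d κ) : 0 < M.det := by
  rcases hM with rfl | rfl
  · simp
  · rw [det_wellB]; linarith

lemma wells_eq_of_det_eq (hκ : 0 < κ) {M N : Mat d} (hM : M ∈ wells d κ) (hN : N ∈ wells d κ)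
    (h : M.det = N.det) : M = N := by
  rcases hM with rfl | rfl <;> rcases hN with rfl | rfl
  · rfl
  · rw [det_wellB, Matrix.det_one] at h; linarith
  · rw [det_wellB, Matrix.det_one] at h; linarith
  · rfl

lemma finite_wells : (wells d κ).Finite := (Set.finite_singleton _).insert _

lemma isClosed_wells : IsClosed (wells d κ) := finite_wells.isClosed

/-- A convergent sequence of phases is eventually constant. -/
lemma eventually_eq_of_tendsto_wells {M : ℕ → Mat d} (hM : ∀ n, M n ∈ wells d κ)
    {L : Mat d} (h : Tendsto M atTop (𝓝 L)) : L ∈ wells d κ ∧ ∀ᶠ n in atTop, M n = L := by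
  have hL : L ∈ wells d κ := isClosed_wells.mem_of_tendsto h (Eventually.of_forall hM)
  have hfin : (wells d κ \ {L}).Finite := finite_wells.subset sdiff_subset
  refine ⟨hL, ?_⟩
  filter_upwards [h.eventually (hfin.isClosed.isOpen_compl.mem_nhds fun hx => hx.2 rfl)] with n hn
  by_contra hne
  exact hn ⟨hM n, hne⟩

end Wells

/-! ### The limits of the phases -/

section Phases

variable {d : ℕ} [NeZero d] {Ω : Set (Vec d)} {P : ℕ → Set (Vec d)} {κ p : ℝ} {ε : ℕ → ℝ}
  {yε : ℕ → Vec d → Vec d} {Rε : ℕ → Mat d} {Pε : ℕ → ℕ → Set (Vec d)} {Mε : ℕ → ℕ → Mat d}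
  {tε : ℕ → ℕ → Vec d} {y u : Vec d → Vec d}

/-- Pointwise convergence along a subsequence on each component `P j`, in terms of the affine map of
index `j`: almost every `x ∈ P j` is eventually in `Pε n j` and in no other component. -/
lemma Represents.exists_subseq_components (h : Represents Ω κ p ε yε Rε Pε Mε tε y u P)
    (hΩ : MeasurableSet Ω) (hΩt : volume Ω ≠ ⊤) {ns : ℕ → ℕ} (hns : Tendsto ns atTop atTop) :
    ∃ φ : ℕ → ℕ, StrictMono φ ∧ ∀ᵐ x ∂(volume.restrict Ω), ∀ j, x ∈ P j →
      Tendsto (fun k => Rε (ns (φ k)) * Mε (ns (φ k)) j) atTop (𝓝 (grad Ω y x)) ∧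
      Tendsto (fun k => (ε (ns (φ k)))⁻¹ • (yε (ns (φ k)) x -
        (act (Rε (ns (φ k)) * Mε (ns (φ k)) j) x + tε (ns (φ k)) j))) atTop (𝓝 (u x)) := by
  obtain ⟨φ, hφ, hae⟩ := h.exists_subseq hΩt hns
  refine ⟨φ, hφ, ?_⟩
  filter_upwards [hae, ae_all_iff.2 fun n => (h.part n).ae_exists_unique hΩ] with x hx hu j hj
  have hev : ∀ᶠ k in atTop, x ∈ Pε (ns (φ k)) j := by
    filter_upwards [hx.1 j] with k hk
    exact hk.2 hj
  have huniq : ∀ n, x ∈ Pε n j → ∀ i, x ∈ Pε n i → i = j := by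
    intro n hn i hi
    obtain ⟨l, -, hl⟩ := hu n
    rw [hl i hi, hl j hn]
  refine ⟨hx.2.1.congr' ?_, hx.2.2.congr' ?_⟩
  · filter_upwards [hev] with k hk
    exact phaseField_eq hk (huniq _ hk)
  · filter_upwards [hev] with k hk
    exact rescaledDisp_eq hk (huniq _ hk)

/-- The phases of a nonnull component converge, and their limit determines the limiting gradient on
this component. -/
lemma Represents.exists_phase (h : Represents Ω κ p ε yε Rε Pε Mε tε y u P)
    (hΩ : MeasurableSet Ω) (hΩt : volume Ω ≠ ⊤) {R : Mat d} (hR : R ∈ rotations d)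
    (hRε : Tendsto Rε atTop (𝓝 R)) {j : ℕ} (hj : volume (P j) ≠ 0) :
    ∃ L ∈ wells d κ, Tendsto (fun n => Mε n j) atTop (𝓝 L) ∧ (∀ᶠ n in atTop, Mε n j = L) ∧
      ∀ᵐ x ∂(volume.restrict (P j)), grad Ω y x = R * L := by
  have key : ∀ ns : ℕ → ℕ, Tendsto ns atTop atTop → ∃ φ : ℕ → ℕ, ∃ L,
      Tendsto (fun k => Mε (ns (φ k)) j) atTop (𝓝 L) ∧
      ∀ᵐ x ∂(volume.restrict (P j)), grad Ω y x = R * L := by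
    intro ns hns
    obtain ⟨φ, hφ, hae⟩ := h.exists_subseq_components hΩ hΩt hns
    have hn : Tendsto (fun k => ns (φ k)) atTop atTop := hns.comp hφ.tendsto_atTop
    have hae' : ∀ᵐ x ∂(volume.restrict (P j)),
        Tendsto (fun k => Mε (ns (φ k)) j) atTop (𝓝 (R.transpose * grad Ω y x)) := by
      filter_upwards [ae_restrict_of_ae_restrict_of_subset (h.limit_part.1.subset j) hae,
        ae_restrict_mem (h.limit_part.1.measurableSet j)] with x hx hxj
      have h1 := (hx j hxj).1
      have h2 : Tendsto (fun k => (Rε (ns (φ k))).transpose) atTop (𝓝 R.transpose) :=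
        ((continuous_id.matrix_transpose).tendsto R).comp (hRε.comp hn)
      refine (h2.mul h1).congr fun k => ?_
      rw [← mul_assoc, rotations_transpose_mul (h.rot _), one_mul]
    have hne : (ae (volume.restrict (P j))).NeBot := by
      rw [ae_neBot, Ne, Measure.restrict_eq_zero]
      exact hj
    obtain ⟨x₀, hx₀⟩ := hae'.exists
    refine ⟨φ, _, hx₀, ?_⟩
    filter_upwards [hae'] with x hx
    have := tendsto_nhds_unique hx hx₀
    rw [← this, ← mul_assoc, rotations_mul_transpose hR, one_mul]
  obtain ⟨-, L, -, hL⟩ := key id tendsto_id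
  have hlim : Tendsto (fun n => Mε n j) atTop (𝓝 L) := by
    refine tendsto_of_subseq_tendsto fun ns hns => ?_
    obtain ⟨φ, L', h1, h2⟩ := key ns hns
    have hne : (ae (volume.restrict (P j))).NeBot := by
      rw [ae_neBot, Ne, Measure.restrict_eq_zero]
      exact hj
    obtain ⟨x, hx, hx'⟩ := (hL.and h2).exists
    have : L = L' := by
      have h3 : R * L = R * L' := hx.symm.trans hx'
      have h4 := congrArg (fun F => R.transpose * F) h3
      simpa only [← mul_assoc, rotations_transpose_mul hR, one_mul] using h4
    exact ⟨φ, this ▸ h1⟩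
  obtain ⟨h1, h2⟩ := eventually_eq_of_tendsto_wells (fun n => h.phase n j) hlim
  exact ⟨L, h1, hlim, h2, hL⟩

end Phases

/-! ### Comparison of two representations -/

section Comparison

lemma tendsto_act {d : ℕ} {α : Type*} {l : Filter α} {F : α → Mat d} {x : α → Vec d} {F₀ : Mat d}
    {x₀ : Vec d} (hF : Tendsto F l (𝓝 F₀)) (hx : Tendsto x l (𝓝 x₀)) :
    Tendsto (fun k => act (F k) (x k)) l (𝓝 (act F₀ x₀)) := by
  have h := (continuous_act.tendsto (F₀, x₀)).comp (hF.prodMk_nhds hx)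
  exact h

/-- Two initial segments of `ℕ` in bijection are equal. -/
lemma lowerSet_eq_of_equiv {s t : Set ℕ} (hs : IsLowerSet s) (ht : IsLowerSet t) (e : s ≃ t) :
    s = t := by
  have key : ∀ {s t : Set ℕ}, IsLowerSet s → s ⊆ t → (s ≃ t) → s = t := by
    intro s t hs hst e
    by_contra hne
    obtain ⟨n, hnt, hns⟩ := Set.exists_of_ssubset (hst.ssubset_of_ne hne)
    have hfin : s.Finite := (Set.finite_Iio n).subset fun k hk => by
      by_contra hkn
      exact hns (hs (not_lt.1 hkn) hk)
    have := hfin.to_subtype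
    have htf : t.Finite := Set.finite_coe_iff.1 (Finite.of_equiv s e)
    exact hne (Set.eq_of_subset_of_ncard_le hst (Nat.card_congr e.symm).le htf)
  rcases hs.total ht with h | h
  · exact key hs h e
  · exact (key ht h e.symm).symm

variable {d : ℕ} [NeZero d] {Ω : Set (Vec d)} {κ p : ℝ} {ε : ℕ → ℝ} {yε : ℕ → Vec d → Vec d}
  {R₁ : ℕ → Mat d} {Q₁ : ℕ → ℕ → Set (Vec d)} {M₁ : ℕ → ℕ → Mat d} {t₁ : ℕ → ℕ → Vec d}
  {y₁ u₁ : Vec d → Vec d} {P₁ : ℕ → Set (Vec d)}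
  {R₂ : ℕ → Mat d} {Q₂ : ℕ → ℕ → Set (Vec d)} {M₂ : ℕ → ℕ → Mat d} {t₂ : ℕ → ℕ → Vec d}
  {y₂ u₂ : Vec d → Vec d} {P₂ : ℕ → Set (Vec d)}

/-- On overlapping components of two representations, the rescaled differences of the affine maps
converge along a common subsequence, and the limit is the difference of the displacements. -/
lemma exists_affine_limits (h₁ : Represents Ω κ p ε yε R₁ Q₁ M₁ t₁ y₁ u₁ P₁)
    (h₂ : Represents Ω κ p ε yε R₂ Q₂ M₂ t₂ y₂ u₂ P₂) (hΩ : MeasurableSet Ω)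
    (hΩt : volume Ω ≠ ⊤) :
    ∃ φ : ℕ → ℕ, StrictMono φ ∧ ∀ i j, volume (P₁ i ∩ P₂ j) ≠ 0 → ∃ F τ,
      Tendsto (fun k => (ε (φ k))⁻¹ • (R₂ (φ k) * M₂ (φ k) j - R₁ (φ k) * M₁ (φ k) i)) atTop
        (𝓝 F) ∧
      Tendsto (fun k => (ε (φ k))⁻¹ • (t₂ (φ k) j - t₁ (φ k) i)) atTop (𝓝 τ) ∧
      ∀ᵐ x ∂(volume.restrict (P₁ i ∩ P₂ j)), u₁ x - u₂ x = act F x + τ := by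
  obtain ⟨φ₁, hφ₁, hae₁⟩ := h₁.exists_subseq_components hΩ hΩt tendsto_id
  obtain ⟨φ₂, hφ₂, hae₂⟩ := h₂.exists_subseq_components hΩ hΩt hφ₁.tendsto_atTop
  refine ⟨φ₁ ∘ φ₂, hφ₁.comp hφ₂, fun i j hij => ?_⟩
  simp only [id] at hae₁
  have hm : MeasurableSet (P₁ i ∩ P₂ j) :=
    (h₁.limit_part.1.measurableSet i).inter (h₂.limit_part.1.measurableSet j)
  have hsub : P₁ i ∩ P₂ j ⊆ Ω := inter_subset_left.trans (h₁.limit_part.1.subset i)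
  have hlim : ∀ᵐ x ∂(volume.restrict (P₁ i ∩ P₂ j)), Tendsto (fun k =>
      act ((ε (φ₁ (φ₂ k)))⁻¹ • (R₂ (φ₁ (φ₂ k)) * M₂ (φ₁ (φ₂ k)) j -
        R₁ (φ₁ (φ₂ k)) * M₁ (φ₁ (φ₂ k)) i)) x +
      (ε (φ₁ (φ₂ k)))⁻¹ • (t₂ (φ₁ (φ₂ k)) j - t₁ (φ₁ (φ₂ k)) i)) atTop (𝓝 (u₁ x - u₂ x)) := by
    filter_upwards [ae_restrict_of_ae_restrict_of_subset hsub hae₁,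
      ae_restrict_of_ae_restrict_of_subset hsub hae₂, ae_restrict_mem hm] with x hx1 hx2 hx
    have h3 := ((hx1 i hx.1).2.comp hφ₂.tendsto_atTop).sub (hx2 j hx.2).2
    refine h3.congr fun k => ?_
    simp only [Function.comp, act_smul, act_sub]
    module
  obtain ⟨Z, hZ, hZm, hZ0⟩ := exists_measurable_superset_of_null (ae_iff.1 hlim)
  rw [Measure.restrict_apply hZm] at hZ0
  -- `yε` cancels in the difference of the displacements; the affine maps that are left converge on
  -- a set of positive measure
  have hne : volume ((P₁ i ∩ P₂ j) \ Z) ≠ 0 := by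
    intro h0
    refine hij (measure_mono_null (fun x hx => ?_) (measure_union_null h0 hZ0))
    by_cases hxZ : x ∈ Z
    · exact Or.inr ⟨hxZ, hx⟩
    · exact Or.inl ⟨hx, hxZ⟩
  have hconv : ∀ x ∈ (P₁ i ∩ P₂ j) \ Z, ∃ l, Tendsto (fun k =>
      act ((ε (φ₁ (φ₂ k)))⁻¹ • (R₂ (φ₁ (φ₂ k)) * M₂ (φ₁ (φ₂ k)) j -
        R₁ (φ₁ (φ₂ k)) * M₁ (φ₁ (φ₂ k)) i)) x +
      (ε (φ₁ (φ₂ k)))⁻¹ • (t₂ (φ₁ (φ₂ k)) j - t₁ (φ₁ (φ₂ k)) i)) atTop (𝓝 l) := by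
    intro x hx
    refine ⟨u₁ x - u₂ x, ?_⟩
    by_contra hcon
    exact hx.2 (hZ hcon)
  obtain ⟨F, τ, hF, hτ⟩ := exists_tendsto_affine hne hconv
  refine ⟨F, τ, hF, hτ, ?_⟩
  filter_upwards [hlim] with x hx
  exact tendsto_nhds_unique hx ((tendsto_act hF tendsto_const_nhds).add hτ)

/-- The rotations of two representations differ by an infinitesimal rotation at order `ε`. -/
lemma exists_common_limits (h₁ : Represents Ω κ p ε yε R₁ Q₁ M₁ t₁ y₁ u₁ P₁)
    (h₂ : Represents Ω κ p ε yε R₂ Q₂ M₂ t₂ y₂ u₂ P₂) (hΩ : MeasurableSet Ω)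
    (hΩt : volume Ω ≠ ⊤) (hΩ0 : volume Ω ≠ 0) (hκ : 0 < κ) (hε : ∀ n, 0 < ε n)
    (hε0 : Tendsto ε atTop (𝓝 0)) :
    ∃ φ : ℕ → ℕ, StrictMono φ ∧ ∃ S : Mat d, S.transpose = -S ∧
      ∀ i j, volume (P₁ i ∩ P₂ j) ≠ 0 → (∃ τ,
      Tendsto (fun k => (ε (φ k))⁻¹ • (t₂ (φ k) j - t₁ (φ k) i)) atTop (𝓝 τ) ∧
      ∀ᵐ x ∂(volume.restrict (P₁ i ∩ P₂ j)), u₁ x - u₂ x = τ + act (S * grad Ω y₁ x) x) ∧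
      (∀ᵐ x ∂(volume.restrict (P₁ i ∩ P₂ j)), grad Ω y₁ x = grad Ω y₂ x) ∧
      ∃ L, Tendsto (fun n => M₁ n i) atTop (𝓝 L) ∧ Tendsto (fun n => M₂ n j) atTop (𝓝 L) := by
  obtain ⟨φ, hφ, hlim⟩ := exists_affine_limits h₁ h₂ hΩ hΩt
  obtain ⟨S₁, hS₁, -, hS₁t⟩ := h₁.rot_tendsto
  obtain ⟨S₂, hS₂, -, hS₂t⟩ := h₂.rot_tendsto
  have hεφ : Tendsto (fun k => ε (φ k)) atTop (𝓝 0) := hε0.comp hφ.tendsto_atTop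
  have hR₁ : Tendsto (fun k => R₁ (φ k)) atTop (𝓝 S₁) := hS₁t.comp hφ.tendsto_atTop
  have hR₂ : Tendsto (fun k => R₂ (φ k)) atTop (𝓝 S₂) := hS₂t.comp hφ.tendsto_atTop
  -- the common phase on overlapping components
  have hov : ∀ i j, volume (P₁ i ∩ P₂ j) ≠ 0 → ∃ L, L ∈ wells d κ ∧ S₁ = S₂ ∧
      Tendsto (fun n => M₁ n i) atTop (𝓝 L) ∧ Tendsto (fun n => M₂ n j) atTop (𝓝 L) ∧
      (∀ᵐ x ∂(volume.restrict (P₁ i ∩ P₂ j)), grad Ω y₁ x = S₁ * L ∧ grad Ω y₂ x = S₁ * L) ∧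
      ∀ F, Tendsto (fun k => (ε (φ k))⁻¹ • (R₂ (φ k) * M₂ (φ k) j - R₁ (φ k) * M₁ (φ k) i)) atTop
        (𝓝 F) → Tendsto (fun k => (ε (φ k))⁻¹ • (R₂ (φ k) - R₁ (φ k))) atTop (𝓝 (F * L⁻¹)) := by
    intro i j hij
    have hi : volume (P₁ i) ≠ 0 := fun h0 => hij (measure_mono_null inter_subset_left h0)
    have hj : volume (P₂ j) ≠ 0 := fun h0 => hij (measure_mono_null inter_subset_right h0)
    obtain ⟨L₁, hL₁, hL₁t, hL₁e, hL₁g⟩ := h₁.exists_phase hΩ hΩt hS₁ hS₁t hi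
    obtain ⟨L₂, hL₂, hL₂t, hL₂e, hL₂g⟩ := h₂.exists_phase hΩ hΩt hS₂ hS₂t hj
    obtain ⟨F, τ, hF, -, -⟩ := hlim i j hij
    -- the difference quotients converge, so the differences tend to zero
    have hdiff : Tendsto (fun k => R₂ (φ k) * M₂ (φ k) j - R₁ (φ k) * M₁ (φ k) i) atTop
        (𝓝 0) := by
      have := hεφ.smul hF
      rw [zero_smul] at this
      refine this.congr fun k => ?_
      rw [smul_smul, mul_inv_cancel₀ (hε _).ne', one_smul]
    have hlimit : S₂ * L₂ - S₁ * L₁ = 0 := tendsto_nhds_unique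
      ((hR₂.mul (hL₂t.comp hφ.tendsto_atTop)).sub (hR₁.mul (hL₁t.comp hφ.tendsto_atTop))) hdiff
    have heq : S₂ * L₂ = S₁ * L₁ := sub_eq_zero.1 hlimit
    have hdet : L₁ = L₂ := by
      refine wells_eq_of_det_eq hκ hL₁ hL₂ ?_
      have := congrArg Matrix.det heq
      rw [Matrix.det_mul, Matrix.det_mul, rotations_det hS₁, rotations_det hS₂] at this
      linarith
    subst hdet
    have hu : IsUnit L₁.det := (wells_det_pos hκ hL₁).ne'.isUnit
    have hSS : S₁ = S₂ := by
      have := congrArg (fun F => F * L₁⁻¹) heq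
      simp only [mul_assoc, Matrix.mul_nonsing_inv _ hu, mul_one] at this
      exact this.symm
    refine ⟨L₁, hL₁, hSS, hL₁t, hL₂t, ?_, fun F hF => ?_⟩
    · filter_upwards [ae_restrict_of_ae_restrict_of_subset inter_subset_left hL₁g,
        ae_restrict_of_ae_restrict_of_subset inter_subset_right hL₂g] with x hx1 hx2
      exact ⟨hx1, by rw [hx2, hSS]⟩
    · refine (hF.mul_const L₁⁻¹).congr' ?_
      filter_upwards [hφ.tendsto_atTop.eventually hL₁e, hφ.tendsto_atTop.eventually hL₂e]
        with k hk1 hk2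
      rw [hk1, hk2, ← sub_mul, smul_mul_assoc, mul_assoc, Matrix.mul_nonsing_inv _ hu, mul_one]
  -- some pair of components overlaps
  obtain ⟨i₀, j₀, hij₀⟩ : ∃ i j, volume (P₁ i ∩ P₂ j) ≠ 0 := by
    by_contra! hcon
    have hnull : ∀ᵐ x : Vec d, ∀ i j, x ∉ P₁ i ∩ P₂ j :=
      ae_all_iff.2 fun i => ae_all_iff.2 fun j => measure_eq_zero_iff_ae_notMem.1 (hcon i j)
    have : (ae (volume.restrict Ω)).NeBot := by
      rw [ae_neBot, Ne, Measure.restrict_eq_zero]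
      exact hΩ0
    obtain ⟨x, hx1, ⟨i, hi, -⟩, ⟨j, hj, -⟩⟩ := ((ae_restrict_of_ae hnull).and
      ((h₁.limit_part.1.ae_exists_unique hΩ).and (h₂.limit_part.1.ae_exists_unique hΩ))).exists
    exact hx1 i j ⟨hi, hj⟩
  obtain ⟨F₀, τ₀, hF₀, -, -⟩ := hlim i₀ j₀ hij₀
  obtain ⟨L₀, -, hSS, -, -, -, hG⟩ := hov i₀ j₀ hij₀
  have hG := hG F₀ hF₀
  set G := F₀ * L₀⁻¹ with hGdef
  subst hSS
  refine ⟨φ, hφ, G * S₁.transpose, ?_, fun i j hij => ?_⟩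
  -- `R₂ R₂ᵀ - R₁ R₁ᵀ = 0` divided by `ε`, in the limit
  · have hT : ∀ {A : ℕ → Mat d} {B : Mat d}, Tendsto A atTop (𝓝 B) →
        Tendsto (fun k => (A k).transpose) atTop (𝓝 B.transpose) := fun h =>
      ((continuous_id.matrix_transpose).tendsto _).comp h
    have h0 : G * S₁.transpose + S₁ * G.transpose = 0 := by
      refine tendsto_nhds_unique ((hG.mul (hT hR₂)).add (hR₁.mul (hT hG))) ?_
      refine tendsto_const_nhds.congr fun k => ?_
      rw [Matrix.transpose_smul, Matrix.transpose_sub, smul_mul_assoc, mul_smul_comm, ← smul_add,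
        sub_mul, mul_sub, rotations_mul_transpose (h₁.rot _), rotations_mul_transpose (h₂.rot _)]
      simp
    rw [Matrix.transpose_mul, Matrix.transpose_transpose]
    exact eq_neg_of_add_eq_zero_right h0
  · obtain ⟨F, τ, hF, hτ, hu⟩ := hlim i j hij
    obtain ⟨L, hL, -, hL1, hL2, hg, hGF⟩ := hov i j hij
    have hGL : F = G * L := by
      have h1 := tendsto_nhds_unique hG (hGF F hF)
      rw [h1, mul_assoc, Matrix.nonsing_inv_mul _ (wells_det_pos hκ hL).ne'.isUnit, mul_one]
    refine ⟨⟨τ, hτ, ?_⟩, ?_, L, hL1, hL2⟩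
    · filter_upwards [hu, hg] with x hx hxg
      rw [hx, hxg.1, add_comm, mul_assoc, ← mul_assoc S₁.transpose, rotations_transpose_mul hS₁,
        one_mul, hGL]
    · filter_upwards [hg] with x hx
      rw [hx.1, hx.2]

/-- A component of one representation overlaps at most one component of the other one. -/
lemma overlap_unique (h₂ : Represents Ω κ p ε yε R₂ Q₂ M₂ t₂ y₂ u₂ P₂) (hε : ∀ n, 0 < ε n)
    {φ : ℕ → ℕ} (hφ : StrictMono φ) {s : ℕ → Vec d} {M : ℕ → Mat d} {j j' : ℕ}
    (hj : volume (P₂ j) ≠ 0) (hj' : volume (P₂ j') ≠ 0)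
    (hτ : ∃ τ, Tendsto (fun k => (ε (φ k))⁻¹ • (t₂ (φ k) j - s k)) atTop (𝓝 τ))
    (hτ' : ∃ τ, Tendsto (fun k => (ε (φ k))⁻¹ • (t₂ (φ k) j' - s k)) atTop (𝓝 τ))
    (hL : ∃ L, Tendsto M atTop (𝓝 L) ∧ Tendsto (fun n => M₂ n j) atTop (𝓝 L))
    (hL' : ∃ L, Tendsto M atTop (𝓝 L) ∧ Tendsto (fun n => M₂ n j') atTop (𝓝 L)) : j = j' := by
  by_contra hne
  obtain ⟨τ, hτ⟩ := hτ
  obtain ⟨τ', hτ'⟩ := hτ'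
  obtain ⟨L, hL1, hL2⟩ := hL
  obtain ⟨L', hL1', hL2'⟩ := hL'
  have hLL := tendsto_nhds_unique hL1 hL1'
  subst hLL
  have hsel := (h₂.selection j j' hne (pos_iff_ne_zero.2 hj) (pos_iff_ne_zero.2 hj')
    ⟨L, hL2, hL2'⟩).comp hφ.tendsto_atTop
  refine not_tendsto_nhds_of_tendsto_atTop hsel _ ((hτ.sub hτ').norm.congr fun k => ?_)
  rw [← smul_sub, sub_sub_sub_cancel_right, norm_smul, norm_inv, Real.norm_of_nonneg (hε _).le,
    Function.comp, div_eq_inv_mul]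

end Comparison

/-! ### Uniqueness of the limits -/

section Uniqueness

variable {d : ℕ} {Ω : Set (Vec d)} {P₁ P₂ : ℕ → Set (Vec d)}

lemma ae_mem_imp_of_ae_restrict {A : Set (Vec d)} (hA : MeasurableSet A) {q : Vec d → Prop}
    (h : volume A ≠ 0 → ∀ᵐ x ∂(volume.restrict A), q x) : ∀ᵐ x : Vec d, x ∈ A → q x := by
  by_cases h0 : volume A = 0
  · filter_upwards [measure_eq_zero_iff_ae_notMem.1 h0] with x hx hxA
    exact absurd hxA hx
  · exact (ae_restrict_iff' hA).1 (h h0)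

lemma exists_overlap (h₁ : IsCaccioppoliPartition Ω P₁) (h₂ : IsCaccioppoliPartition Ω P₂)
    {i : ℕ} (hi : volume (P₁ i) ≠ 0) : ∃ j, volume (P₁ i ∩ P₂ j) ≠ 0 := by
  by_contra! hcon
  refine hi (measure_mono_null ?_ (measure_union_null (measure_iUnion_null hcon) h₂.cover))
  intro x hx
  by_cases hx2 : x ∈ ⋃ j, P₂ j
  · obtain ⟨j, hj⟩ := mem_iUnion.1 hx2
    exact Or.inl (mem_iUnion.2 ⟨j, hx, hj⟩)
  · exact Or.inr ⟨h₁.subset i hx, hx2⟩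

lemma diff_null_of_overlap_unique (h₁ : IsCaccioppoliPartition Ω P₁)
    (h₂ : IsCaccioppoliPartition Ω P₂) {i j : ℕ}
    (huniq : ∀ j', volume (P₁ i ∩ P₂ j') ≠ 0 → j = j') : volume (P₁ i \ P₂ j) = 0 := by
  have hnull : volume (⋃ j' ∈ {j' | j ≠ j'}, P₁ i ∩ P₂ j') = 0 := by
    refine (measure_biUnion_null_iff (Set.to_countable _)).2 fun j' hj' => ?_
    by_contra h
    exact hj' (huniq j' h)
  refine measure_mono_null ?_ (measure_union_null hnull h₂.cover)
  intro x hx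
  by_cases hx2 : x ∈ ⋃ j, P₂ j
  · obtain ⟨j', hj'⟩ := mem_iUnion.1 hx2
    refine Or.inl (mem_biUnion (x := j') ?_ ⟨hx.1, hj'⟩)
    rintro rfl
    exact hx.2 hj'
  · exact Or.inr ⟨h₁.subset i hx.1, hx2⟩

/-- Two partitions such that each component overlaps at most one component of the other partition
agree up to a permutation. -/
lemma exists_perm_of_overlap_unique (h₁ : IsCaccioppoliPartition Ω P₁)
    (h₂ : IsCaccioppoliPartition Ω P₂)
    (ha : ∀ i j j', volume (P₁ i ∩ P₂ j) ≠ 0 → volume (P₁ i ∩ P₂ j') ≠ 0 → j = j')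
    (hb : ∀ i i' j, volume (P₁ i ∩ P₂ j) ≠ 0 → volume (P₁ i' ∩ P₂ j) ≠ 0 → i = i') :
    ∃ π : Equiv.Perm ℕ, ∀ j, P₁ j =ᵐ[volume] P₂ (π j) := by
  classical
  have hpos : ∀ {i j}, volume (P₁ i ∩ P₂ j) ≠ 0 → volume (P₁ i) ≠ 0 ∧ volume (P₂ j) ≠ 0 :=
    fun h => ⟨fun h0 => h (measure_mono_null inter_subset_left h0),
      fun h0 => h (measure_mono_null inter_subset_right h0)⟩
  have hf : ∀ i : {i | volume (P₁ i) ≠ 0}, ∃ j : {j | volume (P₂ j) ≠ 0},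
      volume (P₁ i ∩ P₂ j) ≠ 0 := by
    intro i
    obtain ⟨j, hj⟩ := exists_overlap h₁ h₂ i.2
    exact ⟨⟨j, (hpos hj).2⟩, hj⟩
  choose f hf using hf
  have hbij : Function.Bijective f := by
    refine ⟨fun i i' h => Subtype.ext (hb i i' (f i) (hf i) (by rw [h]; exact hf i')), fun j => ?_⟩
    obtain ⟨i, hi⟩ := exists_overlap h₂ h₁ j.2
    rw [inter_comm] at hi
    exact ⟨⟨i, (hpos hi).1⟩, Subtype.ext (ha i _ _ (hf ⟨i, (hpos hi).1⟩) hi)⟩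
  have hlow : ∀ {P : ℕ → Set (Vec d)}, IsCaccioppoliPartition Ω P →
      IsLowerSet {i | volume (P i) ≠ 0} := by
    intro P hP a b hba ha h0
    exact ha (le_antisymm ((hP.ordered hba).trans h0.le) zero_le)
  -- By the ordering the nonnull indices form initial segments, so they are the same on both sides
  -- and the bijection between them extends to a permutation of `ℕ` by the identity.
  have hset := lowerSet_eq_of_equiv (hlow h₁) (hlow h₂) (Equiv.ofBijective f hbij)
  set e : Equiv.Perm {i | volume (P₁ i) ≠ 0} :=
    (Equiv.ofBijective f hbij).trans (Equiv.setCongr hset.symm) with he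
  refine ⟨Equiv.Perm.ofSubtype e, fun j => ?_⟩
  by_cases hj : volume (P₁ j) ≠ 0
  · have h1 : Equiv.Perm.ofSubtype e j = f ⟨j, hj⟩ := by
      rw [Equiv.Perm.ofSubtype_apply_of_mem e hj]
      rfl
    rw [h1]
    have hov := hf ⟨j, hj⟩
    have hd1 := diff_null_of_overlap_unique h₁ h₂ fun j' hj' => ha j _ j' hov hj'
    have hd2 : volume (P₂ (f ⟨j, hj⟩) \ P₁ j) = 0 := diff_null_of_overlap_unique h₂ h₁
      fun i' hi' => hb j i' (f ⟨j, hj⟩) hov (by rwa [inter_comm] at hi')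
    exact ae_eq_set.2 ⟨hd1, hd2⟩
  · rw [Equiv.Perm.ofSubtype_apply_of_not_mem e hj]
    have hj2 : j ∉ {i | volume (P₂ i) ≠ 0} := by rwa [← hset]
    have h1 : P₁ j =ᵐ[volume] (∅ : Set (Vec d)) := ae_eq_empty.2 (not_not.1 hj)
    have h2 : P₂ j =ᵐ[volume] (∅ : Set (Vec d)) := ae_eq_empty.2 (not_not.1 hj2)
    exact h1.trans h2.symm

/-- The space of piecewise translations depends only on the gradient and on the unordered
partition. -/
lemma piecewiseTranslations_subset {y₁ y₂ : Vec d → Vec d}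
    (hg : ∀ᵐ x ∂(volume.restrict Ω), grad Ω y₁ x = grad Ω y₂ x) (π : Equiv.Perm ℕ)
    (hπ : ∀ j, P₁ j =ᵐ[volume] P₂ (π j)) :
    piecewiseTranslations Ω y₁ P₁ ⊆ piecewiseTranslations Ω y₂ P₂ := by
  rintro T ⟨t, S, hS, hT⟩
  refine ⟨fun j => t (π.symm j), S, hS, ?_⟩
  have hmem : ∀ᵐ x : Vec d, ∀ j, (x ∈ P₁ j ↔ x ∈ P₂ (π j)) :=
    ae_all_iff.2 fun j => (hπ j).mem_iff
  filter_upwards [hT, hg, ae_restrict_of_ae hmem] with x hx1 hx2 hx3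
  rw [hx1, hx2]
  congr 1
  refine Eq.trans (tsum_congr fun j => ?_)
    (π.tsum_eq fun j => (P₂ j).indicator (fun _ => t (π.symm j)) x)
  rw [π.symm_apply_apply]
  by_cases h : x ∈ P₁ j
  · rw [indicator_of_mem h, indicator_of_mem ((hx3 j).1 h)]
  · rw [indicator_of_notMem h, indicator_of_notMem fun h' => h ((hx3 j).2 h')]

lemma MemH1.aestronglyMeasurable {y : Vec d → Vec d} (hy : MemH1 Ω y) :
    AEStronglyMeasurable y (volume.restrict Ω) := by
  have h1 : ∀ k, AEMeasurable (fun x => y x k) (volume.restrict Ω) := fun k =>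
    (hy k).1.aestronglyMeasurable.aemeasurable
  have h2 : AEMeasurable (fun x => WithLp.ofLp (y x)) (volume.restrict Ω) :=
    aemeasurable_pi_iff.2 h1
  exact ((WithLp.measurable_toLp 2 _).comp_aemeasurable h2).aestronglyMeasurable

variable [NeZero d] {κ p : ℝ} {ε : ℕ → ℝ} {yε : ℕ → Vec d → Vec d} {y₁ u₁ y₂ u₂ : Vec d → Vec d}

/-- Both deformations are the limit of the normalized sequence `yε` in `L²`. -/
lemma AdmissibleTriple.def_unique (h₁ : AdmissibleTriple Ω κ p ε yε y₁ u₁ P₁)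
    (h₂ : AdmissibleTriple Ω κ p ε yε y₂ u₂ P₂) (hyε : ∀ n, MemH2 Ω (yε n)) :
    y₁ =ᵐ[volume.restrict Ω] y₂ := by
  obtain ⟨R₁, Q₁, M₁, t₁, h₁⟩ := h₁
  obtain ⟨R₂, Q₂, M₂, t₂, h₂⟩ := h₂
  obtain ⟨S₁, -, hL₁, -⟩ := h₁.rot_tendsto
  obtain ⟨S₂, -, hL₂, -⟩ := h₂.rot_tendsto
  have hm₁ := hL₁.1.aestronglyMeasurable
  have hm₂ := hL₂.1.aestronglyMeasurable
  have hmε : ∀ n, AEStronglyMeasurable (fun x => yε n x - ⨍ z in Ω, yε n z)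
      (volume.restrict Ω) := fun n => (hyε n).1.aestronglyMeasurable.sub aestronglyMeasurable_const
  have hsum : Tendsto (fun n => ∫⁻ x in Ω, (‖(yε n x - ⨍ z in Ω, yε n z) - y₁ x‖ₑ ^ 2 +
      ‖(yε n x - ⨍ z in Ω, yε n z) - y₂ x‖ₑ ^ 2)) atTop (𝓝 0) := by
    have hadd := h₁.def_tendsto.add h₂.def_tendsto
    rw [add_zero] at hadd
    refine tendsto_of_tendsto_of_tendsto_of_le_of_le tendsto_const_nhds hadd
      (fun _ => zero_le) fun n => ?_
    have hm : AEMeasurable (fun x => ‖(yε n x - ⨍ z in Ω, yε n z) - y₁ x‖ₑ ^ 2)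
        (volume.restrict Ω) := ((hmε n).sub hm₁).enorm.pow_const 2
    rw [lintegral_add_left' hm]
    exact add_le_add le_self_add le_self_add
  obtain ⟨φ, -, hae⟩ := exists_subseq_ae_tendsto_zero (fun n =>
    (((hmε n).sub hm₁).enorm.pow_const 2).add (((hmε n).sub hm₂).enorm.pow_const 2)) hsum
  filter_upwards [hae] with x hx
  have key : ∀ v : Vec d, (∀ n, ‖(yε n x - ⨍ z in Ω, yε n z) - v‖ₑ ^ 2 ≤
      ‖(yε n x - ⨍ z in Ω, yε n z) - y₁ x‖ₑ ^ 2 + ‖(yε n x - ⨍ z in Ω, yε n z) - y₂ x‖ₑ ^ 2) →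
      Tendsto (fun k => yε (φ k) x - ⨍ z in Ω, yε (φ k) z) atTop (𝓝 v) := by
    intro v hv
    have h1 : Tendsto (fun k => ‖(yε (φ k) x - ⨍ z in Ω, yε (φ k) z) - v‖ₑ ^ 2) atTop (𝓝 0) :=
      tendsto_of_tendsto_of_tendsto_of_le_of_le tendsto_const_nhds hx (fun _ => zero_le)
        fun k => hv (φ k)
    have h2 := (ENNReal.continuous_rpow_const (y := (1 / 2 : ℝ))).tendsto 0 |>.comp h1
    rw [ENNReal.zero_rpow_of_pos (by norm_num)] at h2
    rw [tendsto_iff_edist_tendsto_0]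
    refine h2.congr fun k => ?_
    rw [Function.comp, edist_eq_enorm_sub, ← ENNReal.rpow_natCast, ← ENNReal.rpow_mul]
    norm_num
  exact tendsto_nhds_unique (key _ fun n => le_self_add) (key _ fun n => le_add_self)

/-- Two admissible triples have the same deformation and the same partition, and their
displacements differ by a piecewise translation. -/
theorem AdmissibleTriple.unique (h₁ : AdmissibleTriple Ω κ p ε yε y₁ u₁ P₁)
    (h₂ : AdmissibleTriple Ω κ p ε yε y₂ u₂ P₂) (hyε : ∀ n, MemH2 Ω (yε n))
    (hΩ : MeasurableSet Ω) (hΩt : volume Ω ≠ ⊤) (hΩ0 : volume Ω ≠ 0) (hκ : 0 < κ)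
    (hε : ∀ n, 0 < ε n) (hε0 : Tendsto ε atTop (𝓝 0)) :
    (y₁ =ᵐ[volume.restrict Ω] y₂ ∧
      ∃ π : Equiv.Perm ℕ, ∀ j, P₁ j =ᵐ[volume] P₂ (π j)) ∧
    (piecewiseTranslations Ω y₁ P₁ = piecewiseTranslations Ω y₂ P₂ ∧
      ∃ T ∈ piecewiseTranslations Ω y₁ P₁, u₁ - u₂ =ᵐ[volume.restrict Ω] T) := by
  classical
  have hy := h₁.def_unique h₂ hyε
  obtain ⟨R₁, Q₁, M₁, t₁, h₁⟩ := h₁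
  obtain ⟨R₂, Q₂, M₂, t₂, h₂⟩ := h₂
  obtain ⟨φ, hφ, S, hS, hlim⟩ := exists_common_limits h₁ h₂ hΩ hΩt hΩ0 hκ hε hε0
  have hp₁ := h₁.limit_part.1
  have hp₂ := h₂.limit_part.1
  have ha : ∀ i j j', volume (P₁ i ∩ P₂ j) ≠ 0 → volume (P₁ i ∩ P₂ j') ≠ 0 → j = j' := by
    intro i j j' hj hj'
    obtain ⟨⟨τ, hτ, -⟩, -, hL⟩ := hlim i j hj
    obtain ⟨⟨τ', hτ', -⟩, -, hL'⟩ := hlim i j' hj'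
    exact overlap_unique h₂ hε hφ (fun h0 => hj (measure_mono_null inter_subset_right h0))
      (fun h0 => hj' (measure_mono_null inter_subset_right h0)) ⟨τ, hτ⟩ ⟨τ', hτ'⟩ hL hL'
  have hb : ∀ i i' j, volume (P₁ i ∩ P₂ j) ≠ 0 → volume (P₁ i' ∩ P₂ j) ≠ 0 → i = i' := by
    intro i i' j hi hi'
    obtain ⟨⟨τ, hτ, -⟩, -, L, hL1, hL2⟩ := hlim i j hi
    obtain ⟨⟨τ', hτ', -⟩, -, L', hL1', hL2'⟩ := hlim i' j hi'
    refine overlap_unique h₁ hε hφ (s := fun k => t₂ (φ k) j)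
      (fun h0 => hi (measure_mono_null inter_subset_left h0))
      (fun h0 => hi' (measure_mono_null inter_subset_left h0))
      ⟨-τ, hτ.neg.congr fun k => ?_⟩ ⟨-τ', hτ'.neg.congr fun k => ?_⟩ ⟨L, hL2, hL1⟩ ⟨L', hL2', hL1'⟩
    · rw [← smul_neg, neg_sub]
    · rw [← smul_neg, neg_sub]
  obtain ⟨π, hπ⟩ := exists_perm_of_overlap_unique hp₁ hp₂ ha hb
  have hm : ∀ i j, MeasurableSet (P₁ i ∩ P₂ j) := fun i j =>
    (hp₁.measurableSet i).inter (hp₂.measurableSet j)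
  have hmem : ∀ᵐ x : Vec d, ∀ j, (x ∈ P₁ j ↔ x ∈ P₂ (π j)) :=
    ae_all_iff.2 fun j => (hπ j).mem_iff
  have hg : ∀ᵐ x ∂(volume.restrict Ω), grad Ω y₁ x = grad Ω y₂ x := by
    have h1 : ∀ᵐ x : Vec d, ∀ i, x ∈ P₁ i ∩ P₂ (π i) → grad Ω y₁ x = grad Ω y₂ x :=
      ae_all_iff.2 fun i => ae_mem_imp_of_ae_restrict (hm _ _) fun h => (hlim i _ h).2.1
    filter_upwards [ae_restrict_of_ae h1, ae_restrict_of_ae hmem, hp₁.ae_exists_unique hΩ]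
      with x hx1 hx2 hx3
    obtain ⟨i, hi, -⟩ := hx3
    exact hx1 i ⟨hi, (hx2 i).1 hi⟩
  refine ⟨⟨hy, π, hπ⟩, Subset.antisymm (piecewiseTranslations_subset hg π hπ)
    (piecewiseTranslations_subset (hg.mono fun x hx => hx.symm) π.symm fun j => ?_), ?_⟩
  · have := (hπ (π.symm j)).symm
    rwa [π.apply_symm_apply] at this
  · have hτ : ∀ i, ∃ τ : Vec d, volume (P₁ i ∩ P₂ (π i)) ≠ 0 →
        ∀ᵐ x ∂(volume.restrict (P₁ i ∩ P₂ (π i))), u₁ x - u₂ x = τ + act (S * grad Ω y₁ x) x := by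
      intro i
      by_cases h : volume (P₁ i ∩ P₂ (π i)) ≠ 0
      · obtain ⟨⟨τ, -, hτ⟩, -⟩ := hlim i _ h
        exact ⟨τ, fun _ => hτ⟩
      · exact ⟨0, fun h' => absurd h' h⟩
    choose τ hτ using hτ
    refine ⟨fun x => (∑' j, (P₁ j).indicator (fun _ => τ j) x) + act (S * grad Ω y₁ x) x,
      ⟨τ, S, hS, EventuallyEq.rfl⟩, ?_⟩
    have h1 : ∀ᵐ x : Vec d, ∀ i, x ∈ P₁ i ∩ P₂ (π i) →
        u₁ x - u₂ x = τ i + act (S * grad Ω y₁ x) x :=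
      ae_all_iff.2 fun i => ae_mem_imp_of_ae_restrict (hm _ _) (hτ i)
    filter_upwards [ae_restrict_of_ae h1, ae_restrict_of_ae hmem, hp₁.ae_exists_unique hΩ]
      with x hx1 hx2 hx3
    obtain ⟨i, hi, hu⟩ := hx3
    rw [tsum_indicator_eq (fun j _ => τ j) hi hu, ← hx1 i ⟨hi, (hx2 i).1 hi⟩, Pi.sub_apply]

end Uniqueness

/-! ### Rotations with a prescribed infinitesimal generator -/

section Cayley

variable {d : ℕ} {S : Mat d}

lemma dotProduct_mulVec_skew (hS : S.transpose = -S) (v : Fin d → ℝ) :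
    dotProduct v (S.mulVec v) = 0 := by
  have h1 : dotProduct v (S.mulVec v) = dotProduct v (S.transpose.mulVec v) := by
    rw [Matrix.dotProduct_mulVec, Matrix.mulVec_transpose, dotProduct_comm]
  rw [hS, Matrix.neg_mulVec, dotProduct_neg] at h1
  linarith

lemma det_one_add_skew_ne_zero (hS : S.transpose = -S) (a : ℝ) : (1 + a • S).det ≠ 0 := by
  intro h
  obtain ⟨v, hv, hv0⟩ := Matrix.exists_mulVec_eq_zero_iff.2 h
  have h1 := congrArg (dotProduct v) hv0
  rw [Matrix.add_mulVec, Matrix.one_mulVec, Matrix.smul_mulVec, dotProduct_add, dotProduct_smul,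
    dotProduct_mulVec_skew hS, smul_zero, add_zero, dotProduct_zero] at h1
  exact hv (dotProduct_self_eq_zero.1 h1)

/-- The Cayley transform of a skew-symmetric matrix is a rotation. -/
lemma cayley_mem_rotations (hS : S.transpose = -S) (a : ℝ) :
    (1 - a • S) * (1 + a • S)⁻¹ ∈ rotations d := by
  have hp : IsUnit (1 + a • S).det := (det_one_add_skew_ne_zero hS a).isUnit
  have hT : (1 + a • S).transpose = 1 - a • S := by
    rw [Matrix.transpose_add, Matrix.transpose_smul, hS, Matrix.transpose_one, smul_neg,
      sub_eq_add_neg]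
  have hT' : (1 - a • S).transpose = 1 + a • S := by
    rw [← hT, Matrix.transpose_transpose]
  have hdet : (1 - a • S).det = (1 + a • S).det := by rw [← hT, Matrix.det_transpose]
  have hm : IsUnit (1 - a • S).det := by rw [hdet]; exact hp
  have hcomm : (1 + a • S) * (1 - a • S) = (1 - a • S) * (1 + a • S) := by
    simp only [mul_add, add_mul, mul_sub, sub_mul, one_mul, mul_one]
    abel
  refine mem_rotations ?_ ?_
  · rw [Matrix.transpose_mul, Matrix.transpose_nonsing_inv, hT, hT', mul_assoc,
      ← mul_assoc (1 + a • S)⁻¹, ← Matrix.mul_inv_rev, ← hcomm, Matrix.mul_inv_rev, mul_assoc,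
      Matrix.nonsing_inv_mul _ hp, mul_one, Matrix.mul_nonsing_inv _ hm]
  · rw [Matrix.det_mul, Matrix.det_nonsing_inv, hdet, Ring.mul_inverse_cancel _ hp]

/-- For each skew-symmetric matrix `S` there are rotations `1 - ε N` with `N → S` as `ε → 0`. -/
lemma exists_rotation_expansion (hS : S.transpose = -S) {ε : ℕ → ℝ}
    (hε0 : Tendsto ε atTop (𝓝 0)) :
    ∃ N : ℕ → Mat d, Tendsto N atTop (𝓝 S) ∧ ∀ n, 1 - ε n • N n ∈ rotations d := by
  refine ⟨fun n => S * (1 + (ε n / 2) • S)⁻¹, ?_, fun n => ?_⟩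
  · have h1 : Tendsto (fun n => 1 + (ε n / 2) • S) atTop (𝓝 1) := by
      have h := (tendsto_const_nhds (x := (1 : Mat d))).add
        ((hε0.div_const 2).smul (tendsto_const_nhds (x := S)))
      simpa using h
    have hdet : Tendsto (fun n => (1 + (ε n / 2) • S).det) atTop (𝓝 1) := by
      have h := ((continuous_id.matrix_det).tendsto (1 : Mat d)).comp h1
      simpa [Function.comp_def] using h
    have hadj : Tendsto (fun n => (1 + (ε n / 2) • S).adjugate) atTop (𝓝 1) := by
      have h := ((continuous_id.matrix_adjugate).tendsto (1 : Mat d)).comp h1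
      simpa [Function.comp_def] using h
    have hinv : Tendsto (fun n => (1 + (ε n / 2) • S)⁻¹) atTop (𝓝 1) := by
      have h := (hdet.inv₀ one_ne_zero).smul hadj
      simp only [inv_one, one_smul] at h
      refine h.congr fun n => ?_
      rw [Matrix.inv_def, Ring.inverse_eq_inv']
    have h := hinv.const_mul S
    rwa [mul_one] at h
  · have hp : IsUnit (1 + (ε n / 2) • S).det := (det_one_add_skew_ne_zero hS _).isUnit
    have : 1 - ε n • (S * (1 + (ε n / 2) • S)⁻¹) =
        (1 - (ε n / 2) • S) * (1 + (ε n / 2) • S)⁻¹ := by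
      have h1 : (1 : Mat d) = (1 + (ε n / 2) • S) * (1 + (ε n / 2) • S)⁻¹ :=
        (Matrix.mul_nonsing_inv _ hp).symm
      calc 1 - ε n • (S * (1 + (ε n / 2) • S)⁻¹)
          = (1 + (ε n / 2) • S) * (1 + (ε n / 2) • S)⁻¹ -
            ε n • (S * (1 + (ε n / 2) • S)⁻¹) := by rw [← h1]
        _ = ((1 + (ε n / 2) • S) - ε n • S) * (1 + (ε n / 2) • S)⁻¹ := by
            rw [sub_mul, smul_mul_assoc]
        _ = _ := by
            congr 1
            rw [add_sub_assoc, ← sub_smul, show ε n / 2 - ε n = -(ε n / 2) by ring, neg_smul,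
              sub_eq_add_neg]
    rw [this]
    exact cayley_mem_rotations hS _

lemma rotations_mul {R Q : Mat d} (hR : R ∈ rotations d) (hQ : Q ∈ rotations d) :
    R * Q ∈ rotations d :=
  (Matrix.specialOrthogonalGroup (Fin d) ℝ).mul_mem hR hQ

end Cayley

/-! ### Approximate differentiability and the Frobenius norm -/

section ApproxGrad

variable {d : ℕ}

/-- At a point of density of a set on which two maps differ by an affine map, the approximate
differentials differ by its linear part. -/
lemma HasApproxGradAt.add_affine {w w' : Vec d → Vec d} {L F : Mat d} {b x : Vec d} {E : Set (Vec d)}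
    (hw : HasApproxGradAt w L x) (hx : x ∈ E) (hE : ∀ z ∈ E, w' z = w z + (act F z + b))
    (hdens : Tendsto (fun r => volume (Eᶜ ∩ Metric.ball x r) / volume (Metric.ball x r))
      (𝓝[>] (0 : ℝ)) (𝓝 0)) : HasApproxGradAt w' (L + F) x := by
  intro δ hδ
  have hsum := (hw δ hδ).add hdens
  rw [add_zero] at hsum
  refine tendsto_of_tendsto_of_tendsto_of_le_of_le tendsto_const_nhds hsum (fun _ => zero_le)
    fun r => ?_
  rw [← ENNReal.add_div]
  refine ENNReal.div_le_div_right (le_trans (measure_mono ?_) (measure_union_le _ _)) _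
  rintro z ⟨hz, hzb⟩
  by_cases hzE : z ∈ E
  · refine Or.inl ⟨?_, hzb⟩
    change δ * ‖z - x‖ < ‖w z - w x - act L (z - x)‖
    have hz' : δ * ‖z - x‖ < ‖w' z - w' x - act (L + F) (z - x)‖ := hz
    rw [hE z hzE, hE x hx, act_add, act_vec_sub F] at hz'
    convert hz' using 2
    abel
  · exact Or.inr ⟨hzE, hzb⟩

lemma ae_tendsto_density_compl {E : Set (Vec d)} (hE : MeasurableSet E) :
    ∀ᵐ x : Vec d, x ∈ E → Tendsto (fun r => volume (Eᶜ ∩ Metric.ball x r) /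
      volume (Metric.ball x r)) (𝓝[>] (0 : ℝ)) (𝓝 0) := by
  filter_upwards [Besicovitch.ae_tendsto_measure_inter_div_of_measurableSet volume hE.compl]
    with x hx hxE
  rw [indicator_of_notMem (by simpa using hxE)] at hx
  refine tendsto_of_tendsto_of_tendsto_of_le_of_le' tendsto_const_nhds hx
    (Eventually.of_forall fun _ => zero_le) ?_
  filter_upwards [self_mem_nhdsWithin] with r hr
  have hvol : volume (Metric.closedBall x r) = volume (Metric.ball x r) := by
    rw [Measure.addHaar_closedBall volume x (le_of_lt hr), Measure.addHaar_ball_of_pos volume x hr]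
  rw [hvol]
  gcongr
  exact Metric.ball_subset_closedBall

lemma frobSq_nonneg (F : Mat d) : 0 ≤ frobSq F :=
  Finset.sum_nonneg fun _ _ => Finset.sum_nonneg fun _ _ => sq_nonneg _

lemma sq_entry_le_frobSq (F : Mat d) (k i : Fin d) : F k i ^ 2 ≤ frobSq F :=
  (Finset.single_le_sum (f := fun i => F k i ^ 2) (fun _ _ => sq_nonneg _)
    (Finset.mem_univ i)).trans (Finset.single_le_sum (f := fun k => ∑ i, F k i ^ 2)
      (fun _ _ => Finset.sum_nonneg fun _ _ => sq_nonneg _) (Finset.mem_univ k))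

lemma frobSq_add_le (F G : Mat d) : frobSq (F + G) ≤ 2 * frobSq F + 2 * frobSq G := by
  simp only [frobSq, Finset.mul_sum, ← Finset.sum_add_distrib]
  refine Finset.sum_le_sum fun k _ => Finset.sum_le_sum fun i _ => ?_
  rw [Matrix.add_apply]
  nlinarith [sq_nonneg (F k i - G k i)]

lemma frobSq_smul (c : ℝ) (F : Mat d) : frobSq (c • F) = c ^ 2 * frobSq F := by
  simp only [frobSq, Finset.mul_sum, Matrix.smul_apply, smul_eq_mul, mul_pow]

lemma continuous_frobSq : Continuous (frobSq : Mat d → ℝ) :=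
  continuous_finsetSum _ fun k _ => continuous_finsetSum _ fun i _ =>
    (continuous_id.matrix_elem k i).pow 2

end ApproxGrad

/-! ### Perturbation of a representation by a piecewise translation -/

section Perturbation

variable {d : ℕ}

/-- A junk value does not interfere: multiplication by a rotation is invertible, so the sums on the
two sides are summable at the same points. -/
lemma phaseField_mul {Q R : Mat d} (hQ : Q ∈ rotations d) (P : ℕ → Set (Vec d)) (M : ℕ → Mat d)
    (x : Vec d) : phaseField (Q * R) P M x = Q * phaseField R P M x := by
  have hterm : ∀ j, (P j).indicator (fun _ => Q * R * M j) x =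
      Q * (P j).indicator (fun _ => R * M j) x := by
    intro j
    by_cases hx : x ∈ P j <;> simp [hx, mul_assoc]
  unfold phaseField
  simp_rw [hterm]
  by_cases hs : Summable fun j => (P j).indicator (fun _ => R * M j) x
  · exact hs.tsum_mul_left Q
  · have hs' : ¬ Summable fun j => Q * (P j).indicator (fun _ => R * M j) x := by
      intro h
      refine hs ((h.mul_left Q.transpose).congr fun j => ?_)
      rw [← mul_assoc, rotations_transpose_mul hQ, one_mul]
    rw [tsum_eq_zero_of_not_summable hs, tsum_eq_zero_of_not_summable hs', mul_zero]

/-- The effect of the perturbed rotation `(1 - ε N) R` and of the perturbed translations `t j - ε τ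
j` on the rescaled displacement. -/
lemma rescaledDisp_perturb {ε : ℝ} (hε : ε ≠ 0) (y : Vec d → Vec d) (R N : Mat d)
    {P : ℕ → Set (Vec d)} (M : ℕ → Mat d) (t τ : ℕ → Vec d) {x : Vec d} {j : ℕ} (hj : x ∈ P j)
    (huniq : ∀ i, x ∈ P i → i = j) :
    rescaledDisp ε y ((1 - ε • N) * R) P M (fun j => t j - ε • τ j) x =
      rescaledDisp ε y R P M t x + (act (N * (R * M j)) x + τ j) := by
  rw [rescaledDisp_eq hj huniq, rescaledDisp_eq hj huniq, sub_mul, one_mul, sub_mul,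
    smul_mul_assoc, smul_mul_assoc, act_sub, act_smul, mul_assoc N R]
  have h1 : act (N * (R * M j)) x + τ j = ε⁻¹ • (ε • (act (N * (R * M j)) x + τ j)) := by
    rw [smul_smul, inv_mul_cancel₀ hε, one_smul]
  rw [h1, ← smul_add]
  congr 1
  module

lemma measurable_tsum_affine {P : ℕ → Set (Vec d)} (hP : ∀ j, MeasurableSet (P j)) (F : ℕ → Mat d)
    (t : ℕ → Vec d) : Measurable fun x => ∑' j, (P j).indicator (fun z => act (F j) z + t j) x := by
  refine Measurable.tsum fun j => Measurable.indicator ?_ (hP j)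
  have h1 : Continuous fun z : Vec d => act (F j) z :=
    continuous_act.comp (continuous_const.prodMk continuous_id)
  exact (h1.add continuous_const).measurable

variable [NeZero d] {Ω : Set (Vec d)} {P : ℕ → Set (Vec d)} {κ p : ℝ} {ε : ℕ → ℝ}
  {yε : ℕ → Vec d → Vec d} {Rε : ℕ → Mat d} {Pε : ℕ → ℕ → Set (Vec d)} {Mε : ℕ → ℕ → Mat d}
  {tε : ℕ → ℕ → Vec d} {y u : Vec d → Vec d}

/-- A uniform bound for the products of a convergent sequence of matrices with the two wells. -/
lemma exists_frobSq_bound {K : ℕ → Mat d} {K₀ : Mat d} (hK : Tendsto K atTop (𝓝 K₀)) (κ : ℝ) :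
    ∃ C : ℝ, 0 ≤ C ∧ ∀ n, ∀ M ∈ wells d κ, frobSq (K n * M) ≤ C := by
  have key : ∀ M : Mat d, ∃ C : ℝ, ∀ n, frobSq (K n * M) ≤ C := by
    intro M
    have h : Tendsto (fun n => frobSq (K n * M)) atTop (𝓝 (frobSq (K₀ * M))) := by
      have h1 := (continuous_frobSq.tendsto (K₀ * M)).comp (hK.mul_const M)
      exact h1
    obtain ⟨C, hC⟩ := h.bddAbove_range
    exact ⟨C, fun n => hC ⟨n, rfl⟩⟩
  obtain ⟨C₁, h₁⟩ := key 1
  obtain ⟨C₂, h₂⟩ := key (wellB d κ)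
  refine ⟨max C₁ C₂, le_max_of_le_left ((frobSq_nonneg _).trans (h₁ 0)), fun n M hM => ?_⟩
  rcases hM with rfl | rfl
  · exact (h₁ n).trans (le_max_left _ _)
  · exact (h₂ n).trans (le_max_right _ _)

variable {N : ℕ → Mat d} {S : Mat d}

/-- The perturbed rotations still satisfy the rigidity estimate. -/
lemma Represents.rigidity_perturb (h : Represents Ω κ p ε yε Rε Pε Mε tε y u P)
    (hΩ : MeasurableSet Ω) (hε : ∀ n, 0 < ε n) (hN : Tendsto N atTop (𝓝 S))
    (hrot : ∀ n, 1 - ε n • N n ∈ rotations d) {O : Set (Vec d)} (hO : CompactlyIn O Ω) :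
    ∃ C : ℝ≥0, ∀ n, (∫⁻ x in O, ENNReal.ofReal (frobSq (grad Ω (yε n) x -
      phaseField ((1 - ε n • N n) * Rε n) (Pε n) (Mε n) x))) ^ (1 / 2 : ℝ) ≤
      C * ENNReal.ofReal (ε n) := by
  obtain ⟨C₁, hC₁⟩ := h.rigidity O hO
  obtain ⟨R, -, -, hR⟩ := h.rot_tendsto
  obtain ⟨C, hC0, hC⟩ := exists_frobSq_bound (hN.mul hR) κ
  have hOΩ : O ⊆ Ω := subset_closure.trans hO.2.2
  have hOt : volume O ≠ ⊤ := ((measure_mono subset_closure).trans_lt hO.2.1.measure_lt_top).ne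
  set V := ENNReal.ofReal (2 * C) * volume O with hV
  have hVt : V ≠ ⊤ := ENNReal.mul_ne_top ENNReal.ofReal_ne_top hOt
  set K : ℝ≥0∞ := 2 ^ (1 / 2 : ℝ) * C₁ + V ^ (1 / 2 : ℝ) with hK
  have hKt : K ≠ ⊤ := ENNReal.add_ne_top.2 ⟨ENNReal.mul_ne_top
    (ENNReal.rpow_ne_top_of_nonneg (by norm_num) (by simp)) ENNReal.coe_ne_top,
    ENNReal.rpow_ne_top_of_nonneg (by norm_num) hVt⟩
  refine ⟨K.toNNReal, fun n => ?_⟩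
  rw [ENNReal.coe_toNNReal hKt]
  set I := ∫⁻ x in O, ENNReal.ofReal
    (frobSq (grad Ω (yε n) x - phaseField (Rε n) (Pε n) (Mε n) x)) with hI
  have hle : ∫⁻ x in O, ENNReal.ofReal (frobSq (grad Ω (yε n) x -
      phaseField ((1 - ε n • N n) * Rε n) (Pε n) (Mε n) x)) ≤
      2 * I + V * ENNReal.ofReal (ε n) ^ 2 := by
    calc _ ≤ ∫⁻ x in O, (2 * ENNReal.ofReal (frobSq (grad Ω (yε n) x -
          phaseField (Rε n) (Pε n) (Mε n) x)) + ENNReal.ofReal (2 * C) * ENNReal.ofReal (ε n) ^ 2) := by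
          refine lintegral_mono_ae ?_
          filter_upwards [ae_restrict_of_ae_restrict_of_subset hOΩ
            ((h.part n).ae_exists_unique hΩ)] with x hx
          obtain ⟨j, hj, hu⟩ := hx
          rw [phaseField_mul (hrot n), sub_mul, one_mul, smul_mul_assoc, ← sub_add]
          refine (ENNReal.ofReal_le_ofReal (frobSq_add_le _ _)).trans ?_
          have hb : frobSq (N n * phaseField (Rε n) (Pε n) (Mε n) x) ≤ C := by
            rw [phaseField_eq hj hu, ← mul_assoc]
            exact hC n _ (h.phase n j)
          have h0 := frobSq_nonneg (grad Ω (yε n) x - phaseField (Rε n) (Pε n) (Mε n) x)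
          have h2 : 2 * frobSq (ε n • (N n * phaseField (Rε n) (Pε n) (Mε n) x)) ≤
              2 * C * ε n ^ 2 := by
            rw [frobSq_smul]
            nlinarith [sq_nonneg (ε n)]
          calc _ ≤ ENNReal.ofReal (2 * frobSq (grad Ω (yε n) x -
                phaseField (Rε n) (Pε n) (Mε n) x) + 2 * C * ε n ^ 2) :=
                ENNReal.ofReal_le_ofReal (by linarith)
            _ = _ := by
                rw [ENNReal.ofReal_add (by positivity) (by positivity),
                  ENNReal.ofReal_mul zero_le_two, ENNReal.ofReal_mul (by positivity),
                  ENNReal.ofReal_pow (hε n).le, ENNReal.ofReal_ofNat]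
      _ = 2 * I + V * ENNReal.ofReal (ε n) ^ 2 := by
          rw [lintegral_add_right _ measurable_const, lintegral_const_mul' _ _ (by simp),
            setLIntegral_const, hV]
          ring
  calc _ ≤ (2 * I + V * ENNReal.ofReal (ε n) ^ 2) ^ (1 / 2 : ℝ) :=
        ENNReal.rpow_le_rpow hle (by norm_num)
    _ ≤ (2 * I) ^ (1 / 2 : ℝ) + (V * ENNReal.ofReal (ε n) ^ 2) ^ (1 / 2 : ℝ) :=
        ENNReal.rpow_add_le_add_rpow _ _ (by norm_num) (by norm_num)
    _ = 2 ^ (1 / 2 : ℝ) * I ^ (1 / 2 : ℝ) + V ^ (1 / 2 : ℝ) * ENNReal.ofReal (ε n) := by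
        rw [ENNReal.mul_rpow_of_nonneg _ _ (by norm_num), ENNReal.mul_rpow_of_nonneg _ _ (by norm_num),
          ← ENNReal.rpow_natCast, ← ENNReal.rpow_mul]
        norm_num
    _ ≤ 2 ^ (1 / 2 : ℝ) * (C₁ * ENNReal.ofReal (ε n)) + V ^ (1 / 2 : ℝ) * ENNReal.ofReal (ε n) := by
        gcongr
        exact hC₁ n
    _ = K * ENNReal.ofReal (ε n) := by rw [hK]; ring

/-- The perturbed displacements converge in measure. -/
lemma Represents.disp_perturb (h : Represents Ω κ p ε yε Rε Pε Mε tε y u P)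
    (hΩ : MeasurableSet Ω) (hΩt : volume Ω ≠ ⊤) (hε : ∀ n, 0 < ε n) (hyε : ∀ n, MemH2 Ω (yε n))
    (hN : Tendsto N atTop (𝓝 S)) {τ : ℕ → Vec d} {T : Vec d → Vec d}
    (hT : T =ᵐ[volume.restrict Ω] fun x =>
      (∑' j, (P j).indicator (fun _ => τ j) x) + act (S * grad Ω y x) x) :
    TendstoInMeasure (volume.restrict Ω) (fun n => rescaledDisp (ε n) (yε n)
      ((1 - ε n • N n) * Rε n) (Pε n) (Mε n) (fun j => tε n j - ε n • τ j)) atTop (u + T) := by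
  have hfin : IsFiniteMeasure (volume.restrict Ω) := ⟨by
    rw [Measure.restrict_apply_univ]; exact hΩt.lt_top⟩
  refine (exists_seq_tendstoInMeasure_atTop_iff fun n => ?_).2 fun ns hns => ?_
  · have hm := (measurable_tsum_affine (h.part n).measurableSet
      (fun j => (1 - ε n • N n) * Rε n * Mε n j) fun j => tε n j - ε n • τ j).aestronglyMeasurable
      (μ := volume.restrict Ω)
    have hm2 := ((hyε n).1.aestronglyMeasurable.sub hm).const_smul (ε n)⁻¹
    exact hm2
  · obtain ⟨φ, hφ, hae⟩ := h.exists_subseq hΩt hns.tendsto_atTop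
    refine ⟨φ, hφ, ?_⟩
    filter_upwards [hae, hT, ae_all_iff.2 fun n => (h.part n).ae_exists_unique hΩ,
      h.limit_part.1.ae_exists_unique hΩ] with x hx hTx hu hux
    obtain ⟨j, hj, hju⟩ := hux
    have hNn : Tendsto (fun k => N (ns (φ k))) atTop (𝓝 S) :=
      hN.comp (hns.tendsto_atTop.comp hφ.tendsto_atTop)
    have hlim := hx.2.2.add ((tendsto_act (hNn.mul hx.2.1) (tendsto_const_nhds (x := x))).add_const
      (τ j))
    have hval : (u + T) x = u x + (act (S * grad Ω y x) x + τ j) := by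
      rw [Pi.add_apply, hTx, tsum_indicator_eq (fun j _ => τ j) hj hju, add_comm (τ j)]
    rw [hval]
    refine hlim.congr' ?_
    filter_upwards [hx.1 j] with k hk
    have hjk := hk.2 hj
    have huk : ∀ i, x ∈ Pε (ns (φ k)) i → i = j := by
      intro i hi
      obtain ⟨l, -, hl⟩ := hu (ns (φ k))
      rw [hl i hi, hl j hjk]
    rw [rescaledDisp_perturb (hε _).ne' _ _ _ _ _ _ hjk huk, phaseField_eq hjk huk]

/-- The approximate gradients of the perturbed displacements. -/
lemma Represents.approxGrad_perturb (h : Represents Ω κ p ε yε Rε Pε Mε tε y u P)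
    (hΩ : MeasurableSet Ω) (hε : ∀ n, 0 < ε n) (τ : ℕ → Vec d) {gε : ℕ → Vec d → Mat d} (n : ℕ)
    (hg : ∀ᵐ x ∂(volume.restrict Ω), HasApproxGradAt
      (rescaledDisp (ε n) (yε n) (Rε n) (Pε n) (Mε n) (tε n)) (gε n x) x) :
    ∀ᵐ x ∂(volume.restrict Ω), HasApproxGradAt (rescaledDisp (ε n) (yε n)
      ((1 - ε n • N n) * Rε n) (Pε n) (Mε n) (fun j => tε n j - ε n • τ j))
      (gε n x + N n * phaseField (Rε n) (Pε n) (Mε n) x) x := by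
  -- The components are disjoint up to null sets only; on `E j`, the part of `Pε n j` in no other
  -- component, the two displacements differ by one affine map.
  set E : ℕ → Set (Vec d) := fun j => Pε n j \ ⋃ i ∈ {i | i ≠ j}, Pε n i with hE
  have hEm : ∀ j, MeasurableSet (E j) := fun j => MeasurableSet.diff ((h.part n).measurableSet j)
    (MeasurableSet.biUnion (Set.to_countable _) fun i _ => (h.part n).measurableSet i)
  have hEu : ∀ j, ∀ x ∈ E j, x ∈ Pε n j ∧ ∀ i, x ∈ Pε n i → i = j := by
    intro j x hx
    refine ⟨hx.1, fun i hi => ?_⟩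
    by_contra hij
    exact hx.2 (mem_biUnion (x := i) hij hi)
  filter_upwards [hg, (h.part n).ae_exists_unique hΩ,
    ae_restrict_of_ae (ae_all_iff.2 fun j => ae_tendsto_density_compl (hEm j))] with x hx hu hd
  obtain ⟨j, hj, hju⟩ := hu
  have hxE : x ∈ E j := by
    refine ⟨hj, fun hcon => ?_⟩
    obtain ⟨i, hij, hi⟩ := mem_iUnion₂.1 hcon
    exact hij (hju i hi)
  rw [phaseField_eq hj hju]
  refine hx.add_affine (b := τ j) hxE (fun z hz => ?_) (hd j hxE)
  exact rescaledDisp_perturb (hε n).ne' _ _ _ _ _ _ (hEu j z hz).1 (hEu j z hz).2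

/-- Weak convergence of the perturbed approximate gradients. -/
lemma Represents.weakGrad_perturb (h : Represents Ω κ p ε yε Rε Pε Mε tε y u P)
    (hΩ : MeasurableSet Ω) (hΩt : volume Ω ≠ ⊤) (hN : Tendsto N atTop (𝓝 S))
    {gε : ℕ → Vec d → Mat d} {g : Vec d → Mat d} (hg : TendstoWeakL2Loc Ω gε g) :
    TendstoWeakL2Loc Ω (fun n x => gε n x + N n * phaseField (Rε n) (Pε n) (Mε n) x)
      (fun x => g x + S * grad Ω y x) := by
  intro O hO k i
  obtain ⟨hg1, hg2, hg3⟩ := hg O hO k i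
  obtain ⟨R, -, -, hR⟩ := h.rot_tendsto
  obtain ⟨C, hC0, hC⟩ := exists_frobSq_bound (hN.mul hR) κ
  have hOΩ : O ⊆ Ω := subset_closure.trans hO.2.2
  have hOt : volume O ≠ ⊤ := ((measure_mono subset_closure).trans_lt hO.2.1.measure_lt_top).ne
  have hfin : IsFiniteMeasure (volume.restrict O) := ⟨by
    rw [Measure.restrict_apply_univ]; exact hOt.lt_top⟩
  set H : ℕ → Vec d → ℝ := fun n x => (N n * phaseField (Rε n) (Pε n) (Mε n) x) k i with hH
  set H₀ : Vec d → ℝ := fun x => (S * grad Ω y x) k i with hH₀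
  have hHm : ∀ n, AEStronglyMeasurable (H n) (volume.restrict O) := fun n => by
    have hm : ∀ l, AEStronglyMeasurable (fun x => phaseField (Rε n) (Pε n) (Mε n) x l i)
        (volume.restrict O) := fun l =>
      (((h.phase_tendsto l i).1 n).1.mono_set hOΩ).aestronglyMeasurable
    have heq : H n = fun x => ∑ l, N n k l * phaseField (Rε n) (Pε n) (Mε n) x l i := by
      funext x
      simp only [hH, Matrix.mul_apply]
    rw [heq]
    exact Finset.aestronglyMeasurable_fun_sum _ fun l _ => (hm l).const_mul _
  have hHb : ∀ n, ∀ᵐ x ∂(volume.restrict O), ‖H n x‖ ≤ Real.sqrt C := by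
    intro n
    filter_upwards [ae_restrict_of_ae_restrict_of_subset hOΩ ((h.part n).ae_exists_unique hΩ)]
      with x hx
    obtain ⟨j, hj, hu⟩ := hx
    refine Real.abs_le_sqrt ((sq_entry_le_frobSq
      (N n * phaseField (Rε n) (Pε n) (Mε n) x) k i).trans ?_)
    rw [phaseField_eq hj hu, ← mul_assoc]
    exact hC n _ (h.phase n j)
  have hsub : ∀ ns : ℕ → ℕ, Tendsto ns atTop atTop → ∃ φ : ℕ → ℕ, StrictMono φ ∧
      ∀ᵐ x ∂(volume.restrict O), Tendsto (fun m => H (ns (φ m)) x) atTop (𝓝 (H₀ x)) := by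
    intro ns hns
    obtain ⟨φ, hφ, hae⟩ := h.exists_subseq hΩt hns
    refine ⟨φ, hφ, ?_⟩
    filter_upwards [ae_restrict_of_ae_restrict_of_subset hOΩ hae] with x hx
    have hNn : Tendsto (fun m => N (ns (φ m))) atTop (𝓝 S) :=
      hN.comp (hns.comp hφ.tendsto_atTop)
    exact ((hNn.mul hx.2.1).apply_nhds k).apply_nhds i
  obtain ⟨φ₀, hφ₀, hae₀⟩ := hsub id tendsto_id
  have hH₀m : AEStronglyMeasurable H₀ (volume.restrict O) :=
    aestronglyMeasurable_of_tendsto_ae atTop (fun m => hHm _) hae₀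
  have hH₀b : ∀ᵐ x ∂(volume.restrict O), ‖H₀ x‖ ≤ Real.sqrt C := by
    filter_upwards [hae₀, ae_all_iff.2 hHb] with x hx hb
    exact le_of_tendsto' hx.norm fun m => hb _
  have hHL : ∀ n, MemLp (H n) 2 (volume.restrict O) := fun n =>
    MemLp.of_bound (hHm n) _ (hHb n)
  have hH₀L : MemLp H₀ 2 (volume.restrict O) := MemLp.of_bound hH₀m _ hH₀b
  refine ⟨fun n => (hg1 n).add (hHL n), hg2.add hH₀L, fun ψ hψ => ?_⟩
  have hlim : Tendsto (fun n => ∫ x in O, H n x * ψ x) atTop (𝓝 (∫ x in O, H₀ x * ψ x)) := by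
    refine tendsto_of_subseq_tendsto fun ns hns => ?_
    obtain ⟨φ, hφ, hae⟩ := hsub ns hns
    refine ⟨φ, tendsto_integral_of_dominated_convergence (fun x => Real.sqrt C * ‖ψ x‖)
      (fun m => (hHm _).mul hψ.aestronglyMeasurable)
      ((hψ.integrable one_le_two).norm.const_mul _) (fun m => ?_) ?_⟩
    · filter_upwards [hHb (ns (φ m))] with x hx
      rw [norm_mul]
      gcongr
    · filter_upwards [hae] with x hx
      exact hx.mul_const _
  have hadd := (hg3 ψ hψ).add hlim
  have hi : ∀ {f : Vec d → ℝ}, MemLp f 2 (volume.restrict O) →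
      Integrable (fun x => f x * ψ x) (volume.restrict O) := fun hf => hf.integrable_mul hψ
  rw [← integral_add (hi hg2) (hi hH₀L)] at hadd
  have h1 : ∫ x in O, (g x + S * grad Ω y x) k i * ψ x =
      ∫ x in O, (g x k i * ψ x + H₀ x * ψ x) := by
    refine integral_congr_ae (Eventually.of_forall fun x => ?_)
    simp only [hH₀, Matrix.add_apply, add_mul]
  rw [h1]
  refine hadd.congr fun n => ?_
  rw [← integral_add (hi (hg1 n)) (hi (hHL n))]
  refine integral_congr_ae (Eventually.of_forall fun x => ?_)
  simp only [hH, Matrix.add_apply, add_mul]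

/-- A piecewise translation can be added to the displacement of a representation, provided that
this does not leave the class of limiting displacements. -/
theorem Represents.perturb (h : Represents Ω κ p ε yε Rε Pε Mε tε y u P)
    (hΩ : IsOpen Ω) (hΩb : Bornology.IsBounded Ω) (hε : ∀ n, 0 < ε n)
    (hε0 : Tendsto ε atTop (𝓝 0)) (hyε : ∀ n, MemH2 Ω (yε n)) (hN : Tendsto N atTop (𝓝 S))
    (hrot : ∀ n, 1 - ε n • N n ∈ rotations d) {τ : ℕ → Vec d} {T : Vec d → Vec d}
    (hT : T =ᵐ[volume.restrict Ω] fun x =>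
      (∑' j, (P j).indicator (fun _ => τ j) x) + act (S * grad Ω y x) x)
    (hSBV : ∀ g, LimitDisplacement Ω u g →
      LimitDisplacement Ω (u + T) (fun x => g x + S * grad Ω y x)) :
    Represents Ω κ p ε yε (fun n => (1 - ε n • N n) * Rε n) Pε Mε
      (fun n j => tε n j - ε n • τ j) y (u + T) P where
  rot n := rotations_mul (hrot n) (h.rot n)
  part := h.part
  phase := h.phase
  surface := h.surface
  layer := h.layer
  rigidity O hO := h.rigidity_perturb hΩ.measurableSet hε hN hrot hO
  rot_tendsto := by
    obtain ⟨R, hR, hL, hRt⟩ := h.rot_tendsto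
    refine ⟨R, hR, hL, ?_⟩
    have h1 := (((hε0.smul hN).const_sub 1).mul hRt)
    simpa using h1
  limit_part := h.limit_part
  part_tendsto := h.part_tendsto
  def_tendsto := h.def_tendsto
  phase_tendsto k i := by
    have hq : ∀ l, Tendsto (fun n => (1 - ε n • N n) k l) atTop (𝓝 ((1 : Mat d) k l)) := by
      intro l
      have h1 := (hε0.smul hN).const_sub 1
      rw [zero_smul, sub_zero] at h1
      exact (h1.apply_nhds k).apply_nhds l
    have h2 := TendstoWeakStarBV.sum_mul hΩ hΩb (fun l => h.phase_tendsto l i) hq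
    have h3 : ∀ n x, phaseField ((1 - ε n • N n) * Rε n) (Pε n) (Mε n) x k i =
        ∑ l, (1 - ε n • N n) k l * phaseField (Rε n) (Pε n) (Mε n) x l i := by
      intro n x
      rw [phaseField_mul (hrot n), Matrix.mul_apply]
    have h4 : ∀ x, grad Ω y x k i = ∑ l, (1 : Mat d) k l * grad Ω y x l i := by
      intro x
      rw [← Matrix.mul_apply, one_mul]
    simp only [h3]
    rw [funext h4]
    exact h2
  selection i j hij hi hj hL := by
    have h1 := tendsto_atTop_add_const_right atTop (-‖τ i - τ j‖) (h.selection i j hij hi hj hL)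
    refine tendsto_atTop_mono (fun n => ?_) h1
    have h2 : tε n i - tε n j = (tε n i - ε n • τ i - (tε n j - ε n • τ j)) +
        ε n • (τ i - τ j) := by module
    have h3 := norm_add_le (tε n i - ε n • τ i - (tε n j - ε n • τ j)) (ε n • (τ i - τ j))
    rw [← h2, norm_smul, Real.norm_of_nonneg (hε n).le] at h3
    rw [← sub_eq_add_neg, sub_le_iff_le_add, div_add' _ _ _ (hε n).ne']
    refine div_le_div_of_nonneg_right ?_ (hε n).le
    linarith
  disp_tendsto := h.disp_perturb hΩ.measurableSet hΩb.measure_lt_top.ne hε hyε hN hT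
  grad_tendsto := by
    obtain ⟨gε, g, hg, hga, hgw⟩ := h.grad_tendsto
    exact ⟨fun n x => gε n x + N n * phaseField (Rε n) (Pε n) (Mε n) x,
      fun x => g x + S * grad Ω y x, hSBV g hg,
      fun n => h.approxGrad_perturb hΩ.measurableSet hε τ n (hga n),
      h.weakGrad_perturb hΩ.measurableSet hΩb.measure_lt_top.ne hN hgw⟩

end Perturbation

/-! ### Derivatives of piecewise affine layer maps -/

section

/-- Integration against a signed measure with a density. -/
lemma signedIntegral_withDensityᵥ {X : Type*} [MeasurableSpace X] {μ : Measure X} {f φ : X → ℝ}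
    (hf : Integrable f μ) (hφ : AEStronglyMeasurable φ μ)
    (hfφ : Integrable (fun x => f x * φ x) μ) :
    (∫ᵛ x, φ x ∂•(μ.withDensityᵥ f)) = ∫ x, f x * φ x ∂μ := by
  have hpart : ∀ g : X → ℝ, Integrable g μ → Integrable (fun x => g x * φ x) μ →
      Integrable (fun x => max (g x) 0 * φ x) μ := by
    intro g hg hgφ
    refine hgφ.mono ((hg.aestronglyMeasurable.aemeasurable.max
      aemeasurable_const).aestronglyMeasurable.mul hφ) (ae_of_all _ fun x => ?_)
    rw [norm_mul, norm_mul]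
    refine mul_le_mul_of_nonneg_right ?_ (norm_nonneg _)
    rw [Real.norm_eq_abs, Real.norm_eq_abs, abs_of_nonneg (le_max_right _ _)]
    exact max_le (le_abs_self _) (abs_nonneg _)
  have hneg : Integrable (fun x => -f x * φ x) μ := by
    simpa only [neg_mul] using! hfφ.neg
  have hint : ∀ g : X → ℝ, Integrable g μ → Integrable (fun x => g x * φ x) μ →
      Integrable φ (μ.withDensity fun x => ENNReal.ofReal (g x)) ∧
      ∫ x, φ x ∂(μ.withDensity fun x => ENNReal.ofReal (g x)) = ∫ x, max (g x) 0 * φ x ∂μ := by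
    intro g hg hgφ
    have hm : AEMeasurable (fun x => ENNReal.ofReal (g x)) μ :=
      hg.aestronglyMeasurable.aemeasurable.ennreal_ofReal
    have hlt : ∀ᵐ x ∂μ, ENNReal.ofReal (g x) < ⊤ := ae_of_all _ fun x => ENNReal.ofReal_lt_top
    constructor
    · rw [integrable_withDensity_iff_integrable_smul₀' hm hlt]
      simpa only [ENNReal.toReal_ofReal_eq_iff, ENNReal.toReal_ofReal', smul_eq_mul]
        using! hpart g hg hgφ
    · rw [integral_withDensity_eq_integral_toReal_smul₀ hm hlt]
      simp only [ENNReal.toReal_ofReal', smul_eq_mul]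
  obtain ⟨hp, hp'⟩ := hint f hf hfφ
  obtain ⟨hn, hn'⟩ := hint (fun x => -f x) hf.neg hneg
  have i1 := isFiniteMeasure_withDensity_ofReal hf.2
  have i2 := isFiniteMeasure_withDensity_ofReal hf.neg.2
  simp only [Pi.neg_apply] at i2
  rw [withDensityᵥ_eq_withDensity_pos_part_sub_withDensity_neg_part hf,
    signedIntegral_sub_toSignedMeasure _ _ hp hn, hp', hn',
    ← integral_sub (hpart f hf hfφ) (hpart (fun x => -f x) hf.neg hneg)]
  refine integral_congr_ae (ae_of_all _ fun x => ?_)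
  change max (f x) 0 * φ x - max (-f x) 0 * φ x = f x * φ x
  rw [← sub_mul, max_zero_sub_max_neg_zero_eq_self]

lemma totalVariation_withDensityᵥ_eq_zero {X : Type*} [MeasurableSpace X] {μ : Measure X}
    (f : X → ℝ) {s : Set X} (hs : MeasurableSet s) (h : μ s = 0) :
    SignedMeasure.totalVariation (μ.withDensityᵥ f) s = 0 := by
  refine totalVariation_apply_eq_zero hs fun t hts ht => ?_
  by_cases hf : Integrable f μ
  · rw [withDensityᵥ_apply hf ht, Measure.restrict_eq_zero.2 (measure_mono_null hts h),
      integral_zero_measure]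
  · rw [Measure.withDensityᵥ, dif_neg hf]
    rfl

variable {d : ℕ}

lemma hasLineDerivAt_pderiv {ψ : Vec d → ℝ} (hψ : ContDiff ℝ ∞ ψ) (i : Fin d) (x : Vec d) :
    HasLineDerivAt ℝ ψ (pderiv i ψ x) x (EuclideanSpace.single i 1) :=
  (hψ.differentiable (by simp) x).hasFDerivAt.hasLineDerivAt _

lemma pderiv_mul {f ψ : Vec d → ℝ} (hf : ContDiff ℝ ∞ f) (hψ : ContDiff ℝ ∞ ψ) (i : Fin d)
    (x : Vec d) : pderiv i (fun z => f z * ψ z) x = f x * pderiv i ψ x + pderiv i f x * ψ x := by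
  unfold pderiv
  have h1 := hf.differentiable (by simp) x
  have h2 := hψ.differentiable (by simp) x
  rw [fderiv_fun_mul h1 h2]
  simp [mul_comm]

variable [NeZero d]

/-- The derivative of the indicator function of a half space `{x_d > s}` is a measure carried by the
hyperplane `{x_d = s}`: the surface measure for `∂_d`, and zero for the other derivatives. -/
lemma exists_measure_pderiv_halfspace (s : ℝ) (i : Fin d) :
    ∃ ρ : Measure (Vec d), IsFiniteMeasureOnCompacts ρ ∧ ρ (strip d {s})ᶜ = 0 ∧
      ∀ ψ : Vec d → ℝ, ContDiff ℝ ∞ ψ → HasCompactSupport ψ →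
        ∫ x in strip d (Ioi s), pderiv i ψ x = -∫ x, ψ x ∂ρ := by
  have hS : MeasurableSet (strip d (Ioi s)) := measurableSet_strip measurableSet_Ioi
  by_cases hi : i = ⊤
  · subst hi
    obtain ⟨m, rfl⟩ : ∃ m, d = m + 1 := ⟨d - 1, (Nat.succ_pred (NeZero.ne d)).symm⟩
    set e := layerCoords m with he
    have hemeas : MeasurableEmbedding e := e.toHomeomorph.measurableEmbedding
    have hcl : Topology.IsClosedEmbedding fun z : Fin m → ℝ => e.symm (s, z) :=
      e.symm.toHomeomorph.isClosedEmbedding.comp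
        (.of_continuous_injective_isClosedMap (by fun_prop) (Prod.mk_right_injective s)
          (isClosedMap_prodMk_left s))
    refine ⟨volume.map fun z : Fin m → ℝ => e.symm (s, z), ?_, ?_, ?_⟩
    · refine ⟨fun K hK => ?_⟩
      rw [hcl.measurableEmbedding.map_apply]
      exact (hcl.isCompact_preimage hK).measure_lt_top
    · rw [hcl.measurableEmbedding.map_apply]
      convert measure_empty (μ := (volume : Measure (Fin m → ℝ)))
      refine eq_empty_of_forall_notMem fun z hz => hz ?_
      exact layerCoords_symm_top (s, z)
    · intro ψ hψ hψc
      have hder : ∀ t z, HasDerivAt (fun t => ψ (e.symm (t, z))) (pderiv ⊤ ψ (e.symm (t, z))) t := by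
        intro t z
        have h1 := (hψ.differentiable (by simp) (e.symm (t, z))).hasFDerivAt
        have h2 : HasDerivAt (fun t : ℝ => e.symm (t, z)) (e.symm (1, 0)) t :=
          e.symm.hasFDerivAt.comp_hasDerivAt t ((hasDerivAt_id t).prodMk (hasDerivAt_const t z))
        have h3 : e.symm (1, 0) = EuclideanSpace.single ⊤ (1 : ℝ) := by
          rw [ContinuousLinearEquiv.symm_apply_eq]
          refine Prod.ext ?_ ?_
          · simp [he, layerCoords]
          · funext i
            simp [he, layerCoords, Fin.succAbove_ne]
        rw [h3] at h2
        exact h1.comp_hasDerivAt t h2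
      have hpc : Continuous (pderiv ⊤ ψ) := (hψ.continuous_fderiv (by simp)).clm_apply continuous_const
      have hps : HasCompactSupport (pderiv ⊤ ψ) :=
        hψc.mono' ((subset_tsupport _).trans (tsupport_pderiv_subset ψ ⊤))
      have hint : Integrable (fun z : ℝ × (Fin m → ℝ) => pderiv ⊤ ψ (e.symm z))
          (volume.prod volume) := by
        rw [← Measure.volume_eq_prod]
        exact (hpc.comp e.symm.continuous).integrable_of_hasCompactSupport
          (hps.comp_homeomorph e.symm.toHomeomorph)
      have h1 : ∫ x in strip (m + 1) (Ioi s), pderiv ⊤ ψ x =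
          ∫ z in Ioi s ×ˢ (univ : Set (Fin m → ℝ)), pderiv ⊤ ψ (e.symm z) := by
        rw [← (measurePreserving_layerCoords m).setIntegral_preimage_emb hemeas]
        simp only [← he, ContinuousLinearEquiv.symm_apply_apply]
        congr 2
        ext x
        simp [strip, he, layerCoords_fst]
      rw [h1, Measure.volume_eq_prod, ← Measure.prod_restrict, Measure.restrict_univ,
        integral_prod_symm _ (hint.mono_measure ?_), hcl.measurableEmbedding.integral_map,
        ← integral_neg]
      · refine integral_congr_ae (ae_of_all _ fun z => ?_)
        have h2 : HasCompactSupport fun t => ψ (e.symm (t, z)) :=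
          hψc.comp_isClosedEmbedding
            (e.symm.toHomeomorph.isClosedEmbedding.comp
            (.of_continuous_injective_isClosedMap (by fun_prop) (Prod.mk_left_injective z)
              (isClosedMap_prodMk_right z)))
        have h3 : ContDiff ℝ 1 fun t => ψ (e.symm (t, z)) :=
          (hψ.of_le (by simp)).comp (e.symm.contDiff.comp (contDiff_id.prodMk contDiff_const))
        have h4 := h2.integral_Ioi_deriv_eq h3 s
        simp only [(hder _ z).deriv] at h4
        exact h4
      · exact Measure.prod_mono Measure.restrict_le_self le_rfl
  · refine ⟨0, inferInstance, by simp, fun ψ hψ hψc => ?_⟩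
    have hpc : Continuous (pderiv i ψ) := (hψ.continuous_fderiv (by simp)).clm_apply continuous_const
    have hps : HasCompactSupport (pderiv i ψ) :=
      hψc.mono' ((subset_tsupport _).trans (tsupport_pderiv_subset ψ i))
    -- the indicator function does not depend on `x_i`
    have h := integral_bilinear_hasLineDerivAt_right_eq_neg_left_of_integrable
      (μ := (volume : Measure (Vec d))) (f := (strip d (Ioi s)).indicator fun _ => (1 : ℝ))
      (f' := fun _ => 0) (g := ψ) (g' := pderiv i ψ) (v := EuclideanSpace.single i 1)
      (B := ContinuousLinearMap.mul ℝ ℝ) (by simp) ?_ ?_ ?_ (fun x _ => hasLineDerivAt_pderiv hψ i x)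
    · simp only [ContinuousLinearMap.mul_apply', zero_mul, integral_zero, neg_zero] at h
      rw [← integral_indicator hS, integral_zero_measure, neg_zero, ← h]
      refine integral_congr_ae (ae_of_all _ fun x => ?_)
      by_cases hx : x ∈ strip d (Ioi s) <;> simp [hx]
    · simp only [ContinuousLinearMap.mul_apply']
      refine ((hpc.integrable_of_hasCompactSupport hps).indicator hS).congr (ae_of_all _ fun x => ?_)
      by_cases hx : x ∈ strip d (Ioi s) <;> simp [hx]
    · simp only [ContinuousLinearMap.mul_apply']
      refine ((hψ.continuous.integrable_of_hasCompactSupport hψc).indicator hS).congr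
        (ae_of_all _ fun x => ?_)
      by_cases hx : x ∈ strip d (Ioi s) <;> simp [hx]
    · intro x _
      have : (fun t : ℝ => (strip d (Ioi s)).indicator (fun _ => (1 : ℝ))
          (x + t • EuclideanSpace.single i 1)) =
          fun _ => (strip d (Ioi s)).indicator (fun _ => (1 : ℝ)) x := by
        funext t
        have : (x + t • EuclideanSpace.single i (1 : ℝ)) ⊤ = x ⊤ := by
          simp [Ne.symm hi]
        have hiff : x + t • EuclideanSpace.single i (1 : ℝ) ∈ strip d (Ioi s) ↔
            x ∈ strip d (Ioi s) := by
          change _ ∈ Ioi s ↔ _ ∈ Ioi s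
          rw [this]
        by_cases hx : x ∈ strip d (Ioi s)
        · rw [indicator_of_mem (hiff.2 hx), indicator_of_mem hx]
        · rw [indicator_of_notMem (fun h => hx (hiff.1 h)), indicator_of_notMem hx]
      unfold HasLineDerivAt
      rw [this]
      exact hasDerivAt_const _ _

/-- An affine function cut off at a hyperplane `{x_d = s}` is in `BV`: the singular part of its
derivative is carried by that hyperplane. -/
lemma exists_hasDistribDeriv_halfspace_affine {O : Set (Vec d)} (hO : IsOpen O)
    (hb : Bornology.IsBounded O) (s : ℝ) (L : Vec d →L[ℝ] ℝ) (b : ℝ) (i : Fin d) :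
    ∃ σ : SignedMeasure (Vec d), σ.totalVariation (strip d {s})ᶜ = 0 ∧
      HasDistribDeriv O i ((strip d (Ioi s)).indicator fun x => L x + b)
        ((volume.restrict O).withDensityᵥ
          ((strip d (Ioi s)).indicator fun _ => L (EuclideanSpace.single i 1)) + σ) := by
  obtain ⟨ρ, hρ, hρs, hρψ⟩ := exists_measure_pderiv_halfspace s i
  have hS : MeasurableSet (strip d (Ioi s)) := measurableSet_strip measurableSet_Ioi
  have hs : MeasurableSet (strip d {s}) := measurableSet_strip (measurableSet_singleton s)
  set f : Vec d → ℝ := fun x => L x + b with hf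
  have hfc : ContDiff ℝ ∞ f := L.contDiff.add contDiff_const
  have hon : ∀ (μ : Measure (Vec d)) [IsFiniteMeasureOnCompacts μ] (g : Vec d → ℝ),
      Continuous g → IntegrableOn g O μ := fun μ _ g hg =>
    (hg.continuousOn.integrableOn_compact hb.isCompact_closure).mono_set subset_closure
  have hd : Integrable ((strip d (Ioi s)).indicator fun _ => L (EuclideanSpace.single i (1 : ℝ)))
      (volume.restrict O) := (hon volume _ continuous_const).indicator hS
  have hpf : ∀ x, pderiv i f x = L (EuclideanSpace.single i (1 : ℝ)) := by
    intro x
    unfold pderiv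
    rw [hf, fderiv_add_const, ContinuousLinearMap.fderiv]
  refine ⟨(ρ.restrict O).withDensityᵥ f,
    totalVariation_withDensityᵥ_eq_zero f hs.compl (Measure.restrict_le_self.absolutelyContinuous hρs), ?_, ?_⟩
  · refine totalVariation_add_apply_eq_zero ?_ ?_ <;>
    · refine totalVariation_withDensityᵥ_eq_zero _ hO.measurableSet.compl ?_
      rw [Measure.restrict_apply hO.measurableSet.compl, compl_inter_self, measure_empty]
  · intro φ hφ
    have hφc := hφ.1.continuous
    have h1 : ∀ (μ : Measure (Vec d)) [IsFiniteMeasureOnCompacts μ],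
        Integrable (fun x => f x * φ x) μ := fun μ _ =>
      (hfc.continuous.mul hφc).integrable_of_hasCompactSupport hφ.2.1.mul_left
    have h2 : Integrable (fun x => f x * pderiv i φ x) :=
      (hfc.continuous.mul (hφ.continuous_pderiv i)).integrable_of_hasCompactSupport
        (hφ.hasCompactSupport_pderiv i).mul_left
    have hφ0 : ∀ x ∉ O, φ x = 0 := fun x hx => image_eq_zero_of_notMem_tsupport fun h => hx (hφ.2.2 h)
    have hpφ0 : ∀ x ∉ O, pderiv i φ x = 0 := fun x hx =>
      image_eq_zero_of_notMem_tsupport fun h => hx (hφ.2.2 (tsupport_pderiv_subset φ i h))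
    have key := hρψ (fun x => f x * φ x) (hfc.mul hφ.1) hφ.2.1.mul_left
    simp only [pderiv_mul hfc hφ.1, hpf] at key
    rw [integral_add h2.integrableOn ((hφ.integrable volume).const_mul _).integrableOn] at key
    rw [VectorMeasure.integral_add_vectorMeasure (integrable_variation (hφ.integrable _))
      (integrable_variation (hφ.integrable _)),
      signedIntegral_withDensityᵥ hd hφc.aestronglyMeasurable (hφ.integrable_mul hd),
      signedIntegral_withDensityᵥ (hon ρ f hfc.continuous) hφc.aestronglyMeasurable
        (h1 ρ).integrableOn,
      setIntegral_eq_integral_of_forall_compl_eq_zero fun x hx => by rw [hpφ0 x hx, mul_zero],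
      setIntegral_eq_integral_of_forall_compl_eq_zero fun x hx => by rw [hφ0 x hx, mul_zero],
      setIntegral_eq_integral_of_forall_compl_eq_zero fun x hx => by rw [hφ0 x hx, mul_zero]]
    have e1 : ∀ g h : Vec d → ℝ, ∫ x, (strip d (Ioi s)).indicator g x * h x =
        ∫ x in strip d (Ioi s), g x * h x := by
      intro g h
      rw [← integral_indicator hS]
      refine integral_congr_ae (ae_of_all _ fun x => ?_)
      by_cases hx : x ∈ strip d (Ioi s) <;> simp [hx]
    rw [e1, e1]
    linarith

end

/-! ### Layerwise affine maps with finitely many layers -/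

section

/-- A locally constant function on an interval is constant; the default value `e₀` is used if the
interval is empty. -/
lemma exists_eq_const_Ioo {E : Type*} {a b : ℝ} {α : ℝ → E} (e₀ : E)
    (h : ∀ t ∈ Ioo a b, ∀ᶠ t' in 𝓝 t, α t' = α t) : ∃ c, ∀ t ∈ Ioo a b, α t = c := by
  let _ : TopologicalSpace E := ⊥
  have : DiscreteTopology E := ⟨rfl⟩
  rcases (Ioo a b).eq_empty_or_nonempty with h0 | ⟨t₀, ht₀⟩
  · exact ⟨e₀, by simp [h0]⟩
  · refine ⟨α t₀, fun t ht => isPreconnected_Ioo.constant (f := α) (fun s hs => ?_) ht ht₀⟩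
    exact ((tendsto_const_nhds (x := α s)).congr'
      ((h s hs).mono fun _ hx => hx.symm)).mono_left nhdsWithin_le_nhds

/-- A function on an interval that is locally constant off a finite set is a sum of step
functions. -/
lemma exists_step_sum {E : Type*} [AddCommGroup E] (F : Finset ℝ) : ∀ (a b : ℝ) (α : ℝ → E),
    (∀ t ∈ Ioo a b, t ∉ F → ∀ᶠ t' in 𝓝 t, α t' = α t) →
    ∃ (e₀ : E) (e : ℝ → E), ∀ t ∈ Ioo a b, t ∉ F →
      α t = e₀ + ∑ s ∈ F, if s < t then e s else 0 := by
  induction F using Finset.induction_on_max with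
  | empty =>
    intro a b α h
    obtain ⟨c, hc⟩ := exists_eq_const_Ioo 0 fun t ht => h t ht (by simp)
    exact ⟨c, 0, fun t ht _ => by simp [hc t ht]⟩
  | insert m F hm ih =>
    intro a b α h
    have hmF : m ∉ F := fun hmem => lt_irrefl _ (hm m hmem)
    obtain ⟨e₀, e, he⟩ := ih a (min m b) α fun t ht htF =>
      h t ⟨ht.1, ht.2.trans_le (min_le_right _ _)⟩ fun htF' =>
        (Finset.mem_insert.1 htF').elim (fun h => by
          have := ht.2.trans_le (min_le_left m b)
          exact this.ne h) htF
    -- past the largest exceptional point `m`, the function has a constant value `c`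
    obtain ⟨c, hc⟩ := exists_eq_const_Ioo (a := max a m) (b := b) (α := α) 0 fun t ht =>
      h t ⟨(le_max_left _ _).trans_lt ht.1, ht.2⟩ fun htF' =>
        (Finset.mem_insert.1 htF').elim
          (fun h => ((le_max_right a m).trans_lt ht.1).ne' h)
          (fun h => lt_asymm (hm t h) ((le_max_right a m).trans_lt ht.1))
    refine ⟨e₀, Function.update e m (c - e₀ - ∑ s ∈ F, e s), fun t ht htF => ?_⟩
    have htm : t ≠ m := fun h => htF (h ▸ Finset.mem_insert_self _ _)
    have htF' : t ∉ F := fun h => htF (Finset.mem_insert_of_mem h)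
    have hsum : ∑ s ∈ F, (if s < t then Function.update e m (c - e₀ - ∑ s ∈ F, e s) s else 0) =
        ∑ s ∈ F, if s < t then e s else 0 :=
      Finset.sum_congr rfl fun s hs => by
        rw [Function.update_of_ne (ne_of_mem_of_not_mem hs hmF)]
    rw [Finset.sum_insert hmF, hsum, Function.update_self]
    rcases lt_or_gt_of_ne htm with hlt | hgt
    · rw [if_neg hlt.not_gt, zero_add]
      exact he t ⟨ht.1, lt_min hlt ht.2⟩ htF'
    · have : ∑ s ∈ F, (if s < t then e s else 0) = ∑ s ∈ F, e s :=
        Finset.sum_congr rfl fun s hs => if_pos ((hm s hs).trans hgt)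
      rw [if_pos hgt, this, hc t ⟨max_lt ht.1 hgt, ht.2⟩]
      abel

variable {d : ℕ}

/-- If `w = u + v` near `x` with a continuous `v`, an approximate limit `a` of `w` at `x` along the
sets `S r` gives the approximate limit `a - v x` of `u`. -/
lemma tendsto_setLAverage_sub {S : ℝ → Set (Vec d)} {x a : Vec d} {u v w : Vec d → Vec d}
    {V : Set (Vec d)} (hS : ∀ r, S r ⊆ Metric.ball x r) (hSm : ∀ r, MeasurableSet (S r))
    (hV : V ∈ 𝓝 x) (h : ∀ᵐ z, z ∈ V → w z = u z + v z) (hv : Continuous v)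
    (hw : Tendsto (fun r => ⨍⁻ z in S r, ‖w z - a‖ₑ ∂volume) (𝓝[>] (0 : ℝ)) (𝓝 0)) :
    Tendsto (fun r => ⨍⁻ z in S r, ‖u z - (a - v x)‖ₑ ∂volume) (𝓝[>] (0 : ℝ)) (𝓝 0) := by
  rw [ENNReal.tendsto_nhds_zero] at hw ⊢
  intro η hη
  have hη2 : 0 < η / 2 := ENNReal.half_pos hη.ne'
  have hnear : {z | ‖v z - v x‖ₑ ≤ η / 2} ∩ V ∈ 𝓝 x := by
    refine inter_mem ?_ hV
    have hc : ContinuousAt (fun z => ‖v z - v x‖ₑ) x := by fun_prop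
    have h0 : ‖v x - v x‖ₑ < η / 2 := by simpa using hη2
    exact (hc.eventually (gt_mem_nhds h0)).mono fun z hz => le_of_lt hz
  obtain ⟨δ, hδ, hball⟩ := Metric.mem_nhds_iff.1 hnear
  filter_upwards [hw _ hη2, Ioo_mem_nhdsGT hδ] with r hr hrδ
  rw [setLAverage_eq] at hr ⊢
  have hsub : S r ⊆ {z | ‖v z - v x‖ₑ ≤ η / 2} ∩ V :=
    (hS r).trans ((Metric.ball_subset_ball hrδ.2.le).trans hball)
  have hle : ∫⁻ z in S r, ‖u z - (a - v x)‖ₑ ≤ (∫⁻ z in S r, ‖w z - a‖ₑ) + η / 2 * volume (S r) := by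
    rw [← setLIntegral_const, ← lintegral_add_right _ measurable_const]
    refine lintegral_mono_ae ?_
    rw [ae_restrict_iff' (hSm r)]
    filter_upwards [h] with z hz hzS
    have hzV := hsub hzS
    have : u z - (a - v x) = (w z - a) - (v z - v x) := by rw [hz hzV.2]; abel
    rw [this]
    exact (enorm_sub_le).trans (add_le_add le_rfl hzV.1)
  calc _ ≤ ((∫⁻ z in S r, ‖w z - a‖ₑ) + η / 2 * volume (S r)) / volume (S r) :=
        ENNReal.div_le_div_right hle _
    _ ≤ η / 2 + η / 2 := by
        rw [ENNReal.add_div]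
        exact add_le_add hr (ENNReal.div_le_of_le_mul le_rfl)
    _ = η := ENNReal.add_halves η

/-- Adding a continuous map does not change the jump set. -/
lemma mem_jumpSet_of_add_continuous {O V : Set (Vec d)} {x : Vec d} {u v w : Vec d → Vec d}
    (hV : V ∈ 𝓝 x) (h : ∀ᵐ z, z ∈ V → w z = u z + v z) (hv : Continuous v)
    (hx : x ∈ jumpSet O w) : x ∈ jumpSet O u := by
  obtain ⟨hxO, a, b, ν, hab, hν, ha, hb⟩ := hx
  have hm1 : MeasurableSet {z : Vec d | 0 < ⟪z - x, ν⟫} :=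
    (isOpen_lt continuous_const (by fun_prop)).measurableSet
  have hm2 : MeasurableSet {z : Vec d | ⟪z - x, ν⟫ < 0} :=
    (isOpen_lt (by fun_prop) continuous_const).measurableSet
  exact ⟨hxO, a - v x, b - v x, ν, fun h => hab (sub_left_injective h), hν,
    tendsto_setLAverage_sub (fun r => inter_subset_left)
      (fun r => Metric.isOpen_ball.measurableSet.inter hm1) hV h hv ha,
    tendsto_setLAverage_sub (fun r => inter_subset_left)
      (fun r => Metric.isOpen_ball.measurableSet.inter hm2) hV h hv hb⟩

variable [NeZero d]

/-- Away from countably many heights, a layer partition has one component per height, and this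
component is locally constant in the height. -/
lemma LayerPartition.exists_layer_index {Ω : Set (Vec d)} (hΩ : IsOpen Ω)
    (hslice : ∀ t : ℝ, IsPreconnected (Ω ∩ strip d {t})) {P : ℕ → Set (Vec d)}
    (hP : LayerPartition Ω P) :
    ∃ j : ℝ → ℕ, (∀ t ∈ heights Ω, t ∉ ⋃ i, switchHeights Ω (P i) → ∀ᶠ t' in 𝓝 t, j t' = j t) ∧
      ∀ᵐ x ∂volume.restrict Ω, x ∈ P (j (x ⊤)) := by
  classical
  set good : ℝ → Prop := fun t => ∃ j, ∃ U, IsOpen U ∧ t ∈ U ∧ volume ((Ω \ P j) ∩ strip d U) = 0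
    with hgood
  set j : ℝ → ℕ := fun t => if h : good t then h.choose else 0 with hj
  have hspec : ∀ t, good t → ∃ U, IsOpen U ∧ t ∈ U ∧ volume ((Ω \ P (j t)) ∩ strip d U) = 0 := by
    intro t ht
    simp only [hj, dif_pos ht]
    exact ht.choose_spec
  have hex : ∀ t ∈ heights Ω, t ∉ ⋃ i, switchHeights Ω (P i) → good t := fun t ht htsw =>
    hP.exists_conull hΩ hslice ht fun i hi => htsw (mem_iUnion.2 ⟨i, hi⟩)
  have hloc : ∀ t ∈ heights Ω, good t → ∀ᶠ t' in 𝓝 t, j t' = j t := by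
    intro t ht htg
    obtain ⟨U, hU, htU, hnull⟩ := hspec t htg
    filter_upwards [hU.mem_nhds htU, (isOpen_heights hΩ).mem_nhds ht] with t' htU' ht'
    obtain ⟨U', hU', htU'', hnull'⟩ := hspec t' ⟨j t, U, hU, htU', hnull⟩
    by_contra hne
    refine volume_strip_inter_ne_zero hΩ (hU.inter hU') (t := t') ⟨htU', htU''⟩ ht' ?_
    · refine measure_mono_null (t := (P (j t') ∩ P (j t)) ∪ ((Ω \ P (j t)) ∩ strip d U) ∪
        ((Ω \ P (j t')) ∩ strip d U')) ?_
        (measure_union_null (measure_union_null (hP.1.disjoint _ _ hne) hnull) hnull')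
      intro x hx
      have hxΩ : x ∈ Ω := by simp_all
      have hxU : x ∈ strip d (U ∩ U') := by simp_all
      by_cases h1 : x ∈ P (j t)
      · by_cases h2 : x ∈ P (j t')
        · exact Or.inl (Or.inl ⟨h2, h1⟩)
        · exact Or.inr ⟨⟨hxΩ, h2⟩, hxU.2⟩
      · exact Or.inl (Or.inr ⟨⟨hxΩ, h1⟩, hxU.1⟩)
  refine ⟨j, fun t ht htsw => hloc t ht (hex t ht htsw), ?_⟩
  have hcount : volume (strip d ((⋃ i, switchHeights Ω (P i)) ∩ heights Ω)) = 0 :=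
    volume_strip_countable (hP.countable_inter_heights hΩ hslice)
  have hnull : volume {x | x ∈ Ω ∧ good (x ⊤) ∧ x ∉ P (j (x ⊤))} = 0 := by
    refine measure_null_of_locally_null _ fun x hx => ?_
    obtain ⟨U, hU, hxU, hnull⟩ := hspec _ hx.2.1
    refine ⟨_, ?_, hnull⟩
    filter_upwards [self_mem_nhdsWithin, mem_nhdsWithin_of_mem_nhds
      (continuous_top.continuousAt.eventually (hloc _ ⟨x, hx.1, rfl⟩ hx.2.1)),
      mem_nhdsWithin_of_mem_nhds ((isOpen_strip hU).mem_nhds hxU)] with z hz hzj hzU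
    have hz3 := hz.2.2
    rw [show j (z ⊤) = j (x ⊤) from hzj] at hz3
    exact ⟨⟨hz.1, hz3⟩, hzU⟩
  rw [ae_restrict_iff' hΩ.measurableSet]
  filter_upwards [compl_mem_ae_iff.2 hcount, compl_mem_ae_iff.2 hnull] with x h1 h2 hxΩ
  by_contra hxP
  refine h2 ⟨hxΩ, hex _ ⟨x, hxΩ, rfl⟩ fun hsw => h1 ⟨hsw, x, hxΩ, rfl⟩, hxP⟩

/-- The function `f` on `O` has the derivative `D_i f = g ℒ + σ`, with a singular part `σ` that is
carried by finitely many hyperplanes `{x_d = s}`. -/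
def HasLayeredDeriv (O : Set (Vec d)) (i : Fin d) (f g : Vec d → ℝ) : Prop :=
  IntegrableOn f O ∧ IntegrableOn g O ∧ ∃ F : Set ℝ, F.Finite ∧ ∃ σ : SignedMeasure (Vec d),
    σ.totalVariation (strip d F)ᶜ = 0 ∧
    HasDistribDeriv O i f ((volume.restrict O).withDensityᵥ g + σ)

namespace HasLayeredDeriv

variable {O : Set (Vec d)} {i : Fin d} {f f' g g' : Vec d → ℝ}

lemma congr (h : HasLayeredDeriv O i f g) (hf : f =ᵐ[volume.restrict O] f')
    (hg : g =ᵐ[volume.restrict O] g') : HasLayeredDeriv O i f' g' := by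
  obtain ⟨h1, h2, F, hF, σ, hσ, hD⟩ := h
  refine ⟨h1.congr hf, h2.congr hg, F, hF, σ, hσ, ?_⟩
  rw [← WithDensityᵥEq.congr_ae hg]
  exact hD.congr hf

lemma add (h : HasLayeredDeriv O i f g) (h' : HasLayeredDeriv O i f' g') :
    HasLayeredDeriv O i (fun x => f x + f' x) (fun x => g x + g' x) := by
  obtain ⟨h1, h2, F, hF, σ, hσ, hD⟩ := h
  obtain ⟨h1', h2', F', hF', σ', hσ', hD'⟩ := h'
  refine ⟨h1.add h1', h2.add h2', F ∪ F', hF.union hF', σ + σ', ?_, ?_⟩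
  · refine totalVariation_add_apply_eq_zero (measure_mono_null ?_ hσ) (measure_mono_null ?_ hσ')
    · exact compl_subset_compl.2 fun x hx => Or.inl hx
    · exact compl_subset_compl.2 fun x hx => Or.inr hx
  · rw [withDensityᵥ_add' h2 h2', add_add_add_comm]
    exact hD.add hD' h1 h1'

lemma sum {ι : Type*} (t : Finset ι) {f g : ι → Vec d → ℝ}
    (h : ∀ l ∈ t, HasLayeredDeriv O i (f l) (g l)) :
    HasLayeredDeriv O i (fun x => ∑ l ∈ t, f l x) (fun x => ∑ l ∈ t, g l x) := by
  classical
  induction t using Finset.induction_on with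
  | empty =>
    refine ⟨by simp, by simp, ∅, finite_empty, 0, by simp [SignedMeasure.totalVariation_zero], ?_⟩
    have : ((volume.restrict O).withDensityᵥ fun _ : Vec d => (0 : ℝ)) = 0 := withDensityᵥ_zero
    simp only [Finset.sum_empty, this, add_zero]
    exact HasDistribDeriv.zero
  | insert a t ha ih =>
    simp only [Finset.sum_insert ha]
    exact (h a (by simp)).add (ih fun l hl => h l (by simp [hl]))

end HasLayeredDeriv

/-- An affine function, cut off to the half space `{x_d > s}`, has a single layer. -/
lemma hasLayeredDeriv_halfspace {O : Set (Vec d)} (hO : IsOpen O)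
    (hb : Bornology.IsBounded O) (s : ℝ) (L : Vec d →L[ℝ] ℝ) (b : ℝ) (i : Fin d) :
    HasLayeredDeriv O i ((strip d (Ioi s)).indicator fun x => L x + b)
      ((strip d (Ioi s)).indicator fun _ => L (EuclideanSpace.single i 1)) := by
  have hS : MeasurableSet (strip d (Ioi s)) := measurableSet_strip measurableSet_Ioi
  have hon : ∀ g : Vec d → ℝ, Continuous g → IntegrableOn g O := fun g hg =>
    (hg.continuousOn.integrableOn_compact hb.isCompact_closure).mono_set subset_closure
  obtain ⟨σ, h⟩ := exists_hasDistribDeriv_halfspace_affine hO hb s L b i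
  exact ⟨(hon _ (by fun_prop)).indicator hS, (hon _ continuous_const).indicator hS, {s},
    finite_singleton s, σ, h⟩

/-- A function that is affine on layers, with finitely many layers, has a layered derivative. -/
lemma hasLayeredDeriv_of_layers {O : Set (Vec d)} (hO : IsOpen O) (hb : Bornology.IsBounded O)
    {a b : ℝ} (hab : ∀ x ∈ O, x ⊤ ∈ Ioo a b) (F : Finset ℝ) (α : ℝ → (Vec d →L[ℝ] ℝ) × ℝ)
    (hα : ∀ t ∈ Ioo a b, t ∉ F → ∀ᶠ t' in 𝓝 t, α t' = α t) (i : Fin d) :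
    HasLayeredDeriv O i (fun x => (α (x ⊤)).1 x + (α (x ⊤)).2)
      (fun x => (α (x ⊤)).1 (EuclideanSpace.single i 1)) := by
  obtain ⟨e₀, e, he⟩ := exists_step_sum F a b α hα
  have h := (hasLayeredDeriv_halfspace hO hb a e₀.1 e₀.2 i).add
    (HasLayeredDeriv.sum F fun s _ => hasLayeredDeriv_halfspace hO hb s (e s).1 (e s).2 i)
  have hF : ∀ᵐ x ∂volume.restrict O, x ∈ O ∧ x ⊤ ∉ F := by
    rw [ae_restrict_iff' hO.measurableSet]
    filter_upwards [compl_mem_ae_iff.2 (volume_strip_countable (d := d) F.countable_toSet)]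
      with x hx hxO
    exact ⟨hxO, hx⟩
  have hind : ∀ (s : ℝ) (g : Vec d → ℝ) (x : Vec d),
      (strip d (Ioi s)).indicator g x = if s < x ⊤ then g x else 0 := fun s g x => by
    classical
    rw [indicator_apply]
    rfl
  refine h.congr ?_ ?_
  · filter_upwards [hF] with x hx
    rw [he _ (hab x hx.1) hx.2, hind, if_pos (hab x hx.1).1]
    simp only [hind, Prod.fst_add, Prod.snd_add, Prod.fst_sum, Prod.snd_sum,
      _root_.add_apply, _root_.sum_apply]
    rw [add_add_add_comm, ← Finset.sum_add_distrib]
    congr 1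
    refine Finset.sum_congr rfl fun s _ => ?_
    split_ifs <;> simp
  · filter_upwards [hF] with x hx
    rw [he _ (hab x hx.1) hx.2, hind, if_pos (hab x hx.1).1]
    simp only [hind, Prod.fst_add, Prod.fst_sum,
      _root_.add_apply, _root_.sum_apply]
    congr 1
    refine Finset.sum_congr rfl fun s _ => ?_
    split_ifs <;> simp

end

/-! ### Stability of `SBV²_loc` under layerwise affine perturbations -/

section

variable {d : ℕ} [NeZero d]

lemma inLayers_iff_countable {S : Set (Vec d)} :
    InLayers S ↔ ∃ C : Set ℝ, C.Countable ∧ S ⊆ strip d C := by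
  constructor
  · rintro ⟨s, hs⟩
    refine ⟨range s, countable_range s, fun x hx => ?_⟩
    obtain ⟨i, hi⟩ := mem_iUnion.1 (hs hx)
    exact ⟨i, Eq.symm hi⟩
  · rintro ⟨C, hC, hS⟩
    obtain ⟨s, hs⟩ := (hC.insert 0).exists_eq_range (insert_nonempty _ _)
    refine ⟨s, fun x hx => ?_⟩
    have h1 : x ⊤ ∈ insert 0 C := Or.inr (hS hx)
    rw [hs] at h1
    obtain ⟨i, hi⟩ := h1
    exact mem_iUnion.2 ⟨i, hi.symm⟩

/-- The heights of a set compactly contained in `Ω` lie in an interval of heights of `Ω` that meets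
only finitely many layers of a layer partition. -/
lemma LayerPartition.exists_Ioo {Ω O : Set (Vec d)} (hΩ : IsOpen Ω) (hΩc : IsPreconnected Ω)
    (hslice : ∀ t : ℝ, IsPreconnected (Ω ∩ strip d {t})) {P : ℕ → Set (Vec d)}
    (hP : LayerPartition Ω P) (hO : CompactlyIn O Ω) :
    ∃ a b, (∀ x ∈ O, x ⊤ ∈ Ioo a b) ∧ Ioo a b ⊆ heights Ω ∧
      ((⋃ j, switchHeights Ω (P j)) ∩ Ioo a b).Finite := by
  rcases O.eq_empty_or_nonempty with rfl | hne
  · exact ⟨0, 0, by simp, by simp, by simp⟩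
  have hK : IsCompact (heights (closure O)) := hO.2.1.image continuous_top
  have hKne : (heights (closure O)).Nonempty := hne.closure.image _
  have hKΩ : heights (closure O) ⊆ heights Ω := image_mono hO.2.2
  obtain ⟨m, hm⟩ := hK.exists_isLeast hKne
  obtain ⟨M, hM⟩ := hK.exists_isGreatest hKne
  have hopen := isOpen_heights hΩ
  obtain ⟨a, ham, ha⟩ : ∃ a < m, a ∈ heights Ω := by
    have h1 : ∀ᶠ t in 𝓝[<] m, t ∈ heights Ω :=
      mem_nhdsWithin_of_mem_nhds (hopen.mem_nhds (hKΩ hm.1))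
    obtain ⟨a, h2, h3⟩ := (h1.and self_mem_nhdsWithin).exists
    exact ⟨a, h3, h2⟩
  obtain ⟨b, hMb, hb⟩ : ∃ b > M, b ∈ heights Ω := by
    have h1 : ∀ᶠ t in 𝓝[>] M, t ∈ heights Ω :=
      mem_nhdsWithin_of_mem_nhds (hopen.mem_nhds (hKΩ hM.1))
    obtain ⟨b, h2, h3⟩ := (h1.and self_mem_nhdsWithin).exists
    exact ⟨b, h3, h2⟩
  have hIcc : Icc a b ⊆ heights Ω :=
    (hΩc.image _ continuous_top.continuousOn).ordConnected.out ha hb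
  refine ⟨a, b, fun x hx => ?_, Ioo_subset_Icc_self.trans hIcc,
    (hP.finite_inter_compact hΩ hslice isCompact_Icc hIcc).subset
      (inter_subset_inter_right _ Ioo_subset_Icc_self)⟩
  have hx' : x ⊤ ∈ heights (closure O) := ⟨x, subset_closure hx, rfl⟩
  exact ⟨ham.trans_le (hm.2 hx'), (hM.2 hx').trans_lt hMb⟩

variable {Ω : Set (Vec d)} {u T : Vec d → Vec d} {g B : Vec d → Mat d} {A : ℕ → Mat d}
  {τ : ℕ → Vec d} {j : ℝ → ℕ} {bad : Set ℝ}

/-- A layerwise affine map creates jumps only at the heights at which the layer changes. -/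
lemma jumpSet_add_layerwise_subset (hΩ : IsOpen Ω)
    (hj : ∀ t ∈ heights Ω, t ∉ bad → ∀ᶠ t' in 𝓝 t, j t' = j t)
    (hT : ∀ᵐ x ∂volume.restrict Ω, T x = act (A (j (x ⊤))) x + τ (j (x ⊤)))
    {O : Set (Vec d)} (hO : O ⊆ Ω) :
    jumpSet O (u + T) ⊆ jumpSet O u ∪ (O ∩ strip d bad) := by
  intro x hx
  by_cases hb : x ⊤ ∈ bad
  · exact Or.inr ⟨hx.1, hb⟩
  have hxΩ := hO hx.1
  refine Or.inl (mem_jumpSet_of_add_continuous (v := fun z => act (A (j (x ⊤))) z + τ (j (x ⊤)))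
    (inter_mem (hΩ.mem_nhds hxΩ)
      (continuous_top.continuousAt.eventually (hj _ ⟨x, hxΩ, rfl⟩ hb))) ?_ ?_ hx)
  · rw [ae_restrict_iff' hΩ.measurableSet] at hT
    filter_upwards [hT] with z hz hzV
    have h2 : j (z ⊤) = j (x ⊤) := hzV.2
    have h3 := hz hzV.1
    rw [h2] at h3
    rw [Pi.add_apply, h3]
  · have h1 : Continuous fun z : Vec d => act (A (j (x ⊤))) z :=
      continuous_act.comp (continuous_const.prodMk continuous_id)
    exact h1.add continuous_const

/-- Adding a map with layered derivatives to a map in `SBV²`: the derivative of the sum does not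
charge the complement of its jump set by the trace theorem, applied on each of the countably many
hyperplanes that carry the singular parts. -/
lemma MemSBV2.add_layered {O : Set (Vec d)} (hO : IsOpen O) (hu : MemSBV2 O u g)
    (hJ : InLayers (jumpSet O u)) (hL : ∀ k i, HasLayeredDeriv O i (fun x => T x k) (fun x => B x k i))
    (hB : ∀ k i, MemLp (fun x => B x k i) 2 (volume.restrict O))
    (hJw : μH[(d : ℝ) - 1] (jumpSet O (u + T)) < ⊤) :
    MemSBV2 O (u + T) (fun x => g x + B x) := by
  obtain ⟨hu1, hg1, hg2, -, σ, hσ⟩ := hu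
  choose hT1 hB1 F hF σT hσT hDT using hL
  obtain ⟨C, hC, hJC⟩ := inLayers_iff_countable.1 hJ
  have hw : IntegrableOn (u + T) O := hu1.add (Integrable.of_eval_piLp fun k => hT1 k k)
  have hD : ∀ k i, HasDistribDeriv O i (fun x => (u + T) x k)
      ((volume.restrict O).withDensityᵥ (fun x => (g x + B x) k i) + (σ k i + σT k i)) := by
    intro k i
    have h1 : (volume.restrict O).withDensityᵥ (fun x => (g x + B x) k i) =
        (volume.restrict O).withDensityᵥ (fun x => g x k i) +
          (volume.restrict O).withDensityᵥ (fun x => B x k i) :=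
      withDensityᵥ_add' (hg1 k i) (hB1 k i)
    rw [h1, add_add_add_comm]
    exact (hσ k i).2.2.add (hDT k i)
      ((EuclideanSpace.proj (𝕜 := ℝ) k).integrable_comp hu1) (hT1 k i)
  refine ⟨hw, fun k i => (hg1 k i).add (hB1 k i), fun k i => (hg2 k i).add (hB k i), hJw,
    fun k i => σ k i + σT k i, fun k i => ⟨?_, ?_, hD k i⟩⟩
  · have h1 : (σT k i).totalVariation ⟂ₘ volume :=
      ⟨(strip d (F k i))ᶜ, (measurableSet_strip (hF k i).measurableSet).compl, hσT k i, by
        rw [compl_compl]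
        exact volume_strip_countable (hF k i).countable⟩
    exact ((hσ k i).1.add_left h1).mono (totalVariation_add_le _ _) le_rfl
  -- the singular part is carried by countably many hyperplanes
  · have hcarr : (σ k i + σT k i).totalVariation (strip d (C ∪ F k i))ᶜ = 0 := by
      refine totalVariation_add_apply_eq_zero (measure_mono_null ?_ (hσ k i).2.1)
        (measure_mono_null ?_ (hσT k i))
      · exact compl_subset_compl.2 fun x hx => Or.inl (hJC hx)
      · exact compl_subset_compl.2 fun x hx => Or.inr hx
    have hstrip : ∀ s, (σ k i + σT k i).totalVariation (strip d {s} \ jumpSet O (u + T)) = 0 := by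
      intro s
      have h1 := totalVariation_strip_diff_jumpSet hO hw hD s k i
      have h2 : SignedMeasure.totalVariation ((volume.restrict O).withDensityᵥ
          (fun x => (g x + B x) k i)) (strip d {s} \ jumpSet O (u + T)) = 0 :=
        measure_mono_null sdiff_subset (totalVariation_withDensityᵥ_eq_zero _
          (measurableSet_strip (measurableSet_singleton s))
          (Measure.restrict_le_self.absolutelyContinuous (volume_hyperplane s)))
      -- the singular part is the derivative minus its density
      have h3 := totalVariation_add_apply_eq_zero h1 (totalVariation_smul_apply_eq_zero (-1 : ℝ) h2)
      convert h3 using 3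
      module
    refine measure_mono_null (t := (strip d (C ∪ F k i))ᶜ ∪
      ⋃ s ∈ C ∪ F k i, strip d {s} \ jumpSet O (u + T)) ?_ (measure_union_null hcarr
        ((measure_biUnion_null_iff (hC.union (hF k i).countable)).2 fun s _ => hstrip s))
    intro x hx
    by_cases h : x ∈ strip d (C ∪ F k i)
    · exact Or.inr (mem_biUnion h ⟨rfl, hx⟩)
    · exact Or.inl h

/-- Limiting displacements are stable under maps that are affine on each component of a layer
partition. -/
theorem LimitDisplacement.add_layerwise (hΩ : IsOpen Ω) (hΩc : IsPreconnected Ω)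
    (hslice : ∀ t : ℝ, IsPreconnected (Ω ∩ strip d {t})) {P : ℕ → Set (Vec d)}
    (hP : LayerPartition Ω P)
    (hT : ∀ᵐ x ∂volume.restrict Ω, ∀ j, x ∈ P j → T x = act (A j) x + τ j ∧ B x = A j)
    {c : ℝ} (hA : ∀ j k i, |A j k i| ≤ c) (h : LimitDisplacement Ω u g) :
    LimitDisplacement Ω (u + T) (fun x => g x + B x) := by
  obtain ⟨j, hj, hjP⟩ := hP.exists_layer_index hΩ hslice
  set bad := ⋃ i, switchHeights Ω (P i) with hbad
  have hTB : ∀ᵐ x ∂volume.restrict Ω,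
      T x = act (A (j (x ⊤))) x + τ (j (x ⊤)) ∧ B x = A (j (x ⊤)) := by
    filter_upwards [hT, hjP] with x h1 h2
    exact h1 _ h2
  have hsub : ∀ {O : Set (Vec d)}, O ⊆ Ω →
      jumpSet O (u + T) ⊆ jumpSet O u ∪ (O ∩ strip d bad) := fun hO =>
    jumpSet_add_layerwise_subset hΩ hj (hTB.mono fun _ hx => hx.1) hO
  obtain ⟨C, hC, hJC⟩ := inLayers_iff_countable.1 h.2
  refine ⟨fun O hO => ?_, inLayers_iff_countable.2 ⟨C ∪ (bad ∩ heights Ω),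
    hC.union (hP.countable_inter_heights hΩ hslice), ?_⟩⟩
  swap
  · rintro x hx
    rcases hsub Subset.rfl hx with h1 | h1
    · exact Or.inl (hJC h1)
    · exact Or.inr ⟨h1.2, x, h1.1, rfl⟩
  have hOΩ : O ⊆ Ω := subset_closure.trans hO.2.2
  have hOb : Bornology.IsBounded O := hO.2.1.isBounded.subset subset_closure
  obtain ⟨a, b, hab, habΩ, hfin⟩ := hP.exists_Ioo hΩ hΩc hslice hO
  have hTBO : ∀ᵐ x ∂volume.restrict O,
      T x = act (A (j (x ⊤))) x + τ (j (x ⊤)) ∧ B x = A (j (x ⊤)) :=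
    ae_restrict_of_ae_restrict_of_subset hOΩ hTB
  have hJu : jumpSet O u ⊆ jumpSet Ω u := fun x hx => ⟨hOΩ hx.1, hx.2⟩
  have hL : ∀ k i, HasLayeredDeriv O i (fun x => T x k) (fun x => B x k i) := by
    intro k i
    set L : Mat d → (Vec d →L[ℝ] ℝ) := fun M => (EuclideanSpace.proj k).comp
      (LinearMap.toContinuousLinearMap (Matrix.toEuclideanLin M)) with hLdef
    have hLact : ∀ M x, L M x = act M x k := fun M x => rfl
    refine (hasLayeredDeriv_of_layers hO.1 hOb hab hfin.toFinset
      (fun t => (L (A (j t)), τ (j t) k)) (fun t ht htF => ?_) i).congr ?_ ?_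
    · have htb : t ∉ bad := fun h => htF (hfin.mem_toFinset.2 ⟨h, ht⟩)
      filter_upwards [hj t (habΩ ht) htb] with t' ht'
      rw [ht']
    · filter_upwards [hTBO] with x hx
      simp only [hx.1, hLact, PiLp.add_apply]
    · filter_upwards [hTBO] with x hx
      simp only [hx.2, hLact, act_apply]
      simp
  refine (h.1 O hO).add_layered hO.1 (inLayers_iff_countable.2 ⟨C, hC, hJu.trans hJC⟩) hL
    (fun k i => ?_) ?_
  · have := hOb.measure_lt_top (μ := volume)
    have : IsFiniteMeasure (volume.restrict O) := ⟨by simpa using this⟩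
    refine MemLp.of_bound (hL k i).2.1.aestronglyMeasurable c ?_
    filter_upwards [hTBO] with x hx
    rw [hx.2]
    exact hA _ k i
  · refine (measure_mono ((hsub hOΩ).trans (union_subset_union_right _
      (t₂ := ⋃ t ∈ bad ∩ Ioo a b, O ∩ strip d {t}) ?_))).trans_lt
      ((measure_union_le _ _).trans_lt (ENNReal.add_lt_top.2 ⟨(h.1 O hO).2.2.2.1,
        measure_biUnion_lt_top hfin fun t _ => hausdorffMeasure_slice_lt_top hOb t⟩))
    intro x hx
    exact mem_biUnion (show x ⊤ ∈ bad ∩ Ioo a b from ⟨hx.2, hab x hx.1⟩) ⟨hx.1, rfl⟩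

variable {κ p : ℝ} {ε : ℕ → ℝ} {yε : ℕ → Vec d → Vec d} {y : Vec d → Vec d}

/-- Admissible triples are stable under the addition of maps in `𝒯(y, 𝒫)`. -/
theorem AdmissibleTriple.add_piecewiseTranslation {P : ℕ → Set (Vec d)}
    (h : AdmissibleTriple Ω κ p ε yε y u P) (hΩ : IsOpen Ω) (hΩc : IsPreconnected Ω)
    (hΩb : Bornology.IsBounded Ω)
    (hslice : ∀ t : ℝ, IsPreconnected (Ω ∩ strip d {t})) (hε : ∀ n, 0 < ε n)
    (hε0 : Tendsto ε atTop (𝓝 0)) (hyε : ∀ n, MemH2 Ω (yε n))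
    (hT : T ∈ piecewiseTranslations Ω y P) : AdmissibleTriple Ω κ p ε yε y (u + T) P := by
  obtain ⟨Rε, Pε, Mε, tε, h⟩ := h
  obtain ⟨τ, S, hS, hT⟩ := hT
  obtain ⟨N, hN, hrot⟩ := exists_rotation_expansion hS hε0
  have hΩm := hΩ.measurableSet
  obtain ⟨R, hR, -, hRε⟩ := h.rot_tendsto
  have hex : ∀ j, ∃ L ∈ wells d κ, ∀ᵐ x : Vec d, x ∈ P j → grad Ω y x = R * L := by
    intro j
    by_cases hj : volume (P j) = 0
    · exact ⟨1, Or.inl rfl, (measure_eq_zero_iff_ae_notMem.1 hj).mono fun x hx hxj => absurd hxj hx⟩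
    · obtain ⟨L, hL, -, -, hg⟩ := h.exists_phase hΩm hΩb.measure_lt_top.ne hR hRε hj
      exact ⟨L, hL, (ae_restrict_iff' (h.limit_part.1.measurableSet j)).1 hg⟩
  choose L hL hgrad using hex
  obtain ⟨c, hc⟩ : ∃ c, ∀ M ∈ wells d κ, ∀ k i, |(S * (R * M)) k i| ≤ c := by
    obtain ⟨c, hc⟩ := ((finite_wells (d := d) (κ := κ)).image
      fun M => ∑ k, ∑ i, |(S * (R * M)) k i|).bddAbove
    refine ⟨c, fun M hM k i => le_trans ?_ (hc (mem_image_of_mem _ hM))⟩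
    exact (Finset.single_le_sum (f := fun i => |(S * (R * M)) k i|)
      (fun _ _ => abs_nonneg _) (Finset.mem_univ i)).trans
      (Finset.single_le_sum (f := fun k => ∑ i, |(S * (R * M)) k i|)
        (fun _ _ => Finset.sum_nonneg fun _ _ => abs_nonneg _) (Finset.mem_univ k))
  refine ⟨_, _, _, _, h.perturb hΩ hΩb hε hε0 hyε hN hrot hT fun g hg =>
    hg.add_layerwise hΩ hΩc hslice h.limit_part (A := fun j => S * (R * L j)) (τ := τ) ?_
      fun j => hc _ (hL j)⟩
  filter_upwards [hT, h.limit_part.1.ae_exists_unique hΩm, ae_restrict_of_ae (ae_all_iff.2 hgrad)]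
    with x hx hux hgx j hj
  obtain ⟨j', hj', huniq⟩ := hux
  obtain rfl := huniq j hj
  rw [hx, tsum_indicator_eq (fun i _ => τ i) hj' huniq, hgx j hj, add_comm]
  exact ⟨rfl, rfl⟩

end

end TwoWell

end

theorem proposition3p5 {d : ℕ} [NeZero d] (hd : 2 ≤ d)
    (Ω : Set (Vec d)) (hΩ : IsLipschitzDomain Ω) (hΩb : Bornology.IsBounded Ω)
    (hslice : ∀ t : ℝ, IsPreconnected (Ω ∩ {x | x ⊤ = t}))
    (κ : ℝ) (hκ : 0 < κ) (W : Mat d → ℝ) (hW : IsTwoWellDensity κ W)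
    (p : ℝ) (hp : 1 < p ∧ p < 2)
    (ε : ℕ → ℝ) (hε : ∀ n, 0 < ε n) (hε0 : Tendsto ε atTop (𝓝 0))
    (yε : ℕ → Vec d → Vec d) (hyε : ∀ n, MemH2 Ω (yε n))
    (C₀ : ℝ≥0) (hC₀ : ∀ n, energy Ω W (ε n) (yε n) ≤ C₀)
    (y₁ u₁ : Vec d → Vec d) (P₁ : ℕ → Set (Vec d))
    (y₂ u₂ : Vec d → Vec d) (P₂ : ℕ → Set (Vec d))
    (h₁ : AdmissibleTriple Ω κ p ε yε y₁ u₁ P₁)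
    (h₂ : AdmissibleTriple Ω κ p ε yε y₂ u₂ P₂) :
    (y₁ =ᵐ[volume.restrict Ω] y₂ ∧
      ∃ π : Equiv.Perm ℕ, ∀ j, P₁ j =ᵐ[volume] P₂ (π j)) ∧
    (piecewiseTranslations Ω y₁ P₁ = piecewiseTranslations Ω y₂ P₂ ∧
      ∃ T ∈ piecewiseTranslations Ω y₁ P₁, u₁ - u₂ =ᵐ[volume.restrict Ω] T) ∧
    ∀ T ∈ piecewiseTranslations Ω y₁ P₁, AdmissibleTriple Ω κ p ε yε y₁ (u₁ + T) P₁ := by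
  have hΩm : MeasurableSet Ω := hΩ.isOpen.measurableSet
  have hΩt : volume Ω ≠ ⊤ := hΩb.measure_lt_top.ne
  have hΩ0 : volume Ω ≠ 0 := (hΩ.isOpen.measure_pos volume hΩ.isConnected.nonempty).ne'
  obtain ⟨h12, h34⟩ := h₁.unique h₂ hyε hΩm hΩt hΩ0 hκ hε hε0
  refine ⟨h12, h34, ?_⟩
  exact fun T hT => h₁.add_piecewiseTranslation hΩ.isOpen hΩ.isConnected.isPreconnected hΩb hslice
    hε hε0 hyε hT
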